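/- Let $\Sigma$ be a smooth complex curve (a Hausdorff one-dimensional complex manifold). A regular spectral curve $(\Sigma,x,y,\omega_{0,2})$ consists of (possibly multivalued, ill-defined at isolated points) functions $x,y$ with $\mathrm{d}x,\mathrm{d}y$ meromorphic on $\Sigma$, such that the set $\mathfrak{a}$ of zeros of $\mathrm{d}x$ is finite, all these zeros are simple, and $y$ is holomorphic with $\mathrm{d}y(a)\neq 0$ at every $a\in\mathfrak{a}$; and of a symmetric bidifferential $\omega_{0,2}$ on $\Sigma\times\Sigma$, holomorphic off the diagonal, and of the form $\frac{\mathrm{d}w_1\mathrm{d}w_2}{(w_1-w_2)^2}+\text{holomorphic}$ near the diagonal in any local coordinate $w$. For $a\in\mathfrak{a}$ let $\sigma_a$ be the non-trivial holomorphic map near $a$, fixing $a$, with $x\circ\sigma_a=x$, and put $$K_a(z_1,z)=\frac{\frac12\int_{\sigma_a(z)}^{z}\omega_{0,2}(z_1,\cdot)}{(y(z)-y(\sigma_a(z)))\,\mathrm{d}x(z)}.$$ The correlators $\omega_{g,n}$ ($g\ge 0$, $n\ge 1$, $2g-2+n>0$) are defined by induction on $2g-2+n$ by $$\omega_{g,n}(z_1,\dots,z_n)=\sum_{a\in\mathfrak{a}}\operatorname*{Res}_{z=a}K_a(z_1,z)\Big(\omega_{g-1,n+1}(z,\sigma_a(z),z_2,\dots,z_n)+\sum\omega_{g_1,1+|J_1|}(z,z_{J_1})\,\omega_{g_2,1+|J_2|}(\sigma_a(z),z_{J_2})\Big),$$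 where the first term is absent for $g=0$ and the inner sum runs over $g_1+g_2=g$ and $J_1\sqcup J_2=\{2,\dots,n\}$ with $(g_i,1+|J_i|)\neq(0,1)$ for $i=1,2$. The free energies are, for $g\ge2$, $$F_g=\omega_{g,0}=\frac{1}{2-2g}\sum_{a\in\mathfrak{a}}\operatorname*{Res}_{z=a}\Big(\int_a^z y\,\mathrm{d}x\Big)\omega_{g,1}(z).$$ Then the following hold for every regular spectral curve. (1) Let $Z$ be a local coordinate on an open set $U\subset\Sigma\setminus\mathfrak{a}$ and $K\subset U$ compact. There are constants $T,B,C>0$ such that for all $g\ge0$, $n\ge1$ with $2g-2+n>0$ and all $z_1,\dots,z_n\in K$ $$\left|\frac{\omega_{g,n}(z_1,\dots,z_n)}{\mathrm{d}Z(z_1)\cdots\mathrm{d}Z(z_n)}\right|\le T\,\frac{(3g-3+2n)!}{B^g\,C^n\,g!\,n!}.$$ Moreover there is a constant $A>0$ and, for each $n\ge1$, a constant $S_n>0$ such that for all $g\ge 0$ with $2g-2+n>0$ and all $z_1,\dots,z_n\in K$ $$\left|\frac{\omega_{g,n}(z_1,\dots,z_n)}{\mathrm{d}Z(z_1)\cdots\mathrm{d}Z(z_n)}\right|\le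 S_n\,\frac{\Gamma(2g-2+n)}{A^{2g-2+n}}.$$ (2) Let $n\ge1$, let $Z_1,\dots,Z_n$ be local coordinates on open sets $U_1,\dots,U_n\subset\Sigma\setminus\mathfrak{a}$ and let $K_i\subset U_i$ be compact. There are constants $S,A>0$ such that for all $g\ge 0$ with $2g-2+n>0$ and all $z_i\in K_i$ $$\left|\frac{\omega_{g,n}(z_1,\dots,z_n)}{\mathrm{d}Z_1(z_1)\cdots\mathrm{d}Z_n(z_n)}\right|\le S\,\frac{\Gamma(2g-2+n)}{A^{2g-2+n}}.$$ (3) There are constants $S_0,A_0>0$ such that for all $g\ge2$ $$|F_g|\le S_0\,\frac{\Gamma(2g-2)}{A_0^{2g-2}}.$$ -/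

import Mathlib

open scoped Manifold ContDiff Topology

noncomputable section

namespace TopRec

/-- Tangent vectors of a complex curve `X` (a point together with a vector of the holomorphic
tangent line at that point). Differentials, bidifferentials and multidifferentials are treated as
functions of one, two or several tangent vectors, linear in each of them. -/
abbrev TVec (X : Type*) [TopologicalSpace X] [ChartedSpace ℂ X] : Type _ :=
  TangentBundle 𝓘(ℂ) X

/-- A (not necessarily continuous) `1`-form of type `(1,0)`: a linear form on each tangent line. -/
abbrev OneForm (X : Type*) [TopologicalSpace X] [ChartedSpace ℂ X] : Type _ :=
  ∀ p : X, TangentSpace 𝓘(ℂ) p →L[ℂ] ℂ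

/-- A bidifferential: a bilinear form on each product of two tangent lines. -/
abbrev BiForm (X : Type*) [TopologicalSpace X] [ChartedSpace ℂ X] : Type _ :=
  ∀ p q : X, TangentSpace 𝓘(ℂ) p →L[ℂ] TangentSpace 𝓘(ℂ) q →L[ℂ] ℂ

/-- The residue at `c` of a function which is holomorphic in a punctured neighbourhood of `c`:
`(2πi)⁻¹ ∮ f` over all sufficiently small circles around `c`. -/
def residue (f : ℂ → ℂ) (c : ℂ) : ℂ :=
  Filter.limUnder (𝓝[>] (0 : ℝ)) fun r : ℝ =>
    (2 * (Real.pi : ℂ) * Complex.I)⁻¹ * ∮ w in C(c, r), f w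

section Curve

variable {X : Type*} [TopologicalSpace X] [ChartedSpace ℂ X]

/-- The coordinate vector field `∂/∂Z` of a local coordinate `Z`, at the point whose coordinate is
`w`. It is the tangent vector on which `dZ` takes the value `1`. -/
def coordVec (Z : OpenPartialHomeomorph X ℂ) (w : ℂ) : TVec X :=
  ⟨Z.symm w, mfderiv 𝓘(ℂ) 𝓘(ℂ) Z.symm w (1 : ℂ)⟩

/-- The value of a `1`-form on a tangent vector. -/
def OneForm.eval (η : OneForm X) (v : TVec X) : ℂ := η v.proj v.snd

/-- The value of a bidifferential on two tangent vectors. -/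
def BiForm.eval (B : BiForm X) (v w : TVec X) : ℂ := B v.proj w.proj v.snd w.snd

/-- The coefficient function `f` of a `1`-form `η = f dZ` in a local coordinate `Z`. -/
def OneForm.coeff (η : OneForm X) (Z : OpenPartialHomeomorph X ℂ) (w : ℂ) : ℂ :=
  η.eval (coordVec Z w)

/-- A `1`-form is meromorphic if its coefficient in a local coordinate at any point is. -/
def OneForm.IsMeromorphic (η : OneForm X) : Prop :=
  ∀ p : X, MeromorphicAt (η.coeff (chartAt ℂ p)) (chartAt ℂ p p)

/-- The order of a meromorphic `1`-form at a point. -/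
def OneForm.ord (η : OneForm X) (p : X) : WithTop ℤ :=
  meromorphicOrderAt (η.coeff (chartAt ℂ p)) (chartAt ℂ p p)

/-- `f` is, in a neighbourhood of `p`, a holomorphic function with `df = η`. -/
def IsPrimitiveNear (f : X → ℂ) (η : OneForm X) (p : X) : Prop :=
  ∀ᶠ z in 𝓝 p, MDifferentiableAt 𝓘(ℂ) 𝓘(ℂ) f z ∧
    ∀ v : TangentSpace 𝓘(ℂ) z, η z v = mfderiv 𝓘(ℂ) 𝓘(ℂ) f z v

/-- Residue at `a` of a `1`-form, given as a function of tangent vectors. -/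
def residueAt (a : X) (η : TVec X → ℂ) : ℂ :=
  residue (fun w => η (coordVec (chartAt ℂ a) w)) (chartAt ℂ a a)

/-- The integral of a `1`-form, given as a function of tangent vectors, from `p` to `q`
along the path that is a straight segment in the chart at `a` (used only for `p`, `q` near `a`). -/
def localIntegral (a : X) (η : TVec X → ℂ) (p q : X) : ℂ :=
  ∫ t in (0 : ℝ)..1,
    η (coordVec (chartAt ℂ a) (chartAt ℂ a p + (t : ℂ) * (chartAt ℂ a q - chartAt ℂ a p))) *
      (chartAt ℂ a q - chartAt ℂ a p)

/-- A bidifferential which is symmetric, holomorphic away from the diagonal, and which in every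
local coordinate is `dw₁ dw₂ / (w₁ - w₂)² + holomorphic` near the diagonal: a double pole with
biresidue `1` (and no residue). -/
structure BiForm.IsFundamental [IsManifold 𝓘(ℂ) ω X] (B : BiForm X) : Prop where
  symm : ∀ (p q : X) (v : TangentSpace 𝓘(ℂ) p) (w : TangentSpace 𝓘(ℂ) q), B p q v w = B q p w v
  holomorphic : ∀ Z ∈ IsManifold.maximalAtlas 𝓘(ℂ) ω X, ∀ Z' ∈ IsManifold.maximalAtlas 𝓘(ℂ) ω X,
    AnalyticOnNhd ℂ (fun w : ℂ × ℂ => B.eval (coordVec Z w.1) (coordVec Z' w.2))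
      {w | w.1 ∈ Z.target ∧ w.2 ∈ Z'.target ∧ Z.symm w.1 ≠ Z'.symm w.2}
  diagonal : ∀ Z ∈ IsManifold.maximalAtlas 𝓘(ℂ) ω X, ∃ h : ℂ × ℂ → ℂ,
    AnalyticOnNhd ℂ h (Z.target ×ˢ Z.target) ∧
    ∀ w₁ ∈ Z.target, ∀ w₂ ∈ Z.target, w₁ ≠ w₂ →
      B.eval (coordVec Z w₁) (coordVec Z w₂) = 1 / (w₁ - w₂) ^ 2 + h (w₁, w₂)

end Curve

/-- A spectral curve `(X, x, y, ω₀₂)` on a smooth complex curve `X` whose ramification points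
(zeros of `dx`) are simple and finite in number.

The functions `x`, `y` may be multivalued and undefined at isolated points; what is globally defined
are the meromorphic forms `dx`, `dy`. The fields `x`, `y` record single-valued branches of the two
functions near the ramification points; their values elsewhere are irrelevant. -/
structure SpectralCurve (X : Type*) [TopologicalSpace X] [ChartedSpace ℂ X]
    [IsManifold 𝓘(ℂ) ω X] where
  dx : OneForm X
  dy : OneForm X
  dx_meromorphic : dx.IsMeromorphic
  dy_meromorphic : dy.IsMeromorphic
  x : X → ℂ
  y : X → ℂ
  x_branch : ∀ a, 0 < dx.ord a → IsPrimitiveNear x dx a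
  y_branch : ∀ a, 0 < dx.ord a → 0 ≤ dy.ord a → IsPrimitiveNear y dy a
  ω₀₂ : BiForm X
  fundamental : ω₀₂.IsFundamental
  finite_zeros : {a | 0 < dx.ord a}.Finite
  simple_zeros : ∀ a, 0 < dx.ord a → dx.ord a = 1

namespace SpectralCurve

variable {X : Type*} [TopologicalSpace X] [ChartedSpace ℂ X] [IsManifold 𝓘(ℂ) ω X]

/-- The finite set `𝔞` of ramification points: the zeros of `dx`. -/
def ram (S : SpectralCurve X) : Finset X := S.finite_zeros.toFinset

/-- A spectral curve is regular if at each ramification point `y` is holomorphic and `dy` does not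
vanish. -/
def IsRegular (S : SpectralCurve X) : Prop := ∀ a ∈ S.ram, S.dy.ord a = 0

/-- `σ` is, near the ramification point `a`, the Galois involution: the nontrivial holomorphic map
fixing `a` such that `x ∘ σ = x`. -/
structure IsGaloisInvolution (S : SpectralCurve X) (a : X) (σ : X → X) : Prop where
  fixes : σ a = a
  holomorphic : ∀ᶠ z in 𝓝 a, MDifferentiableAt 𝓘(ℂ) 𝓘(ℂ) σ z
  x_comp : ∀ᶠ z in 𝓝 a, S.x (σ z) = S.x z
  nontrivial : ¬ ∀ᶠ z in 𝓝 a, σ z = z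

/-- The Galois involution `σ_a` near `a` (its germ at `a` is unique). -/
def galois (S : SpectralCurve X) (a : X) : X → X :=
  @Classical.epsilon (X → X) ⟨id⟩ (S.IsGaloisInvolution a)

/-- The recursion kernel
`K_a(z₁, z) = ½ ∫_{σ_a(z)}^z ω₀₂(z₁, ·) / ((y(z) - y(σ_a(z))) dx(z))`,
evaluated on a tangent vector `v` at `z₁` and a tangent vector `u` at `z`. -/
def kernel (S : SpectralCurve X) (a : X) (v u : TVec X) : ℂ :=
  (1 / 2 * localIntegral a (S.ω₀₂.eval v) (S.galois a u.proj) u.proj) /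
    ((S.y u.proj - S.y (S.galois a u.proj)) * S.dx.eval u)

/-- The sub-tuple `v_J` of a tuple `v`, for a set `J` of indices. -/
def subTuple {m : ℕ} (v : Fin m → TVec X) (J : Finset (Fin m)) : Fin J.card → TVec X :=
  fun i => v (J.orderEmbOfFin rfl i)

/-- The correlator `ω_{g,n}`, as a function of `n` tangent vectors, defined by the topological
recursion: `u` is the vector `∂/∂w` at the integration point `z`, so that the arguments `z` and
`σ_a(z)` of the correlators receive `u` and its image `u'` under the differential of `σ_a`.
The values for `n = 0` and `(g,n) = (0,1)` are placeholders that the recursion never uses. -/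
def correlator (S : SpectralCurve X) : (g n : ℕ) → (Fin n → TVec X) → ℂ
  | _, 0, _ => 0
  | g, m + 1, v =>
    if g = 0 ∧ m = 0 then 0
    else if h02 : g = 0 ∧ m = 1 then S.ω₀₂.eval (v 0) (v ⟨1, by omega⟩)
    else ∑ a ∈ S.ram, residueAt a fun u =>
      let u' := tangentMap 𝓘(ℂ) 𝓘(ℂ) (S.galois a) u
      S.kernel a (v 0) u *
        ((if hg : g = 0 then 0
          else correlator S (g - 1) (m + 2) (Fin.cons u (Fin.cons u' (Fin.tail v)))) +
        ∑ k : Fin (g + 1), ∑ J : Finset (Fin m),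
          if hs : ((k : ℕ) = 0 ∧ J.card = 0) ∨ (g - k = 0 ∧ Jᶜ.card = 0) then 0
          else
            correlator S k (J.card + 1) (Fin.cons u (subTuple (Fin.tail v) J)) *
            correlator S (g - k) (Jᶜ.card + 1) (Fin.cons u' (subTuple (Fin.tail v) Jᶜ)))
termination_by g n => 2 * g + n
decreasing_by
  · omega
  · have h1 := Finset.card_add_card_compl J
    have h2 := k.2
    rw [Fintype.card_fin] at h1
    omega
  · have h1 := Finset.card_add_card_compl J
    have h2 := k.2
    rw [Fintype.card_fin] at h1
    omega

/-- The free energy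
`F_g = ω_{g,0} = (2 - 2g)⁻¹ ∑_a Res_{z = a} (∫_a^z y dx) ω_{g,1}(z)`, for `g ≥ 2`. -/
def freeEnergy (S : SpectralCurve X) (g : ℕ) : ℂ :=
  1 / (2 - 2 * (g : ℂ)) * ∑ a ∈ S.ram, residueAt a fun u =>
    localIntegral a (fun v => S.y v.proj * S.dx.eval v) a u.proj * S.correlator g 1 ![u]

/-- The quotient `ω_{g,n}(z₁,…,zₙ) / (dZ₁(z₁) ⋯ dZₙ(zₙ))`: the coefficient of `ω_{g,n}` in the local
coordinates `Z₁,…,Zₙ`. -/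
def correlatorCoeff (S : SpectralCurve X) (g : ℕ) {n : ℕ} (Z : Fin n → OpenPartialHomeomorph X ℂ)
    (z : Fin n → X) : ℂ :=
  S.correlator g n fun i => coordVec (Z i) (Z i (z i))

end SpectralCurve

end TopRec

end

/-! Near a ramification point `a` choose a coordinate `z` with `x = x(a) + z^2`. The Galois
involution becomes `z ↦ -z`, and the recursion kernel becomes an odd holomorphic function of `z`
times a factor with a double pole that does not depend on `z_1`. The Taylor coefficients of the odd
function are the forms `ξ_{a,k}(z_1)`, `k` even, obtained by expanding `ω_{0,2}(z_1, ·)` at `a`.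
Taking a residue against the kernel therefore produces a finite combination of the `ξ_{a,k}`
(`IsSpecialChart.hasResidue_kernel_mul`). By induction `ω_{g,n}` is a finite combination of products
`ξ_{a_1,k_1}(z_1) ⋯ ξ_{a_n,k_n}(z_n)` with `k_1 + ⋯ + k_n ≤ 6g - 6 + 2n`, and the theorem reduces to
estimating the coefficients.

With `P = 2g - 1 + n` the coefficient of total order `d` is shown to be at most `M_P w(6g - 6 + 2n -
d)`, where `w(e) = ρ^e / (1 + e)^2` for `e ≥ 0`, `w(e) = 0` for `e < 0`, and `M_P = L^(P-1) P! /
(P+1)^2`. This is `Frame.exists_hasExp_correlator`. Three mechanisms close the induction.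

The structure constants of the recursion are residues, so integrating over a circle of fixed radius
`R` bounds them by powers of `1/R`. The choice `ρ = 2/R` absorbs these powers into `w`, and `w` is
stable under convolution (`sum_weight_mul_weight_le`), so a convolved sum over intermediate orders
costs only a constant.

In the term of genus `g - 1` one of the two intermediate sums is not a convolution and costs a
factor linear in `P`. A factor `ω_{0,2}` likewise has coefficients growing linearly with the order.
Both losses are paid for by `P! = P (P-1)!` (`majorant_pred_le`).

In the quadratic terms the number of ways to distribute the points and the genus is compensated by
the binomial coefficients in `p! q! = P! / binom(P, p)` (`sum_majorant_mul_le`). Since every term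
also gains a factor `1/L`, a large `L` absorbs all the constants.

Off the ramification points the `ξ_{a,k}` grow at most exponentially in `k`, uniformly on compact
sets, and `P!` exceeds `(2g+n-3)!` only by an exponential factor. Hence `|ω_{g,n}| ≤ E^(2g+n)
(2g+n-3)!`, uniformly in `g` and `n` (`Frame.Admissible.norm_correlator_le`). All bounds on
correlators follow from this one. For the free energies it is applied to `ω_{g,1}` on circles about
the ramification points. -/

noncomputable section

namespace TopRec

open Metric Filter

/-! ### Residues as eventually constant circle integrals -/

/-- `r` is the residue of `f` at `c`, in the sense that the normalized integrals over all small
circles are equal to `r`. -/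
def HasResidue (f : ℂ → ℂ) (c r : ℂ) : Prop :=
  ∀ᶠ ε : ℝ in 𝓝[>] 0, CircleIntegrable f c ε ∧
    (2 * (Real.pi : ℂ) * Complex.I)⁻¹ * ∮ w in C(c, ε), f w = r

theorem HasResidue.residue_eq {f : ℂ → ℂ} {c r : ℂ} (h : HasResidue f c r) : residue f c = r := by
  refine Tendsto.limUnder_eq ?_
  refine tendsto_const_nhds.congr' ?_
  filter_upwards [h] with ε hε using hε.2.symm

theorem eventually_sphere_of_nhdsNE {c : ℂ} {p : ℂ → Prop} (h : ∀ᶠ w in 𝓝[≠] c, p w) :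
    ∀ᶠ ε : ℝ in 𝓝[>] 0, ∀ w ∈ sphere c ε, p w := by
  rw [eventually_nhdsWithin_iff, Metric.eventually_nhds_iff] at h
  obtain ⟨δ, hδ, h⟩ := h
  filter_upwards [Ioo_mem_nhdsGT hδ] with ε hε w hw
  refine h (by rw [mem_sphere.1 hw]; exact hε.2) ?_
  rintro rfl
  have := hε.1
  simp_all

theorem HasResidue.congr {f g : ℂ → ℂ} {c r : ℂ} (h : HasResidue f c r)
    (hfg : ∀ᶠ w in 𝓝[≠] c, f w = g w) : HasResidue g c r := by
  filter_upwards [h, eventually_sphere_of_nhdsNE hfg, self_mem_nhdsWithin] with ε h1 h2 h3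
  have h3 : 0 < ε := h3
  refine ⟨h1.1.congr_codiscreteWithin ?_, ?_⟩
  · rw [abs_of_pos h3]
    filter_upwards [self_mem_codiscreteWithin _] with w hw using h2 w hw
  · rw [← h1.2]
    congr 1
    exact (circleIntegral.integral_congr h3.le h2).symm

theorem HasResidue.add {f g : ℂ → ℂ} {c r s : ℂ} (hf : HasResidue f c r) (hg : HasResidue g c s) :
    HasResidue (fun w => f w + g w) c (r + s) := by
  filter_upwards [hf, hg] with ε h1 h2
  refine ⟨h1.1.add h2.1, ?_⟩
  rw [circleIntegral.integral_add h1.1 h2.1, mul_add, h1.2, h2.2]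

theorem HasResidue.const_mul {f : ℂ → ℂ} {c r : ℂ} (a : ℂ) (hf : HasResidue f c r) :
    HasResidue (fun w => a * f w) c (a * r) := by
  filter_upwards [hf] with ε h1
  refine ⟨h1.1.const_fun_smul (a := a), ?_⟩
  rw [circleIntegral.integral_const_mul, mul_left_comm, h1.2]

theorem hasResidue_zero (c : ℂ) : HasResidue (fun _ => 0) c 0 := by
  filter_upwards with ε
  exact ⟨circleIntegrable_const 0 c ε, by simp [circleIntegral]⟩

/-- A function with a primitive has vanishing circle integrals, so only `a / (w - c)` contributes.
No Laurent expansion is needed, only a primitive on a punctured neighbourhood. -/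
theorem hasResidue_of_hasDerivAt {f Q : ℂ → ℂ} {c a : ℂ}
    (hf : ∀ᶠ w in 𝓝[≠] c, ContinuousAt f w)
    (h : ∀ᶠ w in 𝓝[≠] c, HasDerivAt Q (f w - a * (w - c)⁻¹) w) : HasResidue f c a := by
  filter_upwards [eventually_sphere_of_nhdsNE hf, eventually_sphere_of_nhdsNE h,
    self_mem_nhdsWithin] with ε h1 h2 h3
  have h3 : 0 < ε := h3
  have hi : CircleIntegrable f c ε :=
    ContinuousOn.circleIntegrable h3.le fun w hw => (h1 w hw).continuousWithinAt
  refine ⟨hi, ?_⟩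
  have hj : CircleIntegrable (fun w => a * (w - c)⁻¹) c ε := by
    refine ContinuousOn.circleIntegrable h3.le fun w hw => ?_
    have : w - c ≠ 0 := by
      rw [← norm_pos_iff, ← dist_eq_norm, mem_sphere.1 hw]; exact h3
    fun_prop (disch := assumption)
  have h4 := circleIntegral.integral_eq_zero_of_hasDerivWithinAt h3.le
    (fun w hw => (h2 w hw).hasDerivWithinAt)
  rw [circleIntegral.integral_sub hi hj, circleIntegral.integral_const_mul,
    circleIntegral.integral_sub_center_inv c h3.ne', sub_eq_zero] at h4
  rw [h4]
  have := Complex.two_pi_I_ne_zero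
  field_simp

theorem exists_primitive_of_analyticAt {f : ℂ → ℂ} {c : ℂ} (hf : AnalyticAt ℂ f c) :
    ∃ Q : ℂ → ℂ, AnalyticAt ℂ Q c ∧ ∀ᶠ w in 𝓝 c, HasDerivAt Q (f w) w := by
  obtain ⟨r, hr, h⟩ := Metric.eventually_nhds_iff_ball.1 hf.eventually_analyticAt
  obtain ⟨Q, hQ⟩ := DifferentiableOn.isExactOn_ball (c := c) (r := r) (f := f)
    fun w hw => (h w hw).differentiableAt.differentiableWithinAt
  have hb : ball c r ∈ 𝓝 c := ball_mem_nhds c hr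
  refine ⟨Q, ?_, ?_⟩
  · exact DifferentiableOn.analyticAt (s := ball c r)
      (fun w hw => (hQ w hw).differentiableAt.differentiableWithinAt) hb
  · filter_upwards [hb] with w hw using hQ w hw

/-- The remainder is the `N`-fold iterated divided difference at `0`. Since `dslope` is defined
everywhere, the identity is global although `f` is analytic only near `0`. -/
theorem taylor_eq {f : ℂ → ℂ} (hf : AnalyticAt ℂ f 0) (N : ℕ) :
    ∃ r : ℂ → ℂ, AnalyticAt ℂ r 0 ∧ ∀ z : ℂ,
      f z = ∑ j ∈ Finset.range N, iteratedDeriv j f 0 / (j.factorial : ℂ) * z ^ j + z ^ N * r z := by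
  have hp := hf.hasFPowerSeriesAt
  set p := FormalMultilinearSeries.ofScalars ℂ
    (fun n : ℕ => iteratedDeriv n f 0 / (n.factorial : ℂ)) with hpdef
  have hN : ∀ N, HasFPowerSeriesAt ((Function.swap dslope 0)^[N] f)
      (FormalMultilinearSeries.fslope^[N] p) 0 := fun N =>
    HasFPowerSeriesAt.has_fpower_series_iterate_dslope_fslope N hp
  refine ⟨(Function.swap dslope 0)^[N] f, (hN N).analyticAt, fun z => ?_⟩
  induction N with
  | zero => simp
  | succ N ih =>
    rw [ih, Finset.sum_range_succ, add_assoc, Function.iterate_succ_apply']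
    congr 1
    have h1 : (Function.swap dslope 0)^[N] f 0 = iteratedDeriv N f 0 / (N.factorial : ℂ) := by
      have := (hN N).coeff_zero 1
      rw [← (hN N).coeff_zero (fun _ => 1)]
      have h2 := FormalMultilinearSeries.coeff_iterate_fslope (p := p) N 0
      rw [FormalMultilinearSeries.coeff] at h2
      rw [show (fun _ : Fin 0 => (1 : ℂ)) = 1 from rfl, h2]
      simp [hpdef, FormalMultilinearSeries.coeff_ofScalars]
    have h3 := sub_smul_dslope ((Function.swap dslope 0)^[N] f) 0 z
    rw [sub_zero, smul_eq_mul, h1] at h3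
    have h4 : (Function.swap dslope 0)^[N] f z = iteratedDeriv N f 0 / (N.factorial : ℂ)
        + z * dslope ((Function.swap dslope 0)^[N] f) 0 z := by rw [h3]; ring
    rw [h4, Function.swap]
    ring

/-! ### Poles of bounded order and their residues -/

/-- `f` has at `0` a pole of order at most `d`. -/
def PoleAt (d : ℤ) (f : ℂ → ℂ) : Prop :=
  ∃ h : ℂ → ℂ, AnalyticAt ℂ h 0 ∧ ∀ᶠ z in 𝓝[≠] 0, f z = z ^ (-d) * h z

theorem AnalyticAt.poleAt {f : ℂ → ℂ} (hf : AnalyticAt ℂ f 0) : PoleAt 0 f :=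
  ⟨f, hf, by simp⟩

theorem poleAt_zpow (k : ℤ) : PoleAt (-k) (fun z => z ^ k) :=
  ⟨fun _ => 1, analyticAt_const, by simp⟩

theorem PoleAt.mul {d e : ℤ} {f g : ℂ → ℂ} (hf : PoleAt d f) (hg : PoleAt e g) :
    PoleAt (d + e) (fun z => f z * g z) := by
  obtain ⟨h, h1, h2⟩ := hf
  obtain ⟨k, k1, k2⟩ := hg
  refine ⟨fun z => h z * k z, h1.mul k1, ?_⟩
  filter_upwards [h2, k2, self_mem_nhdsWithin] with z e1 e2 hz
  rw [e1, e2, neg_add, zpow_add₀ hz]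
  ring

theorem PoleAt.mono {d e : ℤ} {f : ℂ → ℂ} (hf : PoleAt d f) (hde : d ≤ e) : PoleAt e f := by
  obtain ⟨h, h1, h2⟩ := hf
  obtain ⟨n, hn⟩ := Int.eq_ofNat_of_zero_le (sub_nonneg.2 hde)
  refine ⟨fun z => z ^ n * h z, (analyticAt_id.pow n).mul h1, ?_⟩
  filter_upwards [h2, self_mem_nhdsWithin] with z e1 hz
  rw [e1, ← mul_assoc, ← zpow_natCast, ← zpow_add₀ hz, ← hn]
  congr 2
  ring

theorem PoleAt.add {d : ℤ} {f g : ℂ → ℂ} (hf : PoleAt d f) (hg : PoleAt d g) :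
    PoleAt d (fun z => f z + g z) := by
  obtain ⟨h, h1, h2⟩ := hf
  obtain ⟨k, k1, k2⟩ := hg
  refine ⟨fun z => h z + k z, h1.add k1, ?_⟩
  filter_upwards [h2, k2] with z e1 e2
  rw [e1, e2, mul_add]

theorem PoleAt.const_mul {d : ℤ} {f : ℂ → ℂ} (a : ℂ) (hf : PoleAt d f) :
    PoleAt d (fun z => a * f z) := by
  obtain ⟨h, h1, h2⟩ := hf
  refine ⟨fun z => a * h z, analyticAt_const.mul h1, ?_⟩
  filter_upwards [h2] with z e1
  rw [e1]; ring

theorem poleAt_zero (d : ℤ) : PoleAt d (fun _ => 0) :=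
  ⟨fun _ => 0, analyticAt_const, by simp⟩

theorem PoleAt.sum {ι : Type*} {d : ℤ} {s : Finset ι} {f : ι → ℂ → ℂ}
    (hf : ∀ i ∈ s, PoleAt d (f i)) : PoleAt d (fun z => ∑ i ∈ s, f i z) := by
  classical
  induction s using Finset.induction_on with
  | empty => simpa using poleAt_zero d
  | insert a s ha ih =>
    simp only [Finset.sum_insert ha]
    exact (hf a (by simp)).add (ih fun i hi => hf i (by simp [hi]))

theorem PoleAt.congr {d : ℤ} {f g : ℂ → ℂ} (hf : PoleAt d f) (h : ∀ᶠ z in 𝓝[≠] 0, f z = g z) :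
    PoleAt d g := by
  obtain ⟨k, k1, k2⟩ := hf
  refine ⟨k, k1, ?_⟩
  filter_upwards [k2, h] with z e1 e2
  rw [← e2, e1]

theorem tendsto_neg_nhdsNE : Tendsto (fun z : ℂ => -z) (𝓝[≠] 0) (𝓝[≠] 0) := by
  have := (continuous_neg (G := ℂ)).tendsto 0
  rw [neg_zero] at this
  refine tendsto_nhdsWithin_iff.2 ⟨this.mono_left nhdsWithin_le_nhds, ?_⟩
  filter_upwards [self_mem_nhdsWithin] with z hz
  simpa using hz

theorem PoleAt.comp_neg {d : ℤ} {f : ℂ → ℂ} (hf : PoleAt d f) : PoleAt d (fun z => f (-z)) := by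
  obtain ⟨k, k1, k2⟩ := hf
  refine ⟨fun z => (-1) ^ (-d) * k (-z), ?_, ?_⟩
  · refine analyticAt_const.mul ?_
    exact AnalyticAt.comp_of_eq (g := k) (f := fun z : ℂ => -z) k1 analyticAt_id.neg (by simp)
  · filter_upwards [tendsto_neg_nhdsNE.eventually k2] with z hz
    rw [hz, neg_eq_neg_one_mul z, mul_zpow]
    ring

theorem PoleAt.meromorphicAt {d : ℤ} {f : ℂ → ℂ} (hf : PoleAt d f) : MeromorphicAt f 0 := by
  obtain ⟨h, h1, h2⟩ := hf
  refine MeromorphicAt.congr (f := fun z => z ^ (-d) * h z) ?_ ?_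
  · exact ((MeromorphicAt.id 0).zpow (-d)).mul h1.meromorphicAt
  · filter_upwards [h2] with z hz using hz.symm

/-- Laurent terms are peeled off one at a time. Each has a primitive except `z⁻¹`, whose coefficient
is collected in `a`. -/
theorem PoleAt.exists_primitive {d : ℤ} {f : ℂ → ℂ} (hf : PoleAt d f) :
    ∃ (a : ℂ) (P : ℂ → ℂ), (∀ᶠ z in 𝓝[≠] 0, HasDerivAt P (f z - a * z⁻¹) z) ∧
      (d ≤ 0 → a = 0) := by
  have key : ∀ (n : ℕ) (h : ℂ → ℂ), AnalyticAt ℂ h 0 → ∃ (a : ℂ) (P : ℂ → ℂ),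
      (∀ᶠ z in 𝓝[≠] 0, HasDerivAt P (z ^ (-(n : ℤ)) * h z - a * z⁻¹) z) ∧ (n = 0 → a = 0) := by
    intro n
    induction n with
    | zero =>
      intro h hh
      obtain ⟨Q, -, hQ⟩ := exists_primitive_of_analyticAt hh
      exact ⟨0, Q, by simpa using hQ.filter_mono nhdsWithin_le_nhds, fun _ => rfl⟩
    | succ n ih =>
      intro h hh
      obtain ⟨r, hr, hz⟩ := taylor_eq hh 1
      obtain ⟨a, P, hP, -⟩ := ih r hr
      simp only [Finset.range_one, Finset.sum_singleton, pow_zero, mul_one, pow_one] at hz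
      set b : ℂ := iteratedDeriv 0 h 0 / ((0 : ℕ).factorial : ℂ)
      have hdec : ∀ z : ℂ, z ≠ 0 → z ^ (-((n + 1 : ℕ) : ℤ)) * h z =
          b * z ^ (-((n + 1 : ℕ) : ℤ)) + z ^ (-(n : ℤ)) * r z := by
        intro z h0
        rw [hz z, show (-(n : ℤ)) = -((n + 1 : ℕ) : ℤ) + 1 by push_cast; ring, zpow_add₀ h0,
          zpow_one]
        ring
      -- The removed term is `b z^(-(n+1))`. For `n = 0` it goes into the residue; for `n > 0` it is
      -- integrated.
      rcases Nat.eq_zero_or_pos n with rfl | hn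
      · refine ⟨a + b, P, ?_, by simp⟩
        filter_upwards [hP, self_mem_nhdsWithin] with z h1 h0
        refine h1.congr_deriv ?_
        rw [hdec z h0]
        simp
        ring
      · refine ⟨a, fun z => P z + b * (-(n : ℂ))⁻¹ * z ^ (-(n : ℤ)), ?_, by simp⟩
        filter_upwards [hP, self_mem_nhdsWithin] with z h1 h0
        have h2 := (hasDerivAt_zpow (-(n : ℤ)) z (Or.inl h0)).const_mul (b * (-(n : ℂ))⁻¹)
        refine (h1.add h2).congr_deriv ?_
        rw [hdec z h0, show -((n + 1 : ℕ) : ℤ) = -(n : ℤ) - 1 by push_cast; ring]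
        have : (n : ℂ) ≠ 0 := by exact_mod_cast hn.ne'
        push_cast
        field_simp
        ring
  obtain ⟨h, h1, h2⟩ := hf.mono (Int.self_le_toNat d)
  obtain ⟨a, P, hP, ha⟩ := key d.toNat h h1
  refine ⟨a, P, ?_, fun hd => ha (by omega)⟩
  filter_upwards [hP, h2] with z e1 e2
  rwa [e2]

/-- Invariance of the residue under a holomorphic change of the coordinate. -/
theorem hasResidue_comp {G κ f : ℂ → ℂ} {c a : ℂ} {P : ℂ → ℂ} (hG : MeromorphicAt G 0)
    (hP : ∀ᶠ z in 𝓝[≠] 0, HasDerivAt P (G z - a * z⁻¹) z)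
    (hκ : AnalyticAt ℂ κ c) (h0 : κ c = 0) (h1 : deriv κ c ≠ 0)
    (hf : ∀ᶠ w in 𝓝[≠] c, f w = deriv κ w * G (κ w)) :
    MeromorphicAt f c ∧ HasResidue f c a := by
  have hmero : MeromorphicAt f c := by
    refine MeromorphicAt.congr (f := fun w => deriv κ w * G (κ w)) ?_ ?_
    · exact hκ.deriv.meromorphicAt.mul
        (MeromorphicAt.comp_analyticAt (f := G) (by rwa [h0]) hκ)
    · filter_upwards [hf] with w hw using hw.symm
  refine ⟨hmero, ?_⟩
  have hu : AnalyticAt ℂ (dslope κ c) c := by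
    obtain ⟨p, hp⟩ := hκ
    exact hp.has_fpower_series_dslope_fslope.analyticAt
  have hu0 : dslope κ c c ≠ 0 := by rwa [dslope_same]
  have hκu : ∀ w, κ w = (w - c) * dslope κ c w := fun w => by
    have := sub_smul_dslope κ c w
    rw [h0, sub_zero, smul_eq_mul] at this
    exact this.symm
  -- Write `κ = (w - c) u` with `u(c) ≠ 0`. Then `κ'/κ = 1/(w - c) + u'/u`, and `L` is a holomorphic
  -- logarithm of `u`. So `a κ'/κ` and `a/(w - c)` differ by an exact term.
  obtain ⟨L, -, hL⟩ := exists_primitive_of_analyticAt (hu.deriv.div hu hu0)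
  refine hasResidue_of_hasDerivAt (Q := fun w => P (κ w) + a * L w) ?_ ?_
  · filter_upwards [hmero.eventually_analyticAt] with w hw using hw.continuousAt
  · have hκt : Tendsto κ (𝓝[≠] c) (𝓝[≠] 0) := by
      refine tendsto_nhdsWithin_iff.2 ⟨?_, ?_⟩
      · have := hκ.continuousAt.tendsto
        rw [h0] at this
        exact this.mono_left nhdsWithin_le_nhds
      · filter_upwards [(hu.continuousAt.eventually_ne hu0).filter_mono nhdsWithin_le_nhds,
          self_mem_nhdsWithin] with w h2 h3
        have h3 : w ≠ c := h3
        have := mul_ne_zero (sub_ne_zero.2 h3) h2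
        rw [← hκu] at this
        exact this
    filter_upwards [hf, hκt.eventually hP, hL.filter_mono nhdsWithin_le_nhds,
      hκ.eventually_analyticAt.filter_mono nhdsWithin_le_nhds,
      hu.eventually_analyticAt.filter_mono nhdsWithin_le_nhds,
      (hu.continuousAt.eventually_ne hu0).filter_mono nhdsWithin_le_nhds,
      self_mem_nhdsWithin] with w e1 e2 e3 e4 e5 e6 e7
    have e7 : w ≠ c := e7
    have e8 : w - c ≠ 0 := sub_ne_zero.2 e7
    have d1 := e2.comp w e4.differentiableAt.hasDerivAt
    refine (d1.add (e3.const_mul a)).congr_deriv ?_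
    have d2 : deriv κ w = dslope κ c w + (w - c) * deriv (dslope κ c) w := by
      have := ((hasDerivAt_id w).sub_const c).mul e5.differentiableAt.hasDerivAt
      have h' : κ = fun w => (w - c) * dslope κ c w := funext hκu
      have h'' : deriv κ w = deriv (fun w => (w - c) * dslope κ c w) w := by rw [← h']
      rw [h'']
      convert! this.deriv using 1
      simp
    rw [e1]
    have hk := hκu w
    simp only [Pi.div_apply]
    have hkn : κ w ≠ 0 := by rw [hk]; exact mul_ne_zero e8 e6
    have : a * (w - c)⁻¹ = a * (deriv κ w * (κ w)⁻¹) - a * (deriv (dslope κ c) w / dslope κ c w) := by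
      rw [d2, hk]
      field_simp
      ring
    rw [this]
    ring

theorem PoleAt.hasResidue {d : ℤ} {f : ℂ → ℂ} (hf : PoleAt d f) : HasResidue f 0 (residue f 0) := by
  obtain ⟨a, P, hP, -⟩ := hf.exists_primitive
  have := (hasResidue_comp (G := f) (κ := id) (f := f) (c := 0) hf.meromorphicAt hP analyticAt_id
    rfl (by simp) (by simp)).2
  rwa [this.residue_eq]

theorem PoleAt.residue_eq_zero {d : ℤ} {f : ℂ → ℂ} (hf : PoleAt d f) (hd : d ≤ 0) :
    residue f 0 = 0 := by
  obtain ⟨a, P, hP, ha⟩ := hf.exists_primitive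
  have := (hasResidue_comp (G := f) (κ := id) (f := f) (c := 0) hf.meromorphicAt hP analyticAt_id
    rfl (by simp) (by simp)).2
  rw [this.residue_eq, ha hd]

/-- Residues of forms are defined in the preferred chart at the ramification point but computed in
the special coordinate. This passes from one to the other. -/
theorem PoleAt.residue_comp {d : ℤ} {G κ f : ℂ → ℂ} {c : ℂ} (hG : PoleAt d G)
    (hκ : AnalyticAt ℂ κ c) (h0 : κ c = 0) (h1 : deriv κ c ≠ 0)
    (hf : ∀ᶠ w in 𝓝[≠] c, f w = deriv κ w * G (κ w)) :
    HasResidue f c (residue G 0) := by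
  obtain ⟨a, P, hP, -⟩ := hG.exists_primitive
  have h2 := (hasResidue_comp hG.meromorphicAt hP hκ h0 h1 hf).2
  have := (hasResidue_comp (G := G) (κ := id) (f := G) (c := 0) hG.meromorphicAt hP analyticAt_id
    rfl (by simp) (by simp)).2
  rwa [this.residue_eq]

theorem residue_add {f g : ℂ → ℂ} {d e : ℤ} (hf : PoleAt d f) (hg : PoleAt e g) :
    residue (fun z => f z + g z) 0 = residue f 0 + residue g 0 :=
  (hf.hasResidue.add hg.hasResidue).residue_eq

theorem residue_const_mul {f : ℂ → ℂ} {d : ℤ} (a : ℂ) (hf : PoleAt d f) :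
    residue (fun z => a * f z) 0 = a * residue f 0 :=
  (hf.hasResidue.const_mul a).residue_eq

theorem HasResidue.sum {ι : Type*} {s : Finset ι} {f : ι → ℂ → ℂ} {c : ℂ} {r : ι → ℂ}
    (hf : ∀ i ∈ s, HasResidue (f i) c (r i)) :
    HasResidue (fun z => ∑ i ∈ s, f i z) c (∑ i ∈ s, r i) := by
  classical
  induction s using Finset.induction_on with
  | empty => simpa using hasResidue_zero c
  | insert a s ha ih =>
    simp only [Finset.sum_insert ha]
    exact (hf a (by simp)).add (ih fun i hi => hf i (by simp [hi]))

theorem residue_sum {ι : Type*} {s : Finset ι} {f : ι → ℂ → ℂ} {d : ι → ℤ}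
    (hf : ∀ i ∈ s, PoleAt (d i) (f i)) :
    residue (fun z => ∑ i ∈ s, f i z) 0 = ∑ i ∈ s, residue (f i) 0 :=
  (HasResidue.sum fun i hi => (hf i hi).hasResidue).residue_eq

/-! ### Quantitative poles on a disc of fixed radius -/

/-- `f` is holomorphic on the punctured closed disc of radius `R` about `0`, with a pole of order at
most `d` at `0`, and bounded by `M` on the boundary circle. -/
def PoleLE (R : ℝ) (d : ℤ) (f : ℂ → ℂ) (M : ℝ) : Prop :=
  (∃ h : ℂ → ℂ, AnalyticOnNhd ℂ h (closedBall 0 R) ∧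
    ∀ z ∈ closedBall (0 : ℂ) R, z ≠ 0 → f z = z ^ (-d) * h z) ∧ ∀ z ∈ sphere (0 : ℂ) R, ‖f z‖ ≤ M

theorem PoleLE.poleAt {R : ℝ} {d : ℤ} {f : ℂ → ℂ} {M : ℝ} (h : PoleLE R d f M) (hR : 0 < R) :
    PoleAt d f := by
  obtain ⟨⟨k, h1, h2⟩, -⟩ := h
  refine ⟨k, h1 0 (by simp [hR.le]), ?_⟩
  filter_upwards [mem_nhdsWithin_of_mem_nhds (closedBall_mem_nhds (0 : ℂ) hR),
    self_mem_nhdsWithin] with z e1 e2 using h2 z e1 e2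

theorem PoleLE.mul {R : ℝ} {d e : ℤ} {f g : ℂ → ℂ} {M N : ℝ} (hf : PoleLE R d f M)
    (hg : PoleLE R e g N) (hM : 0 ≤ M) : PoleLE R (d + e) (fun z => f z * g z) (M * N) := by
  obtain ⟨⟨h, h1, h2⟩, h3⟩ := hf
  obtain ⟨⟨k, k1, k2⟩, k3⟩ := hg
  refine ⟨⟨fun z => h z * k z, h1.mul k1, fun z hz h0 => ?_⟩, fun z hz => ?_⟩
  · beta_reduce
    rw [h2 z hz h0, k2 z hz h0, neg_add, zpow_add₀ h0]
    ring
  · rw [norm_mul]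
    exact mul_le_mul (h3 z hz) (k3 z hz) (norm_nonneg _) hM

theorem PoleLE.comp_neg {R : ℝ} {d : ℤ} {f : ℂ → ℂ} {M : ℝ} (hf : PoleLE R d f M) :
    PoleLE R d (fun z => f (-z)) M := by
  obtain ⟨⟨h, h1, h2⟩, h3⟩ := hf
  refine ⟨⟨fun z => (-1) ^ (-d) * h (-z), fun z hz => ?_, fun z hz h0 => ?_⟩, fun z hz => ?_⟩
  · refine analyticAt_const.mul ?_
    exact AnalyticAt.comp (g := h) (f := fun z : ℂ => -z) (h1 _ (by simpa using hz)) analyticAt_id.neg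
  · beta_reduce
    rw [h2 (-z) (by simpa using hz) (by simpa using h0), neg_eq_neg_one_mul z, mul_zpow]
    ring
  · exact h3 _ (by simpa using hz)

theorem poleLE_zpow {R : ℝ} (k : ℤ) : PoleLE R (-k) (fun z => z ^ k) (R ^ k) := by
  refine ⟨⟨fun _ => 1, fun z _ => analyticAt_const, by simp⟩, fun z hz => ?_⟩
  rw [norm_zpow, mem_sphere_zero_iff_norm.1 hz]

/-- The small circle computing the residue is deformed through an annulus to the circle of radius
`R`, where `f` is bounded by `M`. -/
theorem PoleLE.norm_residue_le {R : ℝ} {d : ℤ} {f : ℂ → ℂ} {M : ℝ} (hR : 0 < R)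
    (hf : PoleLE R d f M) : ‖residue f 0‖ ≤ R * M := by
  have hres := (hf.poleAt hR).hasResidue
  obtain ⟨⟨h, h1, h2⟩, h3⟩ := hf
  obtain ⟨ε, h4, (h5 : 0 < ε), h6⟩ := (hres.and (Ioc_mem_nhdsGT hR)).exists
  have hne : ∀ z ∈ closedBall (0 : ℂ) R \ ball 0 ε, z ≠ 0 := by
    rintro z hz rfl
    exact hz.2 (by simp [h5])
  have hd : ∀ z ∈ closedBall (0 : ℂ) R \ ball 0 ε, AnalyticAt ℂ (fun z => z ^ (-d) * h z) z :=
    fun z hz => (analyticAt_id.zpow (hne z hz)).mul (h1 z hz.1)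
  have heq := Complex.circleIntegral_eq_of_differentiable_on_annulus_off_countable h5 h6
    Set.countable_empty (f := fun z => z ^ (-d) * h z) (c := 0)
    (fun z hz => (hd z hz).continuousAt.continuousWithinAt)
    (fun z hz => (hd z ⟨ball_subset_closedBall hz.1.1,
      fun h => hz.1.2 (ball_subset_closedBall h)⟩).differentiableAt)
  have e1 : ∀ r, 0 < r → r ≤ R →
      (∮ z in C(0, r), f z) = ∮ z in C(0, r), z ^ (-d) * h z := by
    intro r hr hrR
    refine circleIntegral.integral_congr hr.le fun z hz => ?_
    have hz' := mem_sphere_zero_iff_norm.1 hz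
    refine h2 z (by simpa [hz'] using hrR) ?_
    rintro rfl
    simp at hz'; linarith
  rw [← h4.2, e1 ε h5 h6, ← heq, ← e1 R hR le_rfl]
  exact circleIntegral.norm_two_pi_i_inv_smul_integral_le_of_norm_le_const hR.le h3

/-- The conclusion concerns all small radii, so that finitely many such conditions can later share
one radius. -/
theorem PoleAt.eventually_poleLE {d : ℤ} {f : ℂ → ℂ} (hf : PoleAt d f) :
    ∀ᶠ R : ℝ in 𝓝[>] 0, ∃ M, PoleLE R d f M := by
  obtain ⟨h, h1, h2⟩ := hf
  rw [eventually_nhdsWithin_iff] at h2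
  obtain ⟨r, hr, h3⟩ := Metric.eventually_nhds_iff_ball.1 (h2.and h1.eventually_analyticAt)
  filter_upwards [Ioo_mem_nhdsGT hr] with R hR
  have hsub : closedBall (0 : ℂ) R ⊆ ball 0 r := closedBall_subset_ball hR.2
  have hA : AnalyticOnNhd ℂ h (closedBall 0 R) := fun z hz => (h3 z (hsub hz)).2
  have hE : ∀ z ∈ closedBall (0 : ℂ) R, z ≠ 0 → f z = z ^ (-d) * h z :=
    fun z hz h0 => (h3 z (hsub hz)).1 h0
  obtain ⟨M, hM⟩ := (isCompact_closedBall (0 : ℂ) R).exists_bound_of_continuousOn hA.continuousOn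
  refine ⟨R ^ (-d) * M, ⟨h, hA, hE⟩, fun z hz => ?_⟩
  have hz' := mem_sphere_zero_iff_norm.1 hz
  rw [hE z (sphere_subset_closedBall hz) (by rintro rfl; simp at hz'; linarith [hR.1]), norm_mul,
    norm_zpow, hz']
  have := hR.1
  gcongr
  exact hM z (sphere_subset_closedBall hz)

/-- The residue of the product of a holomorphic function with a function having a pole only sees
finitely many Taylor coefficients of the former. -/
theorem residue_analytic_mul {d : ℤ} {T G : ℂ → ℂ} (hT : AnalyticAt ℂ T 0) (hG : PoleAt d G)
    {N : ℕ} (hN : d ≤ N) :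
    residue (fun z => T z * G z) 0 = ∑ j ∈ Finset.range N,
      iteratedDeriv j T 0 / (j.factorial : ℂ) * residue (fun z => z ^ j * G z) 0 := by
  obtain ⟨r, hr, hz⟩ := taylor_eq hT N
  have hp : ∀ j : ℕ, PoleAt (-(j : ℤ) + d) (fun z => z ^ j * G z) := fun j => by
    simpa using (poleAt_zpow (j : ℤ)).mul hG
  have h1 : ∀ z, T z * G z = (∑ j ∈ Finset.range N,
      iteratedDeriv j T 0 / (j.factorial : ℂ) * (z ^ j * G z)) + r z * (z ^ N * G z) := fun z => by
    rw [hz z, add_mul, Finset.sum_mul]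
    congr 1
    · exact Finset.sum_congr rfl fun j _ => by ring
    · ring
  have h2 : PoleAt (0 + (-(N : ℤ) + d)) fun z => r z * (z ^ N * G z) :=
    (AnalyticAt.poleAt hr).mul (hp N)
  have h3 : PoleAt d fun z => ∑ j ∈ Finset.range N,
      iteratedDeriv j T 0 / (j.factorial : ℂ) * (z ^ j * G z) :=
    PoleAt.sum fun j _ => ((hp j).const_mul _).mono (by omega)
  simp only [h1]
  rw [residue_add h3 h2, h2.residue_eq_zero (by omega), add_zero,
    residue_sum (fun j _ => (hp j).const_mul _)]
  exact Finset.sum_congr rfl fun j _ => residue_const_mul _ (hp j)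

/-! ### Tangent vectors and homogeneity of forms -/

section Vectors

variable {X : Type*} [TopologicalSpace X] [ChartedSpace ℂ X]

/-- Multiplication of a tangent vector by a scalar. -/
def smulVec (c : ℂ) (v : TVec X) : TVec X := ⟨v.proj, c • v.snd⟩

@[simp] theorem smulVec_proj (c : ℂ) (v : TVec X) : (smulVec c v).proj = v.proj := rfl

/-- The velocity vector of a parametrized curve. -/
def velocity (γ : ℂ → X) (w : ℂ) : TVec X := ⟨γ w, mfderiv 𝓘(ℂ) 𝓘(ℂ) γ w (1 : ℂ)⟩

@[simp] theorem coordVec_proj (Z : OpenPartialHomeomorph X ℂ) (w : ℂ) :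
    (coordVec Z w).proj = Z.symm w := rfl

theorem coordVec_eq_velocity (Z : OpenPartialHomeomorph X ℂ) (w : ℂ) :
    coordVec Z w = velocity Z.symm w := rfl

theorem TVec.ext' {u v : TVec X} (h : u.proj = v.proj)
    (h' : (show ℂ from u.snd) = (show ℂ from v.snd)) : u = v := by
  obtain ⟨p, a⟩ := u
  obtain ⟨q, b⟩ := v
  obtain rfl : p = q := h
  exact congrArg _ h'

theorem velocity_congr {γ δ : ℂ → X} {w : ℂ} (h : γ =ᶠ[𝓝 w] δ) : velocity γ w = velocity δ w := by
  refine TVec.ext' h.eq_of_nhds ?_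
  exact congrArg (fun L : ℂ →L[ℂ] ℂ => L 1) (h.mfderiv_eq (I := 𝓘(ℂ)) (I' := 𝓘(ℂ)))

theorem velocity_comp {γ : ℂ → X} {h : ℂ → ℂ} {w : ℂ} (hγ : MDifferentiableAt 𝓘(ℂ) 𝓘(ℂ) γ (h w))
    (hh : DifferentiableAt ℂ h w) :
    velocity (fun z => γ (h z)) w = smulVec (deriv h w) (velocity γ (h w)) := by
  refine TVec.ext' rfl ?_
  have h1 := mfderiv_comp_apply (I := 𝓘(ℂ)) (I' := 𝓘(ℂ)) (I'' := 𝓘(ℂ)) w hγ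
    hh.mdifferentiableAt (1 : ℂ)
  have h2 : mfderiv 𝓘(ℂ) 𝓘(ℂ) h w (1 : ℂ) = deriv h w • (1 : ℂ) := by
    rw [mfderiv_eq_fderiv, smul_eq_mul, mul_one]
    exact fderiv_apply_one_eq_deriv (𝕜 := ℂ) (f := h) (x := w)
  rw [h2] at h1
  exact h1.trans ((mfderiv 𝓘(ℂ) 𝓘(ℂ) γ (h w)).map_smul (deriv h w) (1 : ℂ))

theorem tangentMap_velocity {γ : ℂ → X} {σ : X → X} {w : ℂ}
    (hγ : MDifferentiableAt 𝓘(ℂ) 𝓘(ℂ) γ w) (hσ : MDifferentiableAt 𝓘(ℂ) 𝓘(ℂ) σ (γ w)) :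
    tangentMap 𝓘(ℂ) 𝓘(ℂ) σ (velocity γ w) = velocity (fun z => σ (γ z)) w := by
  refine TVec.ext' rfl ?_
  exact (mfderiv_comp_apply (I := 𝓘(ℂ)) (I' := 𝓘(ℂ)) (I'' := 𝓘(ℂ)) w hσ hγ (1 : ℂ)).symm

theorem mfderiv_velocity {γ : ℂ → X} {f : X → ℂ} {w : ℂ}
    (hγ : MDifferentiableAt 𝓘(ℂ) 𝓘(ℂ) γ w) (hf : MDifferentiableAt 𝓘(ℂ) 𝓘(ℂ) f (γ w)) :
    mfderiv 𝓘(ℂ) 𝓘(ℂ) f (γ w) (velocity γ w).snd = deriv (fun z => f (γ z)) w := by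
  have h1 := mfderiv_comp_apply (I := 𝓘(ℂ)) (I' := 𝓘(ℂ)) (I'' := 𝓘(ℂ)) w hf hγ (1 : ℂ)
  refine h1.symm.trans ?_
  rw [mfderiv_eq_fderiv]
  exact fderiv_apply_one_eq_deriv (𝕜 := ℂ) (f := fun z => f (γ z)) (x := w)

theorem tangentMap_smulVec (σ : X → X) (c : ℂ) (u : TVec X) :
    tangentMap 𝓘(ℂ) 𝓘(ℂ) σ (smulVec c u) = smulVec c (tangentMap 𝓘(ℂ) 𝓘(ℂ) σ u) :=
  TVec.ext' rfl ((mfderiv 𝓘(ℂ) 𝓘(ℂ) σ u.proj).map_smul c u.snd)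

theorem OneForm.eval_smulVec (η : OneForm X) (c : ℂ) (u : TVec X) :
    η.eval (smulVec c u) = c * η.eval u :=
  (η u.proj).map_smul c u.snd

theorem BiForm.eval_smulVec_left (B : BiForm X) (c : ℂ) (u v : TVec X) :
    B.eval (smulVec c u) v = c * B.eval u v := by
  have h := (B u.proj v.proj).map_smul c u.snd
  exact congrArg (fun L : TangentSpace 𝓘(ℂ) v.proj →L[ℂ] ℂ => L v.snd) h

theorem BiForm.eval_smulVec_right (B : BiForm X) (c : ℂ) (u v : TVec X) :
    B.eval u (smulVec c v) = c * B.eval u v :=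
  (B u.proj v.proj u.snd).map_smul c v.snd

theorem IsPrimitiveNear.eval_velocity {f : X → ℂ} {η : OneForm X} {p : X}
    (h : IsPrimitiveNear f η p) {γ : ℂ → X} {w₀ : ℂ} (hγ : ContinuousAt γ w₀) (hp : γ w₀ = p)
    (hd : ∀ᶠ w in 𝓝 w₀, MDifferentiableAt 𝓘(ℂ) 𝓘(ℂ) γ w) :
    ∀ᶠ w in 𝓝 w₀, DifferentiableAt ℂ (fun z => f (γ z)) w ∧
      η.eval (velocity γ w) = deriv (fun z => f (γ z)) w := by
  have ht : Tendsto γ (𝓝 w₀) (𝓝 p) := by rw [← hp]; exact hγ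
  filter_upwards [ht.eventually h, hd] with w h1 h2
  refine ⟨?_, ?_⟩
  · exact (MDifferentiableAt.comp w h1.1 h2).differentiableAt
  · rw [← mfderiv_velocity h2 h1.1]
    exact h1.2 _

end Vectors

/-! ### Holomorphic changes of coordinates -/

section Charts

variable {X : Type*} [TopologicalSpace X] [ChartedSpace ℂ X]

theorem mdifferentiableAt_symm {Z : OpenPartialHomeomorph X ℂ}
    (hZ : Z ∈ IsManifold.maximalAtlas 𝓘(ℂ) ω X) {w : ℂ} (hw : w ∈ Z.target) :
    MDifferentiableAt 𝓘(ℂ) 𝓘(ℂ) Z.symm w :=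
  (contMDiffAt_symm_of_mem_maximalAtlas hZ hw).mdifferentiableAt (by simp)

theorem mdifferentiableAt_coord {Z : OpenPartialHomeomorph X ℂ}
    (hZ : Z ∈ IsManifold.maximalAtlas 𝓘(ℂ) ω X) {p : X} (hp : p ∈ Z.source) :
    MDifferentiableAt 𝓘(ℂ) 𝓘(ℂ) Z p :=
  (contMDiffAt_of_mem_maximalAtlas hZ hp).mdifferentiableAt (by simp)

theorem analyticAt_transition {Z Z' : OpenPartialHomeomorph X ℂ}
    (hZ : Z ∈ IsManifold.maximalAtlas 𝓘(ℂ) ω X) (hZ' : Z' ∈ IsManifold.maximalAtlas 𝓘(ℂ) ω X)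
    {w : ℂ} (hw : w ∈ Z'.target) (hw' : Z'.symm w ∈ Z.source) :
    AnalyticAt ℂ (fun z => Z (Z'.symm z)) w := by
  rw [Complex.analyticAt_iff_eventually_differentiableAt]
  have hc := (Z'.continuousAt_symm hw).eventually (Z.open_source.mem_nhds hw')
  filter_upwards [Z'.open_target.mem_nhds hw, hc] with z h1 h2
  exact (MDifferentiableAt.comp z (mdifferentiableAt_coord hZ h2)
    (mdifferentiableAt_symm hZ' h1)).differentiableAt

theorem coordVec_eq_smulVec {Z Z' : OpenPartialHomeomorph X ℂ}
    (hZ : Z ∈ IsManifold.maximalAtlas 𝓘(ℂ) ω X) (hZ' : Z' ∈ IsManifold.maximalAtlas 𝓘(ℂ) ω X)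
    {w : ℂ} (hw : w ∈ Z'.target) (hw' : Z'.symm w ∈ Z.source) :
    coordVec Z' w =
      smulVec (deriv (fun z => Z (Z'.symm z)) w) (coordVec Z (Z (Z'.symm w))) := by
  have hc := (Z'.continuousAt_symm hw).eventually (Z.open_source.mem_nhds hw')
  rw [coordVec_eq_velocity, coordVec_eq_velocity, ← velocity_comp (γ := Z.symm)
    (h := fun z => Z (Z'.symm z)) (mdifferentiableAt_symm hZ (Z.map_source hw'))
    (analyticAt_transition hZ hZ' hw hw').differentiableAt]
  refine velocity_congr ?_
  filter_upwards [hc] with z hz using (Z.left_inv hz).symm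

theorem deriv_transition_ne_zero {Z Z' : OpenPartialHomeomorph X ℂ}
    (hZ : Z ∈ IsManifold.maximalAtlas 𝓘(ℂ) ω X) (hZ' : Z' ∈ IsManifold.maximalAtlas 𝓘(ℂ) ω X)
    {w : ℂ} (hw : w ∈ Z'.target) (hw' : Z'.symm w ∈ Z.source) :
    deriv (fun z => Z (Z'.symm z)) w ≠ 0 := by
  have h1 := (analyticAt_transition hZ hZ' hw hw').differentiableAt.hasDerivAt
  have h2 := (analyticAt_transition hZ' hZ (Z.map_source hw')
    (by rw [Z.left_inv hw']; exact Z'.map_target hw)).differentiableAt.hasDerivAt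
  have h3 := h2.comp w h1
  have h4 : (fun z => Z' (Z.symm z)) ∘ (fun z => Z (Z'.symm z)) =ᶠ[𝓝 w] id := by
    have hc := (Z'.continuousAt_symm hw).eventually (Z.open_source.mem_nhds hw')
    filter_upwards [hc, Z'.open_target.mem_nhds hw] with z e1 e2
    simp [Z.left_inv e1, Z'.right_inv e2]
  have h5 := (h3.congr_of_eventuallyEq h4.symm).unique (hasDerivAt_id w)
  intro h
  rw [h, mul_zero] at h5
  exact zero_ne_one h5

theorem analyticAt_comp_symm {f : X → ℂ} {a : X} (hf : ∀ᶠ z in 𝓝 a, MDifferentiableAt 𝓘(ℂ) 𝓘(ℂ) f z)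
    {Z : OpenPartialHomeomorph X ℂ} (hZ : Z ∈ IsManifold.maximalAtlas 𝓘(ℂ) ω X)
    (ha : a ∈ Z.source) : AnalyticAt ℂ (fun w => f (Z.symm w)) (Z a) := by
  rw [Complex.analyticAt_iff_eventually_differentiableAt]
  have hc := Z.continuousAt_symm (Z.map_source ha)
  rw [ContinuousAt, Z.left_inv ha] at hc
  filter_upwards [Z.open_target.mem_nhds (Z.map_source ha), hc.eventually hf] with z h1 h2
  exact (MDifferentiableAt.comp z h2 (mdifferentiableAt_symm hZ h1)).differentiableAt

variable [IsManifold 𝓘(ℂ) ω X]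

/-- Composition of a chart with a local biholomorphism of `ℂ`. -/
theorem exists_chart_of_analyticAt {Z : OpenPartialHomeomorph X ℂ}
    (hZ : Z ∈ IsManifold.maximalAtlas 𝓘(ℂ) ω X) {a : X} (ha : a ∈ Z.source) {ψ : ℂ → ℂ}
    (hψ : AnalyticAt ℂ ψ (Z a)) (hψ' : deriv ψ (Z a) ≠ 0) :
    ∃ W ∈ IsManifold.maximalAtlas 𝓘(ℂ) ω X, a ∈ W.source ∧ W.source ⊆ Z.source ∧
      ∀ p, W p = ψ (Z p) := by
  have hψd := hψ.differentiableAt.hasDerivAt.hasFDerivAt_equiv hψ'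
  set e₀ := ContDiffAt.toOpenPartialHomeomorph ψ (n := ω) hψ.contDiffAt hψd (by simp)
  set e := e₀.restrContDiff ℂ ω (by simp) with he
  have hae : Z a ∈ e.source := by
    rw [he, OpenPartialHomeomorph.restrContDiff_source]
    refine ⟨ContDiffAt.mem_toOpenPartialHomeomorph_source _ hψd _, hψ.contDiffAt, ?_⟩
    exact hψ.contDiffAt.to_localInverse hψd (by simp)
  refine ⟨Z.trans e, ?_, ?_, ?_, fun p => rfl⟩
  · refine OpenPartialHomeomorph.mem_maximalAtlas_of_contMDiffOn _ ?_ ?_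
    · exact (OpenPartialHomeomorph.contDiffOn_restrContDiff_source ℂ e₀ (n := ω)
        (by simp)).contMDiffOn.comp ((contMDiffOn_of_mem_maximalAtlas hZ).mono
          fun p hp => hp.1) fun p hp => hp.2
    · exact (contMDiffOn_symm_of_mem_maximalAtlas hZ).comp
        ((OpenPartialHomeomorph.contDiffOn_restrContDiff_target ℂ e₀ (n := ω)
        (by simp)).contMDiffOn.mono fun p hp => hp.1) fun p hp => hp.2
  · simp [ha, hae]
  · intro p hp
    exact hp.1

end Charts

/-! ### The coordinate at a ramification point in which the involution is a sign -/

section SpecialChart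

theorem AnalyticAt.dslope {f : ℂ → ℂ} {c : ℂ} (hf : AnalyticAt ℂ f c) :
    AnalyticAt ℂ (dslope f c) c := by
  obtain ⟨p, hp⟩ := hf
  exact hp.has_fpower_series_dslope_fslope.analyticAt

/-- Near a simple critical point, a holomorphic function is a constant plus the square of a local
coordinate. -/
theorem exists_sqrt_coordinate {f G : ℂ → ℂ} {c : ℂ} (hf : AnalyticAt ℂ f c)
    (hG : AnalyticAt ℂ G c) (hG0 : G c ≠ 0)
    (h : ∀ᶠ w in 𝓝[≠] c, deriv f w = (w - c) * G w) :
    ∃ ψ : ℂ → ℂ, AnalyticAt ℂ ψ c ∧ ψ c = 0 ∧ deriv ψ c ≠ 0 ∧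
      ∀ᶠ w in 𝓝 c, f w = f c + ψ w ^ 2 := by
  have hA : AnalyticAt ℂ (fun w => (w - c) * G w) c := (analyticAt_id.sub analyticAt_const).mul hG
  have hd0 : deriv f c = 0 := by
    have h1 := (hf.deriv.continuousAt.tendsto.mono_left nhdsWithin_le_nhds).congr' h
    have h2 := hA.continuousAt.tendsto.mono_left (nhdsWithin_le_nhds (s := {c}ᶜ))
    simpa using tendsto_nhds_unique h1 h2
  set f₁ := dslope f c with hf₁
  set g := dslope f₁ c with hg
  have hf₁a : AnalyticAt ℂ f₁ c := AnalyticAt.dslope hf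
  have hga : AnalyticAt ℂ g c := AnalyticAt.dslope hf₁a
  have hfg : ∀ w, f w = f c + (w - c) ^ 2 * g w := fun w => by
    have h1 := sub_smul_dslope f c w
    have h2 := sub_smul_dslope f₁ c w
    have h3 : f₁ c = 0 := by rw [hf₁, dslope_same, hd0]
    rw [h3, sub_zero, smul_eq_mul] at h2
    rw [smul_eq_mul, ← hf₁, ← h2, ← hg] at h1
    linear_combination -h1
  -- Differentiating `f = f(c) + (w - c)^2 g` and dividing by `w - c` gives `2 g + (w - c) g' = G`
  -- off `c`. In the limit, `2 g(c) = G(c) ≠ 0`.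
  have hg0 : g c ≠ 0 := by
    have hfd : ∀ᶠ w in 𝓝[≠] c, 2 * g w + (w - c) * deriv g w = G w := by
      filter_upwards [h, hga.eventually_analyticAt.filter_mono nhdsWithin_le_nhds,
        self_mem_nhdsWithin] with w e1 e2 e3
      have e3 : w - c ≠ 0 := sub_ne_zero.2 e3
      have d : HasDerivAt f (2 * (w - c) * g w + (w - c) ^ 2 * deriv g w) w := by
        have d1 := (((hasDerivAt_id w).sub_const c).pow 2).mul e2.differentiableAt.hasDerivAt
        have d2 := d1.const_add (f c)
        refine (d2.congr_deriv ?_).congr_of_eventuallyEq ?_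
        · simp
        · exact Eventually.of_forall fun z => by simpa using hfg z
      rw [d.deriv] at e1
      refine mul_left_cancel₀ e3 ?_
      rw [← e1]; ring
    have hB : AnalyticAt ℂ (fun w => 2 * g w + (w - c) * deriv g w) c :=
      (analyticAt_const.mul hga).add ((analyticAt_id.sub analyticAt_const).mul hga.deriv)
    have h1 := (hB.continuousAt.tendsto.mono_left nhdsWithin_le_nhds).congr' hfd
    have h2 := hG.continuousAt.tendsto.mono_left (nhdsWithin_le_nhds (s := {c}ᶜ))
    have h3 := tendsto_nhds_unique h1 h2
    intro h4
    apply hG0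
    rw [← h3, h4]
    simp
  obtain ⟨r, hr⟩ := IsAlgClosed.exists_pow_nat_eq (g c) (n := 2) (by norm_num)
  have hr0 : r ≠ 0 := by rintro rfl; exact hg0 (by rw [← hr]; simp)
  -- A square root of `g`. Dividing by `g(c)` places the argument of the logarithm near `1`, inside
  -- the slit plane.
  set s : ℂ → ℂ := fun w => r * Complex.exp (1 / 2 * Complex.log (g w / g c)) with hs
  have hsa : AnalyticAt ℂ s c := by
    refine analyticAt_const.mul (AnalyticAt.cexp (analyticAt_const.mul (AnalyticAt.clog ?_ ?_)))
    · exact hga.div analyticAt_const hg0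
    · simp [hg0]
  have hsq : ∀ᶠ w in 𝓝 c, s w ^ 2 = g w := by
    filter_upwards [hga.continuousAt.eventually_ne hg0] with w hw
    have : Complex.exp (1 / 2 * Complex.log (g w / g c)) ^ 2 = g w / g c := by
      rw [← Complex.exp_nat_mul]
      push_cast
      rw [← mul_assoc, mul_one_div_cancel two_ne_zero, one_mul,
        Complex.exp_log (div_ne_zero hw hg0)]
    rw [hs]
    simp only [mul_pow, hr, this]
    field_simp
  have hsc : s c = r := by simp [hs, hg0]
  refine ⟨fun w => (w - c) * s w, (analyticAt_id.sub analyticAt_const).mul hsa, by simp, ?_, ?_⟩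
  · have d1 := ((hasDerivAt_id c).sub_const c).mul hsa.differentiableAt.hasDerivAt
    have d2 : HasDerivAt (fun w => (w - c) * s w) (s c) c := by
      refine d1.congr_deriv ?_
      simp
    rw [d2.deriv, hsc]
    exact hr0
  · filter_upwards [hsq] with w hw
    rw [hfg w, mul_pow, hw]

variable {X : Type*} [TopologicalSpace X] [ChartedSpace ℂ X] [IsManifold 𝓘(ℂ) ω X]

/-- A local coordinate centred at `a` in which `x` is a constant plus the square of the
coordinate. -/
structure IsSpecialChart (S : SpectralCurve X) (a : X) (Z : OpenPartialHomeomorph X ℂ) : Prop where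
  mem : Z ∈ IsManifold.maximalAtlas 𝓘(ℂ) ω X
  mem_source : a ∈ Z.source
  map_eq : Z a = 0
  x_eq : ∀ᶠ z in 𝓝 (0 : ℂ), S.x (Z.symm z) = S.x a + z ^ 2

theorem SpectralCurve.mem_ram {S : SpectralCurve X} {a : X} : a ∈ S.ram ↔ 0 < S.dx.ord a := by
  simp [SpectralCurve.ram]

theorem OneForm.meromorphic_ord {η : OneForm X} (hη : η.IsMeromorphic) {a : X} {f : X → ℂ}
    (hf : IsPrimitiveNear f η a) {n : ℤ} (hn : η.ord a = n) :
    AnalyticAt ℂ (fun w => f ((chartAt ℂ a).symm w)) (chartAt ℂ a a) ∧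
    ∃ G, AnalyticAt ℂ G (chartAt ℂ a a) ∧ G (chartAt ℂ a a) ≠ 0 ∧
      ∀ᶠ w in 𝓝[≠] (chartAt ℂ a a), deriv (fun w => f ((chartAt ℂ a).symm w)) w =
        (w - chartAt ℂ a a) ^ n * G w := by
  have hZ := IsManifold.chart_mem_maximalAtlas (I := 𝓘(ℂ)) (n := ω) a
  have hs := mem_chart_source ℂ a
  have ht := mem_chart_target ℂ a
  refine ⟨analyticAt_comp_symm (hf.mono fun z hz => hz.1) hZ hs, ?_⟩
  obtain ⟨G, h1, h2, h3⟩ := (meromorphicOrderAt_eq_int_iff (hη a)).1 hn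
  refine ⟨G, h1, h2, ?_⟩
  have h4 := hf.eval_velocity ((chartAt ℂ a).continuousAt_symm ht) ((chartAt ℂ a).left_inv hs)
    (Filter.mem_of_superset ((chartAt ℂ a).open_target.mem_nhds ht)
      fun w hw => mdifferentiableAt_symm hZ hw)
  filter_upwards [h3, h4.filter_mono nhdsWithin_le_nhds] with w e1 e2
  rw [← e2.2]
  exact e1

theorem exists_isSpecialChart (S : SpectralCurve X) {a : X} (ha : a ∈ S.ram) :
    ∃ Z, IsSpecialChart S a Z := by
  have ha' := SpectralCurve.mem_ram.1 ha
  have hZ := IsManifold.chart_mem_maximalAtlas (I := 𝓘(ℂ)) (n := ω) a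
  obtain ⟨h1, G, h2, h3, h4⟩ := OneForm.meromorphic_ord S.dx_meromorphic (S.x_branch a ha')
    (n := 1) (by simpa using S.simple_zeros a ha')
  obtain ⟨ψ, p1, p2, p3, p4⟩ := exists_sqrt_coordinate h1 h2 h3 (by simpa using h4)
  obtain ⟨W, w1, w2, w3, w4⟩ := exists_chart_of_analyticAt hZ (mem_chart_source ℂ a) p1 p3
  have hWa : W a = 0 := by rw [w4, p2]
  have ht : (0 : ℂ) ∈ W.target := hWa ▸ W.map_source w2
  refine ⟨W, w1, w2, hWa, ?_⟩
  have hc : Tendsto (fun z => chartAt ℂ a (W.symm z)) (𝓝 0) (𝓝 (chartAt ℂ a a)) := by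
    have c1 := W.continuousAt_symm ht
    have c2 : W.symm 0 = a := by rw [← hWa, W.left_inv w2]
    rw [ContinuousAt, c2] at c1
    exact ((chartAt ℂ a).continuousAt (mem_chart_source ℂ a)).tendsto.comp c1
  filter_upwards [hc.eventually p4, W.open_target.mem_nhds ht] with z e1 e2
  rw [(chartAt ℂ a).left_inv (mem_chart_source ℂ a), ← w4, W.right_inv e2,
    (chartAt ℂ a).left_inv (w3 (W.map_target e2))] at e1
  exact e1

variable {S : SpectralCurve X} {a : X} {Z : OpenPartialHomeomorph X ℂ}

theorem IsSpecialChart.zero_mem (h : IsSpecialChart S a Z) : (0 : ℂ) ∈ Z.target :=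
  h.map_eq ▸ Z.map_source h.mem_source

theorem IsSpecialChart.symm_zero (h : IsSpecialChart S a Z) : Z.symm 0 = a := by
  rw [← h.map_eq, Z.left_inv h.mem_source]

theorem IsSpecialChart.tendsto_symm (h : IsSpecialChart S a Z) : Tendsto Z.symm (𝓝 0) (𝓝 a) := by
  have := Z.continuousAt_symm h.zero_mem
  rwa [ContinuousAt, h.symm_zero] at this

theorem IsSpecialChart.tendsto_coord (h : IsSpecialChart S a Z) : Tendsto Z (𝓝 a) (𝓝 0) := by
  have := Z.continuousAt h.mem_source
  rwa [ContinuousAt, h.map_eq] at this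

theorem tendsto_neg_zero : Tendsto (fun z : ℂ => -z) (𝓝 0) (𝓝 0) := by
  simpa using (continuous_neg (G := ℂ)).tendsto 0

theorem IsSpecialChart.eventually_mem (h : IsSpecialChart S a Z) : ∀ᶠ z in 𝓝 0, z ∈ Z.target :=
  Z.open_target.mem_nhds h.zero_mem

theorem IsSpecialChart.eventually_md (h : IsSpecialChart S a Z) :
    ∀ᶠ z in 𝓝 0, MDifferentiableAt 𝓘(ℂ) 𝓘(ℂ) Z.symm z := by
  filter_upwards [h.eventually_mem] with z hz using mdifferentiableAt_symm h.mem hz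

/-- The involution of the curve is a choice by `Classical.epsilon`, which has the desired properties
only once a witness is known. -/
theorem IsSpecialChart.exists_involution (h : IsSpecialChart S a Z) :
    S.IsGaloisInvolution a fun p => Z.symm (-Z p) := by
  have hneg : Tendsto (fun p => -Z p) (𝓝 a) (𝓝 0) := tendsto_neg_zero.comp h.tendsto_coord
  refine ⟨by simp [h.map_eq, h.symm_zero], ?_, ?_, ?_⟩
  · filter_upwards [hneg.eventually h.eventually_mem, Z.open_source.mem_nhds h.mem_source]
      with p h1 h2
    have h3 := mdifferentiableAt_coord h.mem h2
    have h4 : MDifferentiableAt 𝓘(ℂ) 𝓘(ℂ) (fun z : ℂ => -z) (Z p) :=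
      differentiableAt_id.neg.mdifferentiableAt
    exact MDifferentiableAt.comp p (mdifferentiableAt_symm h.mem h1) (h4.comp p h3)
  · filter_upwards [hneg.eventually h.x_eq, h.tendsto_coord.eventually h.x_eq,
      Z.open_source.mem_nhds h.mem_source] with p h1 h2 h3
    rw [h1, neg_sq, ← h2, Z.left_inv h3]
  · intro hc
    have h1 := h.tendsto_symm.eventually hc
    have h2 : ∀ᶠ z in 𝓝[≠] (0 : ℂ), False := by
      filter_upwards [h1.filter_mono nhdsWithin_le_nhds,
        h.eventually_mem.filter_mono nhdsWithin_le_nhds,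
        (tendsto_neg_zero.eventually h.eventually_mem).filter_mono nhdsWithin_le_nhds,
        self_mem_nhdsWithin] with z e1 e2 e3 e4
      rw [Z.right_inv e2] at e1
      have := Z.symm.injOn e3 e2 e1
      exact e4 (by simpa using self_eq_neg.1 this.symm)
    exact h2.exists.elim fun _ h => h

theorem SpectralCurve.galois_spec (h : IsSpecialChart S a Z) : S.IsGaloisInvolution a (S.galois a) :=
  Classical.epsilon_spec_aux _ _ ⟨_, h.exists_involution⟩

/-- In a special coordinate the Galois involution is the change of sign. -/
theorem IsSpecialChart.galois_eq (h : IsSpecialChart S a Z) :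
    ∀ᶠ z in 𝓝 0, S.galois a (Z.symm z) = Z.symm (-z) := by
  obtain ⟨g1, g2, g3, g4⟩ := SpectralCurve.galois_spec h
  set σ := S.galois a
  have hσc : ContinuousAt σ a := (g2.self_of_nhds).continuousAt
  have hσt : Tendsto σ (𝓝 a) (𝓝 a) := by rw [ContinuousAt, g1] at hσc; exact hσc
  set f : ℂ → ℂ := fun z => Z (σ (Z.symm z)) with hf
  have hfa : AnalyticAt ℂ f 0 := by
    rw [Complex.analyticAt_iff_eventually_differentiableAt]
    filter_upwards [h.eventually_md, h.tendsto_symm.eventually g2,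
      (hσt.comp h.tendsto_symm).eventually (Z.open_source.mem_nhds h.mem_source)] with z e1 e2 e3
    exact (MDifferentiableAt.comp z (mdifferentiableAt_coord h.mem e3)
      (MDifferentiableAt.comp z e2 e1)).differentiableAt
  have hft : Tendsto f (𝓝 0) (𝓝 0) := (h.tendsto_coord.comp hσt).comp h.tendsto_symm
  have hinv : ∀ᶠ z in 𝓝 (0 : ℂ), Z.symm (f z) = σ (Z.symm z) := by
    filter_upwards [(hσt.comp h.tendsto_symm).eventually (Z.open_source.mem_nhds h.mem_source)]
      with z e3 using Z.left_inv e3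
  have hsq : ∀ᶠ z in 𝓝 (0 : ℂ), (f z - z) * (f z + z) = 0 := by
    filter_upwards [h.x_eq, hft.eventually h.x_eq, h.tendsto_symm.eventually g3, hinv]
      with z e1 e2 e3 e4
    rw [e4, e3, e1] at e2
    linear_combination -e2
  -- In the coordinate, `f(z)^2 = z^2`. By the identity theorem either `f = id` near `0`, which
  -- nontriviality excludes, or `f(z) ≠ z` for all small `z ≠ 0` and hence `f(z) = -z`.
  rcases AnalyticAt.eventually_eq_zero_or_eventually_ne_zero (hfa.sub analyticAt_id) with h1 | h1
  · exfalso
    apply g4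
    filter_upwards [h.tendsto_coord.eventually h1, h.tendsto_coord.eventually hinv,
      Z.open_source.mem_nhds h.mem_source] with p e1 e2 e3
    have e1 : f (Z p) = Z p := sub_eq_zero.1 e1
    rw [Z.left_inv e3] at e2
    rw [← e2, e1, Z.left_inv e3]
  · have h2 : ∀ᶠ z in 𝓝[≠] (0 : ℂ), f z + z = 0 := by
      filter_upwards [h1, hsq.filter_mono nhdsWithin_le_nhds] with z e1 e2
      exact (mul_eq_zero.1 e2).resolve_left e1
    have h3 : ∀ᶠ z in 𝓝 (0 : ℂ), f z + z = 0 := by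
      rw [eventually_nhdsWithin_iff] at h2
      filter_upwards [h2] with z hz
      by_cases h0 : z = 0
      · subst h0; simp [hf, h.symm_zero, g1, h.map_eq]
      · exact hz h0
    filter_upwards [h3, hinv] with z e1 e2
    rw [← e2, eq_neg_of_add_eq_zero_left e1]

/-- The differential of the Galois involution in a special coordinate. -/
theorem IsSpecialChart.tangentMap_galois (h : IsSpecialChart S a Z) :
    ∀ᶠ z in 𝓝 0, tangentMap 𝓘(ℂ) 𝓘(ℂ) (S.galois a) (coordVec Z z) =
      smulVec (-1) (coordVec Z (-z)) := by
  have g2 := (SpectralCurve.galois_spec h).holomorphic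
  filter_upwards [h.galois_eq.eventually_nhds, h.tendsto_symm.eventually g2, h.eventually_md,
    tendsto_neg_zero.eventually h.eventually_md] with z e1 e2 e3 e4
  rw [coordVec_eq_velocity, tangentMap_velocity e3 e2]
  have e5 : (fun z => S.galois a (Z.symm z)) =ᶠ[𝓝 z] fun z => Z.symm (-z) := e1
  rw [velocity_congr e5, velocity_comp (γ := Z.symm) (h := fun z => -z) e4
    differentiableAt_id.neg]
  rw [show deriv (fun z : ℂ => -z) z = -1 by simp]
  rfl

theorem IsSpecialChart.dx_eq (h : IsSpecialChart S a Z) (ha : a ∈ S.ram) :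
    ∀ᶠ z in 𝓝 0, S.dx.eval (coordVec Z z) = 2 * z := by
  have h1 := (S.x_branch a (SpectralCurve.mem_ram.1 ha)).eval_velocity
    (Z.continuousAt_symm h.zero_mem) h.symm_zero h.eventually_md
  filter_upwards [h1, h.x_eq.eventually_nhds] with z e1 e2
  have e3 : (fun z => S.x (Z.symm z)) =ᶠ[𝓝 z] fun z => S.x a + z ^ 2 := e2
  rw [coordVec_eq_velocity, e1.2, e3.deriv_eq]
  simp

/-- This is where regularity enters: `y(z) - y(-z)` then has a simple zero, so the kernel factor has
a pole of order at most two. -/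
theorem IsSpecialChart.y_analyticAt (hS : S.IsRegular) (h : IsSpecialChart S a Z) (ha : a ∈ S.ram) :
    AnalyticAt ℂ (fun z => S.y (Z.symm z)) 0 ∧ deriv (fun z => S.y (Z.symm z)) 0 ≠ 0 := by
  have hy := S.y_branch a (SpectralCurve.mem_ram.1 ha) (hS a ha).ge
  have hc := IsManifold.chart_mem_maximalAtlas (I := 𝓘(ℂ)) (n := ω) a
  have hY := analyticAt_comp_symm (hy.mono fun z hz => hz.1) h.mem h.mem_source
  rw [h.map_eq] at hY
  refine ⟨hY, ?_⟩
  obtain ⟨h1, G, h2, h3, h4⟩ := OneForm.meromorphic_ord S.dy_meromorphic hy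
    (n := 0) (by simpa using hS a ha)
  have h5 : deriv (fun w => S.y ((chartAt ℂ a).symm w)) (chartAt ℂ a a) ≠ 0 := by
    have e1 := (h1.deriv.continuousAt.tendsto.mono_left nhdsWithin_le_nhds).congr' h4
    have e2 := h2.continuousAt.tendsto.mono_left (nhdsWithin_le_nhds (s := {chartAt ℂ a a}ᶜ))
    simp only [zpow_zero, one_mul] at e1
    rwa [tendsto_nhds_unique e1 e2]
  have hs : Z.symm 0 ∈ (chartAt ℂ a).source := by rw [h.symm_zero]; exact mem_chart_source ℂ a
  have e0 : chartAt ℂ a (Z.symm 0) = chartAt ℂ a a := by rw [h.symm_zero]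
  have h6 := (analyticAt_transition hc h.mem h.zero_mem hs).differentiableAt.hasDerivAt
  have h7 : HasDerivAt (fun w => S.y ((chartAt ℂ a).symm w))
      (deriv (fun w => S.y ((chartAt ℂ a).symm w)) (chartAt ℂ a a)) (chartAt ℂ a (Z.symm 0)) := by
    rw [e0]; exact h1.differentiableAt.hasDerivAt
  have h8 := h7.comp (0 : ℂ) h6
  have h9 : (fun z => S.y (Z.symm z)) =ᶠ[𝓝 0] ((fun w => S.y ((chartAt ℂ a).symm w)) ∘
      fun z => chartAt ℂ a (Z.symm z)) := by
    filter_upwards [h.tendsto_symm.eventually ((chartAt ℂ a).open_source.mem_nhds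
      (mem_chart_source ℂ a))] with z hz
    simp [(chartAt ℂ a).left_inv hz]
  rw [(h8.congr_of_eventuallyEq h9).deriv]
  exact mul_ne_zero h5 (deriv_transition_ne_zero hc h.mem h.zero_mem hs)

end SpecialChart

/-! ### Damped exponential weights, stable under convolution -/

section Weights

/-- Exponential weight with a polynomial damping, which makes it stable under convolution. -/
def weight (ρ : ℝ) (d : ℤ) : ℝ := if 0 ≤ d then ρ ^ d / (1 + (d : ℝ)) ^ 2 else 0

theorem weight_of_neg {ρ : ℝ} {d : ℤ} (hd : d < 0) : weight ρ d = 0 := if_neg (by omega)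

theorem weight_of_nonneg {ρ : ℝ} {d : ℤ} (hd : 0 ≤ d) : weight ρ d = ρ ^ d / (1 + (d : ℝ)) ^ 2 :=
  if_pos hd

@[simp] theorem weight_zero (ρ : ℝ) : weight ρ 0 = 1 := by simp [weight]

theorem weight_nonneg {ρ : ℝ} (hρ : 0 < ρ) (d : ℤ) : 0 ≤ weight ρ d := by
  unfold weight
  split_ifs <;> positivity

/-- The constant in the convolution inequality for the weights. -/
def convConst : ℝ := 4 * ∑' n : ℕ, 1 / (1 + (n : ℝ)) ^ 2

theorem summable_one_div_sq : Summable fun n : ℕ => 1 / (1 + (n : ℝ)) ^ 2 := by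
  have := (summable_nat_add_iff 1).2 (Real.summable_one_div_nat_pow (p := 2) |>.2 (by norm_num))
  refine this.congr fun n => ?_
  push_cast
  ring_nf

theorem convConst_pos : 0 < convConst := by
  have : 0 < ∑' n : ℕ, 1 / (1 + (n : ℝ)) ^ 2 :=
    summable_one_div_sq.tsum_pos (fun n => by positivity) 0 (by norm_num)
  unfold convConst
  positivity

/-- By injectivity each value of `f` is counted once and negative values contribute nothing, so the
sum is part of the convergent series `∑ 1/(1+n)^2`. -/
theorem sum_weight_one_le {κ : Type*} (s : Finset κ) (f : κ → ℤ) (hf : Set.InjOn f s) :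
    ∑ p ∈ s, weight 1 (f p) ≤ ∑' n : ℕ, 1 / (1 + (n : ℝ)) ^ 2 := by
  classical
  have h1 : ∑ p ∈ s, weight 1 (f p) = ∑ p ∈ s with 0 ≤ f p, 1 / (1 + ((f p).toNat : ℝ)) ^ 2 := by
    rw [Finset.sum_filter]
    refine Finset.sum_congr rfl fun p _ => ?_
    unfold weight
    split_ifs with h
    · rw [one_zpow]
      congr 3
      exact_mod_cast (Int.toNat_of_nonneg h).symm
    · rfl
  rw [h1, ← Finset.sum_image (g := fun p => (f p).toNat) (f := fun n : ℕ => 1 / (1 + (n : ℝ)) ^ 2)]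
  · exact summable_one_div_sq.sum_le_tsum _ fun n _ => by positivity
  · intro p hp q hq h
    simp only [Finset.coe_filter, Set.mem_ofPred_eq] at hp hq h
    exact hf hp.1 hq.1 (by omega)

/-- The exponentials multiply exactly. For the damping, `(1 + x + y)^2 ≤ 2 ((1 + x)^2 + (1 + y)^2)`;
the factor left over is summable in the convolution variable. -/
theorem weight_mul_weight_le {ρ : ℝ} (hρ : 0 < ρ) (x y : ℤ) :
    weight ρ x * weight ρ y ≤ 2 * (weight 1 x + weight 1 y) * weight ρ (x + y) := by
  have hn := weight_nonneg (one_pos) x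
  have hn' := weight_nonneg (one_pos) y
  have hn'' := weight_nonneg hρ (x + y)
  rcases lt_or_ge x 0 with hx | hx
  · rw [weight_of_neg hx, zero_mul]; positivity
  rcases lt_or_ge y 0 with hy | hy
  · rw [weight_of_neg hy, mul_zero]; positivity
  rw [weight_of_nonneg hx, weight_of_nonneg hy, weight_of_nonneg hx, weight_of_nonneg hy,
    weight_of_nonneg (by omega), zpow_add₀ hρ.ne', one_zpow, one_zpow]
  have hx' : (0 : ℝ) ≤ x := by exact_mod_cast hx
  have hy' : (0 : ℝ) ≤ y := by exact_mod_cast hy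
  push_cast
  have key : 1 / ((1 + (x : ℝ)) ^ 2 * (1 + (y : ℝ)) ^ 2) ≤
      2 * (1 / (1 + (x : ℝ)) ^ 2 + 1 / (1 + (y : ℝ)) ^ 2) * (1 / (1 + ((x : ℝ) + y)) ^ 2) := by
    rw [show 2 * (1 / (1 + (x : ℝ)) ^ 2 + 1 / (1 + (y : ℝ)) ^ 2) * (1 / (1 + ((x : ℝ) + y)) ^ 2) =
      2 * ((1 + (y : ℝ)) ^ 2 + (1 + (x : ℝ)) ^ 2) /
        ((1 + (x : ℝ)) ^ 2 * (1 + (y : ℝ)) ^ 2 * (1 + ((x : ℝ) + y)) ^ 2) by field_simp,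
      div_le_div_iff₀ (by positivity) (by positivity), one_mul]
    have : (1 + ((x : ℝ) + y)) ^ 2 ≤ 2 * ((1 + (y : ℝ)) ^ 2 + (1 + (x : ℝ)) ^ 2) := by
      nlinarith [sq_nonneg ((x : ℝ) - y)]
    have h2 : (0 : ℝ) ≤ (1 + (x : ℝ)) ^ 2 * (1 + (y : ℝ)) ^ 2 := by positivity
    nlinarith [mul_le_mul_of_nonneg_left this h2]
  calc ρ ^ x / (1 + (x : ℝ)) ^ 2 * (ρ ^ y / (1 + (y : ℝ)) ^ 2)
      = ρ ^ x * ρ ^ y * (1 / ((1 + (x : ℝ)) ^ 2 * (1 + (y : ℝ)) ^ 2)) := by field_simp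
    _ ≤ ρ ^ x * ρ ^ y * (2 * (1 / (1 + (x : ℝ)) ^ 2 + 1 / (1 + (y : ℝ)) ^ 2) *
        (1 / (1 + ((x : ℝ) + y)) ^ 2)) := by gcongr
    _ = _ := by field_simp

/-- The weights are stable under convolution. -/
theorem sum_weight_mul_weight_le {κ : Type*} {ρ : ℝ} (hρ : 0 < ρ) (A B : ℤ) (s : Finset κ)
    (f : κ → ℤ) (hf : Set.InjOn f s) :
    ∑ p ∈ s, weight ρ (A - f p) * weight ρ (f p - B) ≤ convConst * weight ρ (A - B) := by
  calc ∑ p ∈ s, weight ρ (A - f p) * weight ρ (f p - B)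
      ≤ ∑ p ∈ s, 2 * (weight 1 (A - f p) + weight 1 (f p - B)) * weight ρ (A - B) := by
        refine Finset.sum_le_sum fun p _ => ?_
        convert! weight_mul_weight_le hρ (A - f p) (f p - B) using 2
        ring_nf
    _ = 2 * (∑ p ∈ s, weight 1 (A - f p) + ∑ p ∈ s, weight 1 (f p - B)) * weight ρ (A - B) := by
        rw [← Finset.sum_mul, ← Finset.mul_sum, Finset.sum_add_distrib]
    _ ≤ convConst * weight ρ (A - B) := by
        have h1 := sum_weight_one_le s (fun p => A - f p) fun p hp q hq h => hf hp hq (by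
          simp only at h; omega)
        have h2 := sum_weight_one_le s (fun p => f p - B) fun p hp q hq h => hf hp hq (by
          simp only at h; omega)
        have := weight_nonneg hρ (A - B)
        refine mul_le_mul_of_nonneg_right ?_ this
        unfold convConst
        linarith

/-- Halving the rate pays for the damping, since `(1 + d)^2 ≤ 4 · 2^d`. This converts Cauchy
estimates into weights. -/
theorem geometric_le_weight {ρ : ℝ} (hρ : 0 < ρ) {d : ℤ} (hd : 0 ≤ d) :
    (ρ / 2) ^ d ≤ 4 * weight ρ d := by
  obtain ⟨n, rfl⟩ := Int.eq_ofNat_of_zero_le hd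
  rw [weight_of_nonneg hd, div_zpow, zpow_natCast, zpow_natCast]
  have : ((1 : ℝ) + n) ^ 2 ≤ 4 * 2 ^ n := by
    have key : ∀ n : ℕ, (1 + n) ^ 2 ≤ 4 * 2 ^ n := by
      intro n
      induction n with
      | zero => norm_num
      | succ n ih =>
        rcases Nat.lt_or_ge n 2 with h | h
        · interval_cases n <;> norm_num
        · have : 2 ^ (n + 1) = 2 * 2 ^ n := by ring
          nlinarith
    exact_mod_cast key n
  push_cast
  rw [← mul_div_assoc, div_le_div_iff₀ (by positivity) (by positivity)]
  have h2 : 0 ≤ ρ ^ n := by positivity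
  nlinarith

end Weights

/-! ### The factorial majorant and its stability under the recursion -/

section Majorant

/-- The majorant of the coefficients of `ω_{g,n}` as a function of `P = 2g - 1 + n`. -/
def majorant (L : ℝ) (P : ℕ) : ℝ := L ^ (P - 1) * P.factorial / ((P : ℝ) + 1) ^ 2

theorem majorant_pos {L : ℝ} (hL : 0 < L) (P : ℕ) : 0 < majorant L P := by
  unfold majorant; positivity

/-- Passing from `P - 1` to `P` gains `P` from the factorial and a factor `L`. Thus a loss linear in
`P` is affordable. -/
theorem majorant_pred_le {L : ℝ} (hL : 0 < L) {P : ℕ} (hP : 2 ≤ P) :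
    L * (((P : ℝ) + 1) * majorant L (P - 1)) ≤ 4 * majorant L P := by
  obtain ⟨Q, rfl⟩ : ∃ Q, P = Q + 2 := ⟨P - 2, by omega⟩
  unfold majorant
  simp only [show Q + 2 - 1 = Q + 1 from rfl, show Q + 1 - 1 = Q from rfl]
  rw [Nat.factorial_succ (Q + 1), pow_succ]
  push_cast
  have h : ((Q : ℝ) + 2 + 1) * (1 / ((Q : ℝ) + 1 + 1) ^ 2) ≤
      4 * (((Q : ℝ) + 1 + 1) * (1 / ((Q : ℝ) + 2 + 1) ^ 2)) := by
    rw [mul_one_div, mul_one_div, mul_div_assoc', div_le_div_iff₀ (by positivity) (by positivity)]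
    have : (0 : ℝ) ≤ Q := by positivity
    nlinarith [mul_nonneg this this, mul_nonneg this (mul_nonneg this this)]
  have h0 : 0 ≤ L ^ Q * L * ((Q + 1).factorial : ℝ) := by positivity
  have := mul_le_mul_of_nonneg_left h h0
  calc _ = L ^ Q * L * ((Q + 1).factorial : ℝ) *
      (((Q : ℝ) + 2 + 1) * (1 / ((Q : ℝ) + 1 + 1) ^ 2)) := by ring
    _ ≤ _ := this
    _ = _ := by ring

theorem le_choose {n r : ℕ} (h0 : 0 < r) (h : r < n) : n ≤ n.choose r := by
  induction n with
  | zero => omega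
  | succ n ih =>
    obtain ⟨r, rfl⟩ : ∃ s, r = s + 1 := ⟨r - 1, by omega⟩
    rw [Nat.choose_succ_succ']
    have h1 : 0 < n.choose r := Nat.choose_pos (by omega)
    rcases Nat.lt_or_ge (r + 1) n with h2 | h2
    · have := ih h2
      omega
    · obtain rfl : n = r + 1 := by omega
      simp

/-- The two ends `k = 0` and `k = g` contribute at most `1` each. Every other binomial coefficient
is at least `2g ≥ g + 1`, so the remaining terms contribute at most `1` together. -/
theorem sum_inv_choose_le (g : ℕ) :
    ∑ k : Fin (g + 1), (1 : ℝ) / ((2 * g).choose (2 * k) : ℝ) ≤ 3 := by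
  have h1 : ∀ k ∈ Finset.range (g + 1), (1 : ℝ) / ((2 * g).choose (2 * k) : ℝ) ≤
      (if k = 0 then 1 else 0) + (if k = g then 1 else 0) + 1 / ((g : ℝ) + 1) := by
    intro k hk
    have hk := Finset.mem_range.1 hk
    have hpos : (0 : ℝ) < (g : ℝ) + 1 := by positivity
    have h0 : (0 : ℝ) ≤ 1 / ((g : ℝ) + 1) := by positivity
    by_cases e1 : k = 0
    · subst e1
      simp only [mul_zero, Nat.choose_zero_right, Nat.cast_one, if_true]
      split_ifs <;> linarith
    by_cases e2 : k = g
    · subst e2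
      simp only [Nat.choose_self, Nat.cast_one, if_true, e1, if_false]
      linarith
    · simp only [e1, e2, if_false, zero_add]
      refine one_div_le_one_div_of_le hpos ?_
      have h2 : 2 * g ≤ (2 * g).choose (2 * k) := le_choose (by omega) (by omega)
      have h4 : g + 1 ≤ (2 * g).choose (2 * k) := by omega
      exact_mod_cast h4
  have h2 : ∑ k : Fin (g + 1), (1 : ℝ) / ((2 * g).choose (2 * k) : ℝ) =
      ∑ k ∈ Finset.range (g + 1), (1 : ℝ) / ((2 * g).choose (2 * k) : ℝ) :=
    Fin.sum_univ_eq_sum_range (fun k => (1 : ℝ) / ((2 * g).choose (2 * k) : ℝ)) (g + 1)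
  rw [h2]
  refine (Finset.sum_le_sum h1).trans ?_
  rw [Finset.sum_add_distrib, Finset.sum_add_distrib]
  simp only [Finset.sum_ite_eq', Finset.mem_range, Finset.sum_const, Finset.card_range,
    nsmul_eq_mul]
  have : ((g + 1 : ℕ) : ℝ) * (1 / ((g : ℝ) + 1)) = 1 := by
    push_cast; field_simp
  rw [this]
  simp
  norm_num

theorem choose_mul_choose_le (m n i j : ℕ) :
    m.choose i * n.choose j ≤ (m + n).choose (i + j) := by
  rw [Nat.add_choose_eq]
  exact Finset.single_le_sum (f := fun p : ℕ × ℕ => m.choose p.1 * n.choose p.2)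
    (fun p _ => Nat.zero_le _) (show (i, j) ∈ Finset.HasAntidiagonal.antidiagonal (i + j) by simp)

/-- The `binom(m, j)` subsets of size `j` are controlled by Vandermonde: `binom(2g, 2k) binom(m, j)
≤ binom(2g+m, 2k+j)`. What remains is a convolution in `j` of the factors `1/(p+1)^2`, and the sum
over `k` of `1/binom(2g, 2k)`, which is at most `3`. -/
theorem sum_majorant_mul_le {L : ℝ} (hL : 0 < L) (g m : ℕ) :
    L * ∑ k : Fin (g + 1), ∑ J : Finset (Fin m),
      (if ((k : ℕ) = 0 ∧ J.card = 0) ∨ (g - k = 0 ∧ Jᶜ.card = 0) then 0 else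
        majorant L (2 * k + J.card) * majorant L (2 * (g - k) + Jᶜ.card)) ≤
      3 * convConst * majorant L (2 * g + m) := by
  have hterm : ∀ (k : Fin (g + 1)) (J : Finset (Fin m)),
      L * (if ((k : ℕ) = 0 ∧ J.card = 0) ∨ (g - k = 0 ∧ Jᶜ.card = 0) then 0 else
        majorant L (2 * k + J.card) * majorant L (2 * (g - k) + Jᶜ.card)) ≤
      L ^ (2 * g + m - 1) * ((2 * k + J.card).factorial * (2 * (g - k) + (m - J.card)).factorial *
        (weight 1 (((2 * g + m : ℕ) : ℤ) - ((2 * k + J.card : ℕ) : ℤ)) *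
          weight 1 (((2 * k + J.card : ℕ) : ℤ) - 0))) := by
    intro k J
    have hk := k.2
    have hJ : J.card ≤ m := by simpa using J.card_le_univ
    have hJc : Jᶜ.card = m - J.card := by rw [Finset.card_compl, Fintype.card_fin]
    rw [hJc]
    have w1 := weight_nonneg one_pos (((2 * g + m : ℕ) : ℤ) - ((2 * k + J.card : ℕ) : ℤ))
    have w2 := weight_nonneg one_pos (((2 * k + J.card : ℕ) : ℤ) - 0)
    split_ifs with h
    · rw [mul_zero]; positivity
    · have e1 : ((2 * g + m : ℕ) : ℤ) - ((2 * k + J.card : ℕ) : ℤ) =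
          ((2 * (g - k) + (m - J.card) : ℕ) : ℤ) := by omega
      rw [e1, weight_of_nonneg (by omega), weight_of_nonneg (by omega), one_zpow, one_zpow]
      obtain ⟨p, hp⟩ : ∃ p, 2 * (k : ℕ) + J.card = p + 1 := ⟨2 * k + J.card - 1, by omega⟩
      obtain ⟨q, hq⟩ : ∃ q, 2 * (g - k) + (m - J.card) = q + 1 :=
        ⟨2 * (g - k) + (m - J.card) - 1, by omega⟩
      -- The excluded cases are exactly those in which one argument of the majorant is zero.
      -- Otherwise `L · L^p · L^q = L^(p+q+1)`, with no truncated exponent.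
      rw [hp, hq, show 2 * g + m - 1 = p + q + 1 by omega]
      unfold majorant
      simp only [Nat.add_sub_cancel]
      refine le_of_eq ?_
      push_cast
      rw [pow_succ, pow_add, sub_zero]
      field_simp
      ring
  have hsum : ∀ k : Fin (g + 1), L * ∑ J : Finset (Fin m),
      (if ((k : ℕ) = 0 ∧ J.card = 0) ∨ (g - k = 0 ∧ Jᶜ.card = 0) then 0 else
        majorant L (2 * k + J.card) * majorant L (2 * (g - k) + Jᶜ.card)) ≤
      (1 : ℝ) / ((2 * g).choose (2 * k) : ℝ) * (convConst * majorant L (2 * g + m)) := by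
    intro k
    have hk := k.2
    rw [Finset.mul_sum]
    refine (Finset.sum_le_sum fun J _ => hterm k J).trans ?_
    rw [← Finset.powerset_univ, Finset.sum_powerset_apply_card (fun j =>
      L ^ (2 * g + m - 1) * ((2 * k + j).factorial * (2 * (g - k) + (m - j)).factorial *
        (weight 1 (((2 * g + m : ℕ) : ℤ) - ((2 * k + j : ℕ) : ℤ)) *
          weight 1 (((2 * k + j : ℕ) : ℤ) - 0))))]
    simp only [Finset.card_univ, Fintype.card_fin, nsmul_eq_mul]
    have hc : (0 : ℝ) < ((2 * g).choose (2 * k) : ℝ) := by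
      exact_mod_cast Nat.choose_pos (by omega)
    have hj : ∀ j ∈ Finset.range (m + 1), ((m.choose j : ℕ) : ℝ) * (L ^ (2 * g + m - 1) *
        ((2 * k + j).factorial * (2 * (g - k) + (m - j)).factorial *
        (weight 1 (((2 * g + m : ℕ) : ℤ) - ((2 * k + j : ℕ) : ℤ)) *
          weight 1 (((2 * k + j : ℕ) : ℤ) - 0)))) ≤
        1 / ((2 * g).choose (2 * k) : ℝ) * (L ^ (2 * g + m - 1) * (2 * g + m).factorial) *
        (weight 1 (((2 * g + m : ℕ) : ℤ) - ((2 * k + j : ℕ) : ℤ)) *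
          weight 1 (((2 * k + j : ℕ) : ℤ) - 0)) := by
      intro j hj
      have hj := Finset.mem_range.1 hj
      have w1 := weight_nonneg one_pos (((2 * g + m : ℕ) : ℤ) - ((2 * k + j : ℕ) : ℤ))
      have w2 := weight_nonneg one_pos (((2 * k + j : ℕ) : ℤ) - 0)
      have h1 := choose_mul_choose_le (2 * g) m (2 * k) j
      have h2 := Nat.choose_mul_factorial_mul_factorial (show 2 * (k : ℕ) + j ≤ 2 * g + m by omega)
      rw [show 2 * g + m - (2 * k + j) = 2 * (g - k) + (m - j) by omega] at h2
      have h3 : m.choose j * ((2 * k + j).factorial * (2 * (g - k) + (m - j)).factorial) *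
          (2 * g).choose (2 * k) ≤ (2 * g + m).factorial := by
        rw [← h2]
        calc _ = ((2 * g).choose (2 * k) * m.choose j) *
            ((2 * k + j).factorial * (2 * (g - k) + (m - j)).factorial) := by ring
          _ ≤ _ := by rw [mul_assoc ((2 * g + m).choose _)]; exact Nat.mul_le_mul_right _ h1
      have h4 : (m.choose j : ℝ) * ((2 * k + j).factorial * (2 * (g - k) + (m - j)).factorial) ≤
          1 / ((2 * g).choose (2 * k) : ℝ) * (2 * g + m).factorial := by
        rw [one_div_mul_eq_div, le_div_iff₀ hc]
        exact_mod_cast h3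
      calc _ = L ^ (2 * g + m - 1) * ((m.choose j : ℝ) *
            ((2 * k + j).factorial * (2 * (g - k) + (m - j)).factorial)) *
            (weight 1 (((2 * g + m : ℕ) : ℤ) - ((2 * k + j : ℕ) : ℤ)) *
            weight 1 (((2 * k + j : ℕ) : ℤ) - 0)) := by ring
        _ ≤ L ^ (2 * g + m - 1) * (1 / ((2 * g).choose (2 * k) : ℝ) * (2 * g + m).factorial) *
            (weight 1 (((2 * g + m : ℕ) : ℤ) - ((2 * k + j : ℕ) : ℤ)) *
            weight 1 (((2 * k + j : ℕ) : ℤ) - 0)) := by gcongr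
        _ = _ := by ring
    refine (Finset.sum_le_sum hj).trans ?_
    rw [← Finset.mul_sum]
    have hconv := sum_weight_mul_weight_le one_pos ((2 * g + m : ℕ) : ℤ) 0 (Finset.range (m + 1))
      (fun j => ((2 * k + j : ℕ) : ℤ)) (fun i _ j _ h => by simp only at h; omega)
    calc _ ≤ 1 / ((2 * g).choose (2 * k) : ℝ) * (L ^ (2 * g + m - 1) * (2 * g + m).factorial) *
          (convConst * weight 1 (((2 * g + m : ℕ) : ℤ) - 0)) := by gcongr
      _ = _ := by
        rw [weight_of_nonneg (by omega), one_zpow]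
        unfold majorant
        push_cast
        rw [sub_zero]
        field_simp
        ring
  rw [Finset.mul_sum]
  refine (Finset.sum_le_sum fun k _ => hsum k).trans ?_
  rw [← Finset.sum_mul]
  have := convConst_pos
  have := majorant_pos hL (2 * g + m)
  calc _ ≤ 3 * (convConst * majorant L (2 * g + m)) := by
        gcongr; exact sum_inv_choose_le g
    _ = _ := by ring

/-- The majorant of one factor in the quadratic terms of the recursion; `x` records the growth of
`ω_{0,2}`. -/
def factorMajorant (L : ℝ) {m : ℕ} (x : Fin m → ℝ) (k : ℕ) (J : Finset (Fin m)) : ℝ :=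
  if k = 0 ∧ J.card = 1 then ∑ i ∈ J, x i else majorant L (2 * k + J.card)

theorem sum_singletons_le {m : ℕ} (x : Fin m → ℝ) :
    ∑ J : Finset (Fin m), (if J.card = 1 then ∑ i ∈ J, x i else 0) ≤ ∑ i, x i := by
  rw [← Finset.sum_filter]
  have : (Finset.univ.filter fun J : Finset (Fin m) => J.card = 1) =
      Finset.univ.image fun i => {i} := by
    ext J
    simp [Finset.card_eq_one, eq_comm]
  rw [this, Finset.sum_image (by intro i _ j _ h; simpa using h)]
  simp

/-- Factors `ω_{0,2}` occur only for `k = 0`, `|J| = 1` or symmetrically on the other side. They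
leave a majorant at `P - 1` times a sum of the `x i`, which is linear in `P` and is absorbed by
`majorant_pred_le`. -/
theorem sum_factorMajorant_le {L : ℝ} (hL : 1 ≤ L) {g m : ℕ} (hP : 2 ≤ 2 * g + m) {x : Fin m → ℝ}
    (hx : ∀ i, 0 ≤ x i) (hs : ∑ i, x i ≤ 6 * ((2 * g + m : ℕ) + 1 : ℝ)) :
    L * ∑ k : Fin (g + 1), ∑ J : Finset (Fin m),
      (if ((k : ℕ) = 0 ∧ J.card = 0) ∨ (g - k = 0 ∧ Jᶜ.card = 0) then 0 else
        factorMajorant L x k J * factorMajorant L x (g - k) Jᶜ) ≤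
      (3 * convConst + 10000) * majorant L (2 * g + m) := by
  have hL0 : 0 < L := by linarith
  set P := 2 * g + m with hPdef
  have hM := majorant_pos hL0 (P - 1)
  -- The three added terms account for `ω_{0,2}` as the left factor only, as the right factor only,
  -- and as both. The last happens only for `ω_{0,3}`, where `P = 2` and the hypothesis gives `∑ x i
  -- ≤ 6 · 3 = 18`.
  have hterm : ∀ (k : Fin (g + 1)) (J : Finset (Fin m)),
      (if ((k : ℕ) = 0 ∧ J.card = 0) ∨ (g - k = 0 ∧ Jᶜ.card = 0) then 0 else
        factorMajorant L x k J * factorMajorant L x (g - k) Jᶜ) ≤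
      (if ((k : ℕ) = 0 ∧ J.card = 0) ∨ (g - k = 0 ∧ Jᶜ.card = 0) then 0 else
        majorant L (2 * k + J.card) * majorant L (2 * (g - k) + Jᶜ.card)) +
      ((if k = 0 then (if J.card = 1 then ∑ i ∈ J, x i else 0) * majorant L (P - 1) else 0) +
      (if k = Fin.last g then
        (if Jᶜ.card = 1 then ∑ i ∈ Jᶜ, x i else 0) * majorant L (P - 1) else 0) +
      (if k = 0 then (if J.card = 1 then ∑ i ∈ J, x i else 0) *
        (if P = 2 then 18 else 0) else 0)) := by
    intro k J
    have hk := k.2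
    have hxJ : 0 ≤ ∑ i ∈ J, x i := Finset.sum_nonneg fun i _ => hx i
    have hxJc : 0 ≤ ∑ i ∈ Jᶜ, x i := Finset.sum_nonneg fun i _ => hx i
    have hJ := Finset.card_add_card_compl J
    rw [Fintype.card_fin] at hJ
    have n1 : (0 : ℝ) ≤ (if k = 0 then (if J.card = 1 then ∑ i ∈ J, x i else 0) *
        majorant L (P - 1) else 0) := by split_ifs <;> positivity
    have n2 : (0 : ℝ) ≤ (if k = Fin.last g then
        (if Jᶜ.card = 1 then ∑ i ∈ Jᶜ, x i else 0) * majorant L (P - 1) else 0) := by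
      split_ifs <;> positivity
    have n3 : (0 : ℝ) ≤ (if k = 0 then (if J.card = 1 then ∑ i ∈ J, x i else 0) *
        (if P = 2 then 18 else 0) else 0) := by split_ifs <;> positivity
    have n4 := majorant_pos hL0 (2 * k + J.card)
    have n5 := majorant_pos hL0 (2 * (g - k) + Jᶜ.card)
    by_cases hun : ((k : ℕ) = 0 ∧ J.card = 0) ∨ (g - k = 0 ∧ Jᶜ.card = 0)
    · rw [if_pos hun, if_pos hun]; positivity
    rw [if_neg hun, if_neg hun]
    have hlast : k = Fin.last g ↔ g - (k : ℕ) = 0 := by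
      rw [Fin.ext_iff, Fin.val_last]; omega
    have hzero : k = 0 ↔ (k : ℕ) = 0 := by rw [Fin.ext_iff, Fin.val_zero]
    by_cases h1 : (k : ℕ) = 0 ∧ J.card = 1
    · by_cases h2 : g - k = 0 ∧ Jᶜ.card = 1
      · have hP2 : P = 2 := by omega
        have hle : ∑ i ∈ Jᶜ, x i ≤ 18 := by
          refine (Finset.sum_le_univ_sum_of_nonneg hx).trans (hs.trans ?_)
          rw [hP2]; norm_num
        have : factorMajorant L x k J * factorMajorant L x (g - k) Jᶜ ≤
            (if k = 0 then (if J.card = 1 then ∑ i ∈ J, x i else 0) *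
              (if P = 2 then 18 else 0) else 0) := by
          rw [factorMajorant, if_pos h1, factorMajorant, if_pos h2, if_pos (hzero.2 h1.1),
            if_pos h1.2, if_pos hP2]
          gcongr
        have := mul_pos n4 n5
        linarith
      · have : factorMajorant L x k J * factorMajorant L x (g - k) Jᶜ ≤
            (if k = 0 then (if J.card = 1 then ∑ i ∈ J, x i else 0) *
              majorant L (P - 1) else 0) := by
          rw [factorMajorant, if_pos h1, factorMajorant, if_neg h2, if_pos (hzero.2 h1.1),
            if_pos h1.2, show 2 * (g - (k : ℕ)) + Jᶜ.card = P - 1 by omega]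
        have := mul_pos n4 n5
        linarith
    · by_cases h2 : g - k = 0 ∧ Jᶜ.card = 1
      · have : factorMajorant L x k J * factorMajorant L x (g - k) Jᶜ ≤
            (if k = Fin.last g then
              (if Jᶜ.card = 1 then ∑ i ∈ Jᶜ, x i else 0) * majorant L (P - 1) else 0) := by
          rw [factorMajorant, if_neg h1, factorMajorant, if_pos h2, if_pos (hlast.2 h2.1),
            if_pos h2.2, show 2 * (k : ℕ) + J.card = P - 1 by omega, mul_comm]
        have := mul_pos n4 n5
        linarith
      · rw [factorMajorant, if_neg h1, factorMajorant, if_neg h2]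
        linarith
  have hS := sum_singletons_le x
  have hSc : ∑ J : Finset (Fin m), (if Jᶜ.card = 1 then ∑ i ∈ Jᶜ, x i else 0) ≤ ∑ i, x i := by
    refine le_trans (le_of_eq ?_) hS
    exact Fintype.sum_equiv (Equiv.ofBijective _ compl_bijective) _ _ fun J => rfl
  have hx0 : 0 ≤ ∑ i, x i := Finset.sum_nonneg fun i _ => hx i
  have h1 := Finset.sum_le_sum fun k (_ : k ∈ Finset.univ) =>
    Finset.sum_le_sum fun J (_ : J ∈ Finset.univ) => hterm k J
  simp only [Finset.sum_add_distrib] at h1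
  have e1 : ∑ k : Fin (g + 1), ∑ J : Finset (Fin m), (if k = 0 then
      (if J.card = 1 then ∑ i ∈ J, x i else 0) * majorant L (P - 1) else 0) ≤
      (∑ i, x i) * majorant L (P - 1) := by
    rw [Finset.sum_comm]
    simp only [Finset.sum_ite_eq', Finset.mem_univ, if_true]
    rw [← Finset.sum_mul]
    gcongr
  have e2 : ∑ k : Fin (g + 1), ∑ J : Finset (Fin m), (if k = Fin.last g then
      (if Jᶜ.card = 1 then ∑ i ∈ Jᶜ, x i else 0) * majorant L (P - 1) else 0) ≤
      (∑ i, x i) * majorant L (P - 1) := by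
    rw [Finset.sum_comm]
    simp only [Finset.sum_ite_eq', Finset.mem_univ, if_true]
    rw [← Finset.sum_mul]
    gcongr
  have e3 : ∑ k : Fin (g + 1), ∑ J : Finset (Fin m), (if k = 0 then
      (if J.card = 1 then ∑ i ∈ J, x i else 0) * (if P = 2 then 18 else 0) else 0) ≤
      (∑ i, x i) * (if P = 2 then 18 else 0) := by
    rw [Finset.sum_comm]
    simp only [Finset.sum_ite_eq', Finset.mem_univ, if_true]
    rw [← Finset.sum_mul]
    gcongr
  have e4 : (∑ i, x i) * (if P = 2 then 18 else 0) ≤ 324 * (if P = 2 then 1 else 0) := by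
    split_ifs with h2
    · rw [h2] at hs; norm_num at hs ⊢; linarith
    · simp
  have e5 := majorant_pred_le hL0 hP
  -- For `P = 2` the majorant is `2L/9`, and `1458 · 2/9 = 324 = 18^2`.
  have e6 : L * (324 * (if P = 2 then 1 else 0)) ≤ 1458 * majorant L P := by
    split_ifs with h2
    · rw [h2, majorant]; norm_num [Nat.factorial]; linarith
    · have := majorant_pos hL0 P
      simp only [mul_zero]; positivity
  have e7 := sum_majorant_mul_le hL0 g m
  rw [← hPdef] at e7
  have e8 : L * ((∑ i, x i) * majorant L (P - 1)) ≤ 24 * majorant L P := by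
    calc L * ((∑ i, x i) * majorant L (P - 1)) ≤
        L * ((6 * ((P : ℝ) + 1)) * majorant L (P - 1)) := by gcongr
      _ = 6 * (L * (((P : ℝ) + 1) * majorant L (P - 1))) := by ring
      _ ≤ 6 * (4 * majorant L P) := by gcongr
      _ = _ := by ring
  have hMP := majorant_pos hL0 P
  calc _ ≤ L * _ := mul_le_mul_of_nonneg_left h1 hL0.le
    _ ≤ L * ((∑ k : Fin (g + 1), ∑ J : Finset (Fin m),
        (if ((k : ℕ) = 0 ∧ J.card = 0) ∨ (g - k = 0 ∧ Jᶜ.card = 0) then 0 else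
          majorant L (2 * k + J.card) * majorant L (2 * (g - k) + Jᶜ.card))) +
        ((∑ i, x i) * majorant L (P - 1) + (∑ i, x i) * majorant L (P - 1) +
          324 * (if P = 2 then 1 else 0))) := by
        gcongr
        exact e3.trans e4
    -- The exceptional terms total at most `24 + 24 + 1458` times the majorant, well below the round
    -- constant `10000`.
    _ ≤ _ := by
        rw [mul_add, mul_add, mul_add]
        nlinarith

end Majorant

/-! ### Taylor coefficients in one of two variables -/

section TwoVariables

/-- Partial derivatives of a jointly analytic function are jointly analytic. The single function `k`
expresses this for iterated one-variable derivatives. -/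
theorem iteratedDeriv_snd_eq {h : ℂ × ℂ → ℂ} (l : ℕ) :
    ∃ k : ℂ × ℂ → ℂ, AnalyticOnNhd ℂ k {p | AnalyticAt ℂ h p} ∧ ∀ p, AnalyticAt ℂ h p →
      iteratedDeriv l (fun z => h (p.1, z)) p.2 = k p := by
  induction l with
  | zero => exact ⟨h, fun p hp => hp, fun p _ => by simp⟩
  | succ l ih =>
    obtain ⟨k, k1, k2⟩ := ih
    refine ⟨fun p => fderiv ℂ k p (0, 1), fun p hp => ?_, fun p hp => ?_⟩
    · exact (ContinuousLinearMap.analyticAt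
        (ContinuousLinearMap.apply ℂ ℂ ((0, 1) : ℂ × ℂ)) _).comp (k1.fderiv p hp)
    · rw [iteratedDeriv_succ]
      have hline : HasDerivAt (fun z : ℂ => (p.1, z)) ((0, 1) : ℂ × ℂ) p.2 :=
        (hasDerivAt_const p.2 p.1).prodMk (hasDerivAt_id p.2)
      have he : iteratedDeriv l (fun z => h (p.1, z)) =ᶠ[𝓝 p.2] fun z => k (p.1, z) := by
        have := hline.continuousAt.eventually (p := fun q => AnalyticAt ℂ h q)
          hp.eventually_analyticAt
        filter_upwards [this] with z hz using k2 (p.1, z) hz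
      rw [he.deriv_eq]
      have hk : HasFDerivAt k (fderiv ℂ k p) (p.1, p.2) := (k1 p hp).differentiableAt.hasFDerivAt
      exact (hk.comp_hasDerivAt p.2 hline).deriv

/-- Uniform Cauchy estimates for the Taylor coefficients in the second variable. -/
theorem exists_bound_iteratedDeriv_snd {h : ℂ × ℂ → ℂ} {R : ℝ} (hR : 0 < R)
    (hh : AnalyticOnNhd ℂ h (closedBall 0 R ×ˢ closedBall 0 R)) :
    ∃ M : ℝ, 0 ≤ M ∧ ∀ l : ℕ,
      AnalyticOnNhd ℂ (fun z => iteratedDeriv l (fun w => h (z, w)) 0 / ((l + 1).factorial : ℂ))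
        (closedBall 0 R) ∧
      ∀ z ∈ closedBall (0 : ℂ) R,
        ‖iteratedDeriv l (fun w => h (z, w)) 0 / ((l + 1).factorial : ℂ)‖ ≤ M / R ^ l := by
  obtain ⟨M, hM⟩ := ((isCompact_closedBall (0 : ℂ) R).prod
    (isCompact_closedBall (0 : ℂ) R)).exists_bound_of_continuousOn hh.continuousOn
  have h0 : (0 : ℂ) ∈ closedBall (0 : ℂ) R := by simp [hR.le]
  refine ⟨M, (norm_nonneg _).trans (hM (0, 0) ⟨h0, h0⟩), fun l => ⟨fun z hz => ?_, fun z hz => ?_⟩⟩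
  · obtain ⟨k, k1, k2⟩ := iteratedDeriv_snd_eq (h := h) l
    have hz0 : AnalyticAt ℂ h (z, 0) := hh _ ⟨hz, h0⟩
    have ha : AnalyticAt ℂ (fun z : ℂ => (z, (0 : ℂ))) z := analyticAt_id.prod analyticAt_const
    have hk : AnalyticAt ℂ (fun z => k (z, 0)) z :=
      AnalyticAt.comp (g := k) (f := fun z : ℂ => (z, (0 : ℂ))) (k1 (z, 0) hz0) ha
    refine (hk.div (analyticAt_const (v := ((l + 1).factorial : ℂ)))
      (by exact_mod_cast Nat.factorial_ne_zero _)).congr ?_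
    filter_upwards [ha.continuousAt.eventually (p := fun q => AnalyticAt ℂ h q)
      hz0.eventually_analyticAt] with w hw
    simp only [Pi.div_apply]
    rw [← k2 (w, 0) hw]
  · have hd : DiffContOnCl ℂ (fun w => h (z, w)) (ball 0 R) := by
      refine DifferentiableOn.diffContOnCl ?_
      rw [closure_ball _ hR.ne']
      intro w hw
      have ha : AnalyticAt ℂ (fun w : ℂ => (z, w)) w := analyticAt_const.prod analyticAt_id
      exact (AnalyticAt.comp (g := h) (f := fun w : ℂ => (z, w)) (hh (z, w) ⟨hz, hw⟩)
        ha).differentiableAt.differentiableWithinAt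
    have := Complex.norm_iteratedDeriv_le_of_forall_mem_sphere_norm_le l hR hd
      fun w hw => hM (z, w) ⟨hz, sphere_subset_closedBall hw⟩
    rw [norm_div, Complex.norm_natCast]
    have hM0 : 0 ≤ M := (norm_nonneg _).trans (hM (0, 0) ⟨h0, h0⟩)
    rw [div_le_div_iff₀ (by positivity) (by positivity)]
    rw [le_div_iff₀ (by positivity)] at this
    refine this.trans ?_
    rw [mul_comm M]
    gcongr
    exact Nat.le_succ l

theorem iteratedDeriv_inv_sub_sq (l : ℕ) (z : ℂ) : ∀ w, w ≠ z →
    iteratedDeriv l (fun w => 1 / (z - w) ^ 2) w =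
      ((l + 1).factorial : ℂ) * (z - w) ^ (-((l : ℤ) + 2)) := by
  induction l with
  | zero => intro w hw; simp
  | succ l ih =>
    intro w hw
    have hne : z - w ≠ 0 := sub_ne_zero.2 hw.symm
    rw [iteratedDeriv_succ]
    have he : iteratedDeriv l (fun w => 1 / (z - w) ^ 2) =ᶠ[𝓝 w]
        fun w => ((l + 1).factorial : ℂ) * (z - w) ^ (-((l : ℤ) + 2)) := by
      filter_upwards [isOpen_ne.mem_nhds hw] with u hu using ih u hu
    have h1 := (hasDerivAt_zpow (-((l : ℤ) + 2)) (z - w) (Or.inl hne)).comp w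
      ((hasDerivAt_id w).const_sub z)
    have h2 : HasDerivAt (fun w => ((l + 1).factorial : ℂ) * (z - w) ^ (-((l : ℤ) + 2))) _ w :=
      h1.const_mul _
    rw [he.deriv_eq, h2.deriv, Nat.factorial_succ (l + 1)]
    push_cast
    rw [show -((l : ℤ) + 2) - 1 = -((l : ℤ) + 1 + 2) by ring]
    ring

theorem PoleLE.mono {R : ℝ} {d e : ℤ} {f : ℂ → ℂ} {M N : ℝ} (hf : PoleLE R d f M) (hde : d ≤ e)
    (hMN : M ≤ N) : PoleLE R e f N := by
  obtain ⟨⟨h, h1, h2⟩, h3⟩ := hf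
  obtain ⟨n, hn⟩ := Int.eq_ofNat_of_zero_le (sub_nonneg.2 hde)
  refine ⟨⟨fun z => z ^ n * h z, fun z hz => (analyticAt_id.pow n).mul (h1 z hz),
    fun z hz hz0 => ?_⟩, fun z hz => (h3 z hz).trans hMN⟩
  rw [h2 z hz hz0, ← mul_assoc, ← zpow_natCast, ← zpow_add₀ hz0, ← hn]
  congr 2
  ring

theorem PoleLE.add {R : ℝ} {d : ℤ} {f g : ℂ → ℂ} {M N : ℝ} (hf : PoleLE R d f M)
    (hg : PoleLE R d g N) : PoleLE R d (fun z => f z + g z) (M + N) := by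
  obtain ⟨⟨h, h1, h2⟩, h3⟩ := hf
  obtain ⟨⟨k, k1, k2⟩, k3⟩ := hg
  refine ⟨⟨fun z => h z + k z, h1.add k1, fun z hz h0 => ?_⟩, fun z hz => ?_⟩
  · beta_reduce
    rw [h2 z hz h0, k2 z hz h0]
    ring
  · exact (norm_add_le _ _).trans (add_le_add (h3 z hz) (k3 z hz))

theorem PoleLE.congr {R : ℝ} (hR : 0 < R) {d : ℤ} {f g : ℂ → ℂ} {M : ℝ} (hf : PoleLE R d f M)
    (h : ∀ z ∈ closedBall (0 : ℂ) R, z ≠ 0 → g z = f z) : PoleLE R d g M := by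
  obtain ⟨⟨k, k1, k2⟩, k3⟩ := hf
  refine ⟨⟨k, k1, fun z hz h0 => by rw [h z hz h0, k2 z hz h0]⟩, fun z hz => ?_⟩
  rw [h z (sphere_subset_closedBall hz)]
  · exact k3 z hz
  · rintro rfl
    simp at hz; linarith

end TwoVariables

/-! ### Local expansions of `ω_{0,2}` and of the ingredients of the kernel -/

section Forms

variable {X : Type*} [TopologicalSpace X] [ChartedSpace ℂ X]

/-- The tangent line is one-dimensional and the coordinate vector is nonzero because `dZ` takes the
value `1` on it. -/
theorem exists_eq_smulVec_coordVec {Z : OpenPartialHomeomorph X ℂ}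
    (hZ : Z ∈ IsManifold.maximalAtlas 𝓘(ℂ) ω X) (v : TVec X) (hv : v.proj ∈ Z.source) :
    ∃ c : ℂ, v = smulVec c (coordVec Z (Z v.proj)) := by
  have ht := Z.map_source hv
  have h1 := mfderiv_velocity (γ := Z.symm) (f := Z) (mdifferentiableAt_symm hZ ht)
    (mdifferentiableAt_coord hZ (by rwa [Z.left_inv hv]))
  have h2 : (fun z => Z (Z.symm z)) =ᶠ[𝓝 (Z v.proj)] id := by
    filter_upwards [Z.open_target.mem_nhds ht] with z hz using Z.right_inv hz
  rw [h2.deriv_eq, deriv_id] at h1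
  set e : ℂ := (velocity Z.symm (Z v.proj)).snd with he
  have he0 : e ≠ 0 := by
    intro h0
    have : (mfderiv 𝓘(ℂ) 𝓘(ℂ) Z (Z.symm (Z v.proj))) (velocity Z.symm (Z v.proj)).snd = 0 := by
      rw [show (velocity Z.symm (Z v.proj)).snd = 0 from h0]
      exact map_zero _
    rw [this] at h1
    exact zero_ne_one (α := ℂ) h1
  refine ⟨(show ℂ from v.snd) / e, TVec.ext' (Z.left_inv hv).symm ?_⟩
  exact (div_mul_cancel₀ (show ℂ from v.snd) he0).symm

variable [IsManifold 𝓘(ℂ) ω X]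

theorem BiForm.IsFundamental.analyticAt {B : BiForm X} (hB : B.IsFundamental) (v : TVec X)
    {Z : OpenPartialHomeomorph X ℂ} (hZ : Z ∈ IsManifold.maximalAtlas 𝓘(ℂ) ω X) {w : ℂ}
    (hw : w ∈ Z.target) (hv : v.proj ≠ Z.symm w) :
    AnalyticAt ℂ (fun z => B.eval v (coordVec Z z)) w := by
  have hc := IsManifold.chart_mem_maximalAtlas (I := 𝓘(ℂ)) (n := ω) v.proj
  have hs := mem_chart_source ℂ v.proj
  obtain ⟨c, hcv⟩ := exists_eq_smulVec_coordVec hc v hs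
  have h1 := hB.holomorphic _ hc _ hZ (chartAt ℂ v.proj v.proj, w)
    ⟨(chartAt ℂ v.proj).map_source hs, hw, by rwa [(chartAt ℂ v.proj).left_inv hs]⟩
  have h2 : AnalyticAt ℂ (fun z : ℂ => (chartAt ℂ v.proj v.proj, z)) w :=
    analyticAt_const.prod analyticAt_id
  have h3 := analyticAt_const (v := c).mul (AnalyticAt.comp
    (g := fun w : ℂ × ℂ => B.eval (coordVec (chartAt ℂ v.proj) w.1) (coordVec Z w.2))
    (f := fun z : ℂ => (chartAt ℂ v.proj v.proj, z)) h1 h2)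
  refine h3.congr (Eventually.of_forall fun z => ?_)
  change c * B.eval (coordVec (chartAt ℂ v.proj) (chartAt ℂ v.proj v.proj)) (coordVec Z z) =
    B.eval v (coordVec Z z)
  rw [← BiForm.eval_smulVec_left, ← hcv]

theorem BiForm.IsFundamental.eval_symm {B : BiForm X} (hB : B.IsFundamental) (u v : TVec X) :
    B.eval u v = B.eval v u := hB.symm _ _ _ _

variable {S : SpectralCurve X} {a : X} {Z : OpenPartialHomeomorph X ℂ}

/-- Integration of a holomorphic form near a ramification point. -/
theorem IsSpecialChart.localIntegral_eq (h : IsSpecialChart S a Z) {η : TVec X → ℂ}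
    (hη : ∀ c u, η (smulVec c u) = c * η u)
    (ha : AnalyticAt ℂ (fun w => η (coordVec (chartAt ℂ a) w)) (chartAt ℂ a a)) :
    ∃ Q : ℂ → ℂ, AnalyticAt ℂ Q 0 ∧ (∀ᶠ z in 𝓝 0, HasDerivAt Q (η (coordVec Z z)) z) ∧
      ∀ᶠ p : ℂ × ℂ in 𝓝 (0, 0),
        localIntegral a η (Z.symm p.1) (Z.symm p.2) = Q p.2 - Q p.1 := by
  have hc := IsManifold.chart_mem_maximalAtlas (I := 𝓘(ℂ)) (n := ω) a
  have hs := mem_chart_source ℂ a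
  set φ := chartAt ℂ a
  obtain ⟨Q₀, q1, q2⟩ := exists_primitive_of_analyticAt ha
  obtain ⟨r, hr, hball⟩ := Metric.eventually_nhds_iff_ball.1 (q2.and ha.eventually_analyticAt)
  have hsz : Z.symm 0 ∈ φ.source := by rw [h.symm_zero]; exact hs
  have e0 : φ (Z.symm 0) = φ a := by rw [h.symm_zero]
  have hκ := analyticAt_transition hc h.mem h.zero_mem hsz
  have hκt : Tendsto (fun z => φ (Z.symm z)) (𝓝 0) (𝓝 (φ a)) := by
    have := hκ.continuousAt.tendsto
    rwa [e0] at this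
  refine ⟨fun z => Q₀ (φ (Z.symm z)), ?_, ?_, ?_⟩
  · exact AnalyticAt.comp_of_eq (g := Q₀) (f := fun z => φ (Z.symm z)) q1 hκ e0
  · filter_upwards [hκt.eventually q2, hκ.eventually_analyticAt, h.eventually_mem,
      h.tendsto_symm.eventually (φ.open_source.mem_nhds hs)] with z e1 e2 e3 e4
    refine (e1.comp z e2.differentiableAt.hasDerivAt).congr_deriv ?_
    rw [coordVec_eq_smulVec hc h.mem e3 e4, hη, mul_comm]
  · have h1 : ∀ᶠ z in 𝓝 (0 : ℂ), φ (Z.symm z) ∈ ball (φ a) r :=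
      hκt.eventually (ball_mem_nhds _ hr)
    have h2 : ∀ᶠ p : ℂ × ℂ in 𝓝 (0, 0), φ (Z.symm p.1) ∈ ball (φ a) r ∧
        φ (Z.symm p.2) ∈ ball (φ a) r := by
      rw [nhds_prod_eq]
      exact h1.prod_mk h1
    filter_upwards [h2] with p hp
    set u := φ (Z.symm p.1)
    set w := φ (Z.symm p.2)
    have hseg : ∀ t ∈ Set.uIcc (0 : ℝ) 1, u + (t : ℂ) * (w - u) ∈ ball (φ a) r := by
      intro t ht
      rw [Set.uIcc_of_le zero_le_one] at ht
      have := (convex_ball (φ a) r).add_smul_sub_mem hp.1 hp.2 ht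
      simpa using this
    have hlin : ∀ t : ℝ, HasDerivAt (fun t : ℝ => u + (t : ℂ) * (w - u)) (w - u) t := fun t => by
      simpa using ((Complex.ofRealCLM.hasDerivAt (x := t)).mul_const (w - u)).const_add u
    have hF : ∀ t ∈ Set.uIcc (0 : ℝ) 1, HasDerivAt (fun t : ℝ => Q₀ (u + (t : ℂ) * (w - u)))
        (η (coordVec φ (u + (t : ℂ) * (w - u))) * (w - u)) t := fun t ht => by
      exact (hball _ (hseg t ht)).1.comp t (hlin t)
    have hint : IntervalIntegrable (fun t : ℝ =>
        η (coordVec φ (u + (t : ℂ) * (w - u))) * (w - u)) MeasureTheory.volume 0 1 := by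
      refine ContinuousOn.intervalIntegrable fun t ht => ?_
      refine ContinuousAt.continuousWithinAt ?_
      refine ContinuousAt.mul ?_ continuousAt_const
      exact ContinuousAt.comp (f := fun t : ℝ => u + (t : ℂ) * (w - u))
        (g := fun z => η (coordVec φ z)) (hball _ (hseg t ht)).2.continuousAt (hlin t).continuousAt
    have := intervalIntegral.integral_eq_sub_of_hasDerivAt hF hint
    simpa [localIntegral] using this

/-- The coefficients of the expansion of `ω₀₂` in a local coordinate `Z` at `0` (up to a factor
`k + 1`). -/
def basisForm (S : SpectralCurve X) (Z : OpenPartialHomeomorph X ℂ) (k : ℕ) (v : TVec X) : ℂ :=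
  iteratedDeriv k (fun z => S.ω₀₂.eval v (coordVec Z z)) 0 / ((k + 1).factorial : ℂ)

theorem basisForm_smulVec (S : SpectralCurve X) (Z : OpenPartialHomeomorph X ℂ) (k : ℕ) (c : ℂ)
    (v : TVec X) : basisForm S Z k (smulVec c v) = c * basisForm S Z k v := by
  unfold basisForm
  simp only [BiForm.eval_smulVec_left]
  rw [iteratedDeriv_const_mul_field, mul_div_assoc]

/-- The factor of the recursion kernel which does not depend on its first argument. -/
def kernelFactor (S : SpectralCurve X) (Z : OpenPartialHomeomorph X ℂ) (z : ℂ) : ℂ :=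
  ((S.y (Z.symm z) - S.y (Z.symm (-z))) * (2 * z))⁻¹

/-- The difference `y(z) - y(-z)` vanishes at `0` with derivative `2 y'(0) ≠ 0`, and `dx = 2z dz`
vanishes once more. -/
theorem IsSpecialChart.poleAt_kernelFactor (hS : S.IsRegular) (h : IsSpecialChart S a Z)
    (ha : a ∈ S.ram) : PoleAt 2 (kernelFactor S Z) := by
  obtain ⟨h1, h2⟩ := h.y_analyticAt hS ha
  set Y : ℂ → ℂ := fun z => S.y (Z.symm z) with hY
  have hneg : AnalyticAt ℂ (fun z => Y (-z)) 0 :=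
    AnalyticAt.comp_of_eq (g := Y) (f := fun z : ℂ => -z) h1 analyticAt_id.neg (by simp)
  set D : ℂ → ℂ := fun z => Y z - Y (-z) with hD
  have hDa : AnalyticAt ℂ D 0 := h1.sub hneg
  have hD0 : D 0 = 0 := by simp [hD]
  have hD1 : deriv D 0 = 2 * deriv Y 0 := by
    have d1 := h1.differentiableAt.hasDerivAt
    have d1' : HasDerivAt Y (deriv Y 0) (-(0 : ℂ)) := by simpa using d1
    have d2 := d1'.comp (0 : ℂ) (hasDerivAt_neg (0 : ℂ))
    have d3 : HasDerivAt D _ 0 := d1.sub d2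
    rw [d3.deriv]
    ring
  have hg := AnalyticAt.dslope hDa
  have hg0 : 2 * dslope D 0 0 ≠ 0 := by
    rw [dslope_same, hD1]
    simpa using h2
  refine ⟨fun z => (2 * dslope D 0 z)⁻¹, (analyticAt_const.mul hg).inv hg0, ?_⟩
  filter_upwards [self_mem_nhdsWithin] with z hz
  have hz : z ≠ 0 := hz
  have h3 := sub_smul_dslope D 0 z
  rw [hD0, sub_zero, sub_zero, smul_eq_mul] at h3
  change (D z * (2 * z))⁻¹ = _
  rw [← h3, zpow_neg, ← mul_inv]
  congr 1
  norm_cast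
  ring

theorem IsSpecialChart.poleAt_diagonal (h : IsSpecialChart S a Z) :
    PoleAt 2 (fun z => S.ω₀₂.eval (coordVec Z z) (coordVec Z (-z))) := by
  obtain ⟨k, k1, k2⟩ := S.fundamental.diagonal Z h.mem
  have hk : AnalyticAt ℂ (fun z : ℂ => k (z, -z)) 0 :=
    AnalyticAt.comp_of_eq (g := k) (f := fun z : ℂ => (z, -z)) (y := (0, 0))
      (k1 (0, 0) ⟨h.zero_mem, h.zero_mem⟩) (analyticAt_id.prod analyticAt_id.neg) (by simp)
  refine PoleAt.congr (f := fun z => 1 / 4 * z ^ (-2 : ℤ) + k (z, -z)) ?_ ?_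
  · exact ((poleAt_zpow (-2)).const_mul _).add ((AnalyticAt.poleAt hk).mono (by norm_num))
  · filter_upwards [h.eventually_mem.filter_mono nhdsWithin_le_nhds,
      (tendsto_neg_zero.eventually h.eventually_mem).filter_mono nhdsWithin_le_nhds,
      self_mem_nhdsWithin] with z e1 e2 e3
    have e3 : z ≠ 0 := e3
    rw [k2 z e1 (-z) e2 (by simpa using fun h => e3 (self_eq_neg.1 h))]
    congr 1
    rw [zpow_neg, sub_neg_eq_add, ← two_mul, mul_pow]
    norm_cast
    field_simp
    norm_num

theorem IsSpecialChart.poleAt_action (hS : S.IsRegular) (h : IsSpecialChart S a Z)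
    (ha : a ∈ S.ram) :
    PoleAt 0 (fun z => localIntegral a (fun v => S.y v.proj * S.dx.eval v) a (Z.symm z)) := by
  have hc := IsManifold.chart_mem_maximalAtlas (I := 𝓘(ℂ)) (n := ω) a
  have hs := mem_chart_source ℂ a
  have hy := S.y_branch a (SpectralCurve.mem_ram.1 ha) (hS a ha).ge
  have hx := S.x_branch a (SpectralCurve.mem_ram.1 ha)
  have h1 := analyticAt_comp_symm (hy.mono fun z hz => hz.1) hc hs
  have h2 := analyticAt_comp_symm (hx.mono fun z hz => hz.1) hc hs
  have h3 := hx.eval_velocity ((chartAt ℂ a).continuousAt_symm (mem_chart_target ℂ a))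
    ((chartAt ℂ a).left_inv hs) (Filter.mem_of_superset ((chartAt ℂ a).open_target.mem_nhds
      (mem_chart_target ℂ a)) fun w hw => mdifferentiableAt_symm hc hw)
  obtain ⟨Q, q1, -, q3⟩ := h.localIntegral_eq (η := fun v => S.y v.proj * S.dx.eval v)
    (fun c u => by rw [OneForm.eval_smulVec, smulVec_proj]; ring) (by
      refine (h1.mul h2.deriv).congr ?_
      filter_upwards [h3] with w hw
      simp only [Pi.mul_apply]
      rw [← hw.2]
      rfl)
  refine PoleAt.congr (f := fun z => Q z - Q 0) (AnalyticAt.poleAt (q1.sub analyticAt_const)) ?_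
  have ht : Tendsto (fun z : ℂ => ((0 : ℂ), z)) (𝓝 0) (𝓝 (0, 0)) :=
    Continuous.tendsto' (by fun_prop) _ _ rfl
  filter_upwards [(ht.eventually q3).filter_mono nhdsWithin_le_nhds] with z hz
  rw [← hz, h.symm_zero]

/-- Differentiating `1/(z - w)^2` at `w = 0` shows that the polar part of `ξ_{a,l}` is exactly
`z^(-(l+2))`; the factor `1/(l+1)!` in the definition normalizes it so. The regular part is bounded
by Cauchy estimates, with a constant independent of `l`. -/
theorem IsSpecialChart.eventually_basis_self (h : IsSpecialChart S a Z) :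
    ∀ᶠ R : ℝ in 𝓝[>] 0, ∃ M, ∀ l : ℕ, PoleLE R (l + 2)
      (fun z => basisForm S Z l (coordVec Z z)) (M * R ^ (-((l : ℤ) + 2))) := by
  obtain ⟨k, k1, k2⟩ := S.fundamental.diagonal Z h.mem
  obtain ⟨r, hr, hball⟩ := Metric.eventually_nhds_iff_ball.1 h.eventually_mem
  filter_upwards [Ioo_mem_nhdsGT hr] with R hR
  have hR0 : 0 < R := hR.1
  have hsub : closedBall (0 : ℂ) R ⊆ Z.target := fun z hz =>
    hball z (closedBall_subset_ball hR.2 hz)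
  obtain ⟨M, hM, hk⟩ := exists_bound_iteratedDeriv_snd hR0 (h := k)
    fun p hp => k1 p ⟨hsub hp.1, hsub hp.2⟩
  refine ⟨1 + M * R ^ 2, fun l => ?_⟩
  obtain ⟨a1, a2⟩ := hk l
  have h1 : PoleLE R (l + 2) (fun z => z ^ (-((l : ℤ) + 2))) (R ^ (-((l : ℤ) + 2))) := by
    simpa using poleLE_zpow (R := R) (-((l : ℤ) + 2))
  have h2 : PoleLE R 0 (fun z => iteratedDeriv l (fun w => k (z, w)) 0 / ((l + 1).factorial : ℂ))
      (M / R ^ l) :=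
    ⟨⟨_, a1, by simp⟩, fun z hz => a2 z (sphere_subset_closedBall hz)⟩
  have h3 := h1.add (h2.mono (show (0 : ℤ) ≤ l + 2 by omega) le_rfl)
  refine (h3.mono le_rfl (le_of_eq ?_)).congr hR0 fun z hz hz0 => ?_
  · rw [add_mul, one_mul, neg_add, zpow_add₀ hR0.ne', zpow_neg, zpow_natCast]
    congr 1
    rw [zpow_neg]
    norm_cast
    field_simp
  · unfold basisForm
    have h0 : (0 : ℂ) ∈ closedBall (0 : ℂ) R := by simp [hR0.le]
    have he : (fun w => S.ω₀₂.eval (coordVec Z z) (coordVec Z w)) =ᶠ[𝓝 0]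
        ((fun w => 1 / (z - w) ^ 2) + fun w => k (z, w)) := by
      filter_upwards [h.eventually_mem, isOpen_ne.mem_nhds hz0.symm] with w e1 e2
      exact k2 z (hsub hz) w e1 (Ne.symm e2)
    rw [Filter.EventuallyEq.iteratedDeriv_eq l he, iteratedDeriv_add, iteratedDeriv_inv_sub_sq l z 0 hz0.symm,
      sub_zero, add_div, mul_div_cancel_left₀]
    · exact_mod_cast Nat.factorial_ne_zero _
    · refine AnalyticAt.contDiffAt ?_
      exact analyticAt_const.div ((analyticAt_const.sub analyticAt_id).pow 2) (by simpa using hz0)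
    · refine AnalyticAt.contDiffAt ?_
      exact AnalyticAt.comp (g := k) (f := fun w : ℂ => (z, w)) (k1 (z, 0) ⟨hsub hz, hsub h0⟩)
        (analyticAt_const.prod analyticAt_id)

theorem eventually_nhdsGT_closedBall {p : ℂ → Prop} (h : ∀ᶠ z in 𝓝 (0 : ℂ), p z) :
    ∀ᶠ R : ℝ in 𝓝[>] 0, ∀ z ∈ closedBall (0 : ℂ) R, p z := by
  obtain ⟨r, hr, hball⟩ := Metric.eventually_nhds_iff_ball.1 h
  filter_upwards [Ioo_mem_nhdsGT hr] with R hR z hz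
  exact hball z (closedBall_subset_ball hR.2 hz)

/-- At two distinct points `ω_{0,2}` is holomorphic on a product of small discs, so there is no
pole. The order `l + 2` is kept for uniformity with the case of equal points. -/
theorem IsSpecialChart.eventually_basis_ne [T2Space X] (h : IsSpecialChart S a Z) {b : X}
    {W : OpenPartialHomeomorph X ℂ} (h' : IsSpecialChart S b W) (hab : a ≠ b) :
    ∀ᶠ R : ℝ in 𝓝[>] 0, ∃ M, ∀ l : ℕ, PoleLE R (l + 2)
      (fun z => basisForm S W l (coordVec Z z)) (M * R ^ (-((l : ℤ) + 2))) := by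
  obtain ⟨U, V, hU, hV, haU, hbV, hUV⟩ := t2_separation hab
  filter_upwards [eventually_nhdsGT_closedBall (h.tendsto_symm.eventually (hU.mem_nhds haU)),
    eventually_nhdsGT_closedBall (h'.tendsto_symm.eventually (hV.mem_nhds hbV)),
    eventually_nhdsGT_closedBall h.eventually_mem, eventually_nhdsGT_closedBall h'.eventually_mem,
    self_mem_nhdsWithin] with R r1 r2 r3 r4 hR0
  have hR0 : 0 < R := hR0
  obtain ⟨M, hM, hk⟩ := exists_bound_iteratedDeriv_snd hR0
    (h := fun w : ℂ × ℂ => S.ω₀₂.eval (coordVec Z w.1) (coordVec W w.2))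
    fun p hp => S.fundamental.holomorphic Z h.mem W h'.mem p ⟨r3 _ hp.1, r4 _ hp.2,
      fun e => Set.disjoint_left.1 hUV (r1 _ hp.1) (e ▸ r2 _ hp.2)⟩
  refine ⟨M * R ^ 2, fun l => ?_⟩
  obtain ⟨a1, a2⟩ := hk l
  have h2 : PoleLE R 0 (fun z => basisForm S W l (coordVec Z z)) (M / R ^ l) :=
    ⟨⟨_, a1, by simp [basisForm]⟩, fun z hz => a2 z (sphere_subset_closedBall hz)⟩
  refine h2.mono (by omega) (le_of_eq ?_)
  rw [neg_add, zpow_add₀ hR0.ne', zpow_neg, zpow_natCast, zpow_neg]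
  norm_cast
  field_simp

end Forms

/-! ### A common radius and a common constant -/

section Frames

variable {X : Type*} [TopologicalSpace X] [ChartedSpace ℂ X] [IsManifold 𝓘(ℂ) ω X]

/-- Special coordinates at all ramification points, with a common radius `R` and a common constant
`c` for all the estimates which the recursion needs. -/
structure Frame (S : SpectralCurve X) where
  Z : X → OpenPartialHomeomorph X ℂ
  R : ℝ
  c : ℝ
  R_pos : 0 < R
  c_pos : 0 < c
  special : ∀ a ∈ S.ram, IsSpecialChart S a (Z a)
  off : ∀ a ∈ S.ram, ∀ z ∈ closedBall (0 : ℂ) R, z ≠ 0 → (Z a).symm z ∉ S.ram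
  kernel_le : ∀ a ∈ S.ram, PoleLE R 2 (kernelFactor S (Z a)) c
  basis_le : ∀ a ∈ S.ram, ∀ b ∈ S.ram, ∀ l : ℕ, PoleLE R (l + 2)
    (fun z => basisForm S (Z b) l (coordVec (Z a) z)) (c * R ^ (-((l : ℤ) + 2)))
  diag_le : ∀ a ∈ S.ram, PoleLE R 2
    (fun z => S.ω₀₂.eval (coordVec (Z a) z) (coordVec (Z a) (-z))) c
  action_le : ∀ a ∈ S.ram, PoleLE R 0
    (fun z => localIntegral a (fun v => S.y v.proj * S.dx.eval v) a ((Z a).symm z)) c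

/-- Every requirement holds for all small radii and there are finitely many ramification points, so
one radius serves all. Bounds for that radius are then combined into one constant. -/
theorem exists_frame [T2Space X] (S : SpectralCurve X) (hS : S.IsRegular) : Nonempty (Frame S) := by
  classical
  have hZ : ∀ a, ∃ Z, a ∈ S.ram → IsSpecialChart S a Z := fun a => by
    by_cases ha : a ∈ S.ram
    · obtain ⟨Z, h⟩ := exists_isSpecialChart S ha
      exact ⟨Z, fun _ => h⟩
    · exact ⟨chartAt ℂ a, fun h => (ha h).elim⟩
  choose Z hZ using hZ
  have hoff : ∀ a ∈ S.ram, ∀ᶠ z in 𝓝 (0 : ℂ), z ≠ 0 → (Z a).symm z ∉ S.ram := by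
    intro a ha
    have h := hZ a ha
    have hcl : IsClosed ((S.ram.erase a : Finset X) : Set X) := (Finset.finite_toSet _).isClosed
    filter_upwards [h.tendsto_symm.eventually (hcl.isOpen_compl.mem_nhds (by simp)),
      h.eventually_mem] with z e1 e2 hz hr
    have e3 : (Z a).symm z = a := by
      by_contra hne
      exact e1 (by simpa using ⟨hr, hne⟩)
    exact hz ((Z a).symm.injOn e2 h.zero_mem (e3.trans h.symm_zero.symm))
  have hall : ∀ᶠ R : ℝ in 𝓝[>] 0, ∀ a ∈ S.ram,
      (∀ z ∈ closedBall (0 : ℂ) R, z ≠ 0 → (Z a).symm z ∉ S.ram) ∧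
      (∃ M, PoleLE R 2 (kernelFactor S (Z a)) M) ∧
      (∃ M, PoleLE R 2 (fun z => S.ω₀₂.eval (coordVec (Z a) z) (coordVec (Z a) (-z))) M) ∧
      (∃ M, PoleLE R 0
        (fun z => localIntegral a (fun v => S.y v.proj * S.dx.eval v) a ((Z a).symm z)) M) ∧
      ∀ b ∈ S.ram, ∃ M, ∀ l : ℕ, PoleLE R (l + 2)
        (fun z => basisForm S (Z b) l (coordVec (Z a) z)) (M * R ^ (-((l : ℤ) + 2))) := by
    rw [Filter.eventually_all_finset]
    intro a ha
    have h := hZ a ha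
    refine (eventually_nhdsGT_closedBall (hoff a ha)).and
      ((h.poleAt_kernelFactor hS ha).eventually_poleLE.and
      (h.poleAt_diagonal.eventually_poleLE.and
      ((h.poleAt_action hS ha).eventually_poleLE.and ?_)))
    rw [Filter.eventually_all_finset]
    intro b hb
    by_cases hab : a = b
    · subst hab
      exact h.eventually_basis_self
    · exact h.eventually_basis_ne (hZ b hb) hab
  obtain ⟨R, hR, hR0⟩ := (hall.and self_mem_nhdsWithin).exists
  have hR0 : 0 < R := hR0
  have hM : ∀ a, ∃ M : ℝ, a ∈ S.ram → PoleLE R 2 (kernelFactor S (Z a)) M ∧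
      PoleLE R 2 (fun z => S.ω₀₂.eval (coordVec (Z a) z) (coordVec (Z a) (-z))) M ∧
      PoleLE R 0
        (fun z => localIntegral a (fun v => S.y v.proj * S.dx.eval v) a ((Z a).symm z)) M ∧
      ∀ b ∈ S.ram, ∀ l : ℕ, PoleLE R (l + 2)
        (fun z => basisForm S (Z b) l (coordVec (Z a) z)) (M * R ^ (-((l : ℤ) + 2))) := by
    intro a
    by_cases ha : a ∈ S.ram
    · obtain ⟨-, ⟨M1, h1⟩, ⟨M2, h2⟩, ⟨M3, h3⟩, h4⟩ := hR a ha
      choose! M4 h4 using h4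
      refine ⟨∑ b ∈ S.ram, |M4 b| + (|M1| + |M2| + |M3|), fun _ => ⟨h1.mono le_rfl ?_,
        h2.mono le_rfl ?_, h3.mono le_rfl ?_, fun b hb l => (h4 b hb l).mono le_rfl ?_⟩⟩
      all_goals have hs : 0 ≤ ∑ b ∈ S.ram, |M4 b| := Finset.sum_nonneg fun b _ => abs_nonneg _
      · linarith [le_abs_self M1, abs_nonneg M2, abs_nonneg M3]
      · linarith [le_abs_self M2, abs_nonneg M1, abs_nonneg M3]
      · linarith [le_abs_self M3, abs_nonneg M1, abs_nonneg M2]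
      · have := Finset.single_le_sum (f := fun b => |M4 b|) (fun b _ => abs_nonneg _) hb
        gcongr
        linarith [le_abs_self (M4 b), abs_nonneg M1, abs_nonneg M2, abs_nonneg M3]
    · exact ⟨0, fun h => (ha h).elim⟩
  choose M hM using hM
  have hle : ∀ a ∈ S.ram, M a ≤ ∑ b ∈ S.ram, |M b| + 1 := fun a ha => by
    have := Finset.single_le_sum (f := fun b => |M b|) (fun b _ => abs_nonneg _) ha
    linarith [le_abs_self (M a)]
  exact ⟨{
    Z := Z
    R := R
    -- The summand `1` keeps the constant positive even if there is no ramification point.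
    c := ∑ b ∈ S.ram, |M b| + 1
    R_pos := hR0
    c_pos := by
      have : 0 ≤ ∑ b ∈ S.ram, |M b| := Finset.sum_nonneg fun b _ => abs_nonneg _
      linarith
    special := hZ
    off := fun a ha => (hR a ha).1
    kernel_le := fun a ha => (hM a ha).1.mono le_rfl (hle a ha)
    basis_le := fun a ha b hb l => ((hM a ha).2.2.2 b hb l).mono le_rfl (by
      have := hle a ha
      gcongr)
    diag_le := fun a ha => (hM a ha).2.1.mono le_rfl (hle a ha)
    action_le := fun a ha => (hM a ha).2.2.1.mono le_rfl (hle a ha) }⟩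

end Frames

/-! ### The residue of the kernel against a quadratic differential -/

section KernelResidue

variable {X : Type*} [TopologicalSpace X] [ChartedSpace ℂ X] [IsManifold 𝓘(ℂ) ω X]
  {S : SpectralCurve X} {a : X} {Z : OpenPartialHomeomorph X ℂ}

/-- The kernel has weight `-1` in its second argument, so its product with a quadratic differential
is a `1`-form and has a coordinate-free residue. -/
theorem kernel_smulVec (S : SpectralCurve X) (a : X) (v u : TVec X) (c : ℂ) :
    S.kernel a v (smulVec c u) = c⁻¹ * S.kernel a v u := by
  unfold SpectralCurve.kernel
  rw [OneForm.eval_smulVec, smulVec_proj, div_eq_mul_inv, div_eq_mul_inv,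
    show (S.y u.proj - S.y (S.galois a u.proj)) * (c * S.dx.eval u) =
      c * ((S.y u.proj - S.y (S.galois a u.proj)) * S.dx.eval u) by ring, mul_inv]
  ring

/-- Expansion of the recursion kernel near a ramification point. -/
theorem IsSpecialChart.kernel_eq (h : IsSpecialChart S a Z) (ha : a ∈ S.ram) {v : TVec X}
    (hv : v.proj ≠ a) :
    ∃ T : ℂ → ℂ, AnalyticAt ℂ T 0 ∧
      (∀ᶠ z in 𝓝 0, S.kernel a v (coordVec Z z) = T z * kernelFactor S Z z) ∧ T 0 = 0 ∧
      ∀ k : ℕ, iteratedDeriv (k + 1) T 0 / ((k + 1).factorial : ℂ) =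
        if Even k then basisForm S Z k v else 0 := by
  have hc := IsManifold.chart_mem_maximalAtlas (I := 𝓘(ℂ)) (n := ω) a
  obtain ⟨Q, q1, q2, q3⟩ := h.localIntegral_eq (η := S.ω₀₂.eval v)
    (fun c u => BiForm.eval_smulVec_right _ _ _ _)
    (S.fundamental.analyticAt v hc (mem_chart_target ℂ a)
      (by rwa [(chartAt ℂ a).left_inv (mem_chart_source ℂ a)]))
  have hneg : AnalyticAt ℂ (fun z => Q (-z)) 0 :=
    AnalyticAt.comp_of_eq (g := Q) (f := fun z : ℂ => -z) q1 analyticAt_id.neg (by simp)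
  -- With `Q` a primitive of `ω_{0,2}(v, ·)`, this is half the integral from `-z` to `z`. It is odd,
  -- so only its coefficients of odd order `k + 1` survive; `k` must be even.
  refine ⟨fun z => 1 / 2 * (Q z - Q (-z)), analyticAt_const.mul (q1.sub hneg), ?_, by simp, ?_⟩
  · have ht : Tendsto (fun z : ℂ => (-z, z)) (𝓝 0) (𝓝 (0, 0)) :=
      Continuous.tendsto' (by fun_prop) _ _ (by simp)
    filter_upwards [ht.eventually q3, h.galois_eq, h.dx_eq ha] with z e1 e2 e3
    unfold SpectralCurve.kernel kernelFactor
    rw [coordVec_proj, e2, e1, e3, div_eq_mul_inv]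
  · intro k
    have hd : deriv Q =ᶠ[𝓝 0] fun z => S.ω₀₂.eval v (coordVec Z z) := by
      filter_upwards [q2] with z hz using hz.deriv
    have h1 : iteratedDeriv (k + 1) Q 0 =
        iteratedDeriv k (fun z => S.ω₀₂.eval v (coordVec Z z)) 0 := by
      rw [iteratedDeriv_succ', Filter.EventuallyEq.iteratedDeriv_eq k hd]
    have h2 : iteratedDeriv (k + 1) (fun z => 1 / 2 * (Q z - Q (-z))) 0 =
        1 / 2 * (iteratedDeriv (k + 1) Q 0 - (-1) ^ (k + 1) * iteratedDeriv (k + 1) Q 0) := by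
      rw [iteratedDeriv_const_mul_field]
      congr 1
      have := iteratedDeriv_sub (n := k + 1) (x := (0 : ℂ)) q1.contDiffAt hneg.contDiffAt
      rw [show (fun z => Q z - Q (-z)) = Q - fun z => Q (-z) from rfl, this,
        iteratedDeriv_comp_neg]
      simp
    rw [h2, h1]
    unfold basisForm
    split_ifs with he
    · rw [he.add_one.neg_one_pow]
      ring
    · rw [(Nat.not_even_iff_odd.1 he).add_one.neg_one_pow]
      ring

/-- The residue of the recursion kernel against a quadratic differential. -/
theorem IsSpecialChart.hasResidue_kernel_mul (hS : S.IsRegular) (h : IsSpecialChart S a Z)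
    (ha : a ∈ S.ram) {v : TVec X} (hv : v.proj ≠ a) {Q : TVec X → ℂ} {q : ℂ → ℂ} {N : ℕ}
    (hq : PoleAt N q)
    (hQ : ∀ᶠ z in 𝓝[≠] 0, ∀ c, Q (smulVec c (coordVec Z z)) = c ^ 2 * q z) :
    HasResidue (fun w => S.kernel a v (coordVec (chartAt ℂ a) w) * Q (coordVec (chartAt ℂ a) w))
      (chartAt ℂ a a) (∑ k ∈ Finset.range (N + 1), (if Even k then basisForm S Z k v else 0) *
        residue (fun z => z ^ (k + 1) * (kernelFactor S Z z * q z)) 0) := by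
  have hc := IsManifold.chart_mem_maximalAtlas (I := 𝓘(ℂ)) (n := ω) a
  have hs := mem_chart_source ℂ a
  have ht := mem_chart_target ℂ a
  obtain ⟨T, t1, t2, t3, t4⟩ := h.kernel_eq ha hv
  have hG : PoleAt (2 + N) fun z => kernelFactor S Z z * q z := (h.poleAt_kernelFactor hS ha).mul hq
  -- The kernel factor adds two to the pole order, so Taylor coefficients of order below `N + 2`
  -- matter. The one of order `0` vanishes, leaving `k ≤ N`.
  have hres := residue_analytic_mul t1 hG (N := N + 2) (by push_cast; omega)
  rw [Finset.sum_range_succ'] at hres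
  simp only [t4, iteratedDeriv_zero, t3, zero_div, zero_mul, add_zero] at hres
  rw [← hres]
  set φ := chartAt ℂ a
  have hs' : φ.symm (φ a) ∈ Z.source := by rw [φ.left_inv hs]; exact h.mem_source
  have hκ := analyticAt_transition h.mem hc ht hs'
  have hκ0 : Z (φ.symm (φ a)) = 0 := by rw [φ.left_inv hs, h.map_eq]
  have hκ1 := deriv_transition_ne_zero h.mem hc ht hs'
  refine ((AnalyticAt.poleAt t1).mul hG).residue_comp hκ hκ0 hκ1 ?_
  have hev : ∀ᶠ w in 𝓝 (φ a), w ∈ φ.target ∧ φ.symm w ∈ Z.source :=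
    (φ.open_target.eventually_mem ht).and ((φ.continuousAt_symm ht).eventually
      (Z.open_source.mem_nhds hs'))
  have hκt : Tendsto (fun w => Z (φ.symm w)) (𝓝 (φ a)) (𝓝 0) := by
    have := hκ.continuousAt.tendsto
    rwa [hκ0] at this
  have hκt' : Tendsto (fun w => Z (φ.symm w)) (𝓝[≠] (φ a)) (𝓝[≠] 0) := by
    refine tendsto_nhdsWithin_iff.2 ⟨hκt.mono_left nhdsWithin_le_nhds, ?_⟩
    filter_upwards [hev.filter_mono nhdsWithin_le_nhds, self_mem_nhdsWithin] with w e1 e2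
    intro e3
    have e4 : Z (φ.symm w) = Z a := e3.trans h.map_eq.symm
    have e5 := Z.injOn e1.2 h.mem_source e4
    exact e2 (by rw [Set.mem_singleton_iff, ← e5, φ.right_inv e1.1])
  filter_upwards [hev.filter_mono nhdsWithin_le_nhds, hκt'.eventually hQ,
    (hκt.eventually t2).filter_mono nhdsWithin_le_nhds] with w e1 e2 e3
  have hne := deriv_transition_ne_zero h.mem hc e1.1 e1.2
  rw [coordVec_eq_smulVec h.mem hc e1.1 e1.2, kernel_smulVec, e2, e3]
  field_simp

end KernelResidue

/-! ### Expansions in products of basis forms -/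

section Expansions

variable {X : Type*} [TopologicalSpace X] [ChartedSpace ℂ X] [IsManifold 𝓘(ℂ) ω X]
  {S : SpectralCurve X}

/-- Indices of the basis forms: a ramification point and an order. -/
abbrev Index (S : SpectralCurve X) : Type _ := {a // a ∈ S.ram} × ℕ

/-- The total order of a multi-index. -/
def degree {n : ℕ} (α : Fin n → Index S) : ℤ := ∑ i, ((α i).2 : ℤ)

/-- The multi-indices all of whose orders are at most `K`. -/
def box (S : SpectralCurve X) (n K : ℕ) : Finset (Fin n → Index S) :=
  Fintype.piFinset fun _ => Finset.univ ×ˢ Finset.range (K + 1)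

/-- All base points of the tuple of tangent vectors avoid the ramification points. -/
def OffRam (S : SpectralCurve X) {n : ℕ} (v : Fin n → TVec X) : Prop := ∀ i, (v i).proj ∉ S.ram

theorem mem_box {n K : ℕ} {α : Fin n → Index S} : α ∈ box S n K ↔ ∀ i, (α i).2 ≤ K := by
  simp [box]

theorem box_mono {n K L : ℕ} (h : K ≤ L) : box S n K ⊆ box S n L := fun _ hα =>
  mem_box.2 fun i => (mem_box.1 hα i).trans h

theorem mem_box_of_degree_le {n K : ℕ} {α : Fin n → Index S} (h : degree α ≤ K) :
    α ∈ box S n K := by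
  refine mem_box.2 fun i => ?_
  have := Finset.single_le_sum (f := fun i => ((α i).2 : ℤ)) (fun _ _ => by positivity)
    (Finset.mem_univ i)
  unfold degree at h
  exact_mod_cast this.trans h

theorem degree_nonneg {n : ℕ} (α : Fin n → Index S) : 0 ≤ degree α :=
  Finset.sum_nonneg fun _ _ => by positivity

theorem degree_cons {n : ℕ} (i : Index S) (α : Fin n → Index S) :
    degree (Fin.cons i α : Fin (n + 1) → Index S) = i.2 + degree α := by
  simp [degree, Fin.sum_univ_succ]

theorem sum_box_succ {n K : ℕ} (f : (Fin (n + 1) → Index S) → ℂ) :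
    ∑ α ∈ box S (n + 1) K, f α =
      ∑ i ∈ Finset.univ ×ˢ Finset.range (K + 1), ∑ α ∈ box S n K, f (Fin.cons i α) := by
  rw [← Finset.sum_product']
  refine Finset.sum_nbij' (fun α => (α 0, Fin.tail α)) (fun p => Fin.cons p.1 p.2) ?_ ?_ ?_ ?_ ?_
  · intro α hα
    rw [mem_box] at hα
    simp only [Finset.mem_product, Finset.mem_univ, Finset.mem_range, true_and, mem_box]
    exact ⟨by have := hα 0; omega, fun i => hα i.succ⟩
  · intro p hp
    simp only [Finset.mem_product, Finset.mem_univ, Finset.mem_range, true_and, mem_box] at hp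
    rw [mem_box]
    intro i
    refine Fin.cases ?_ (fun i => ?_) i
    · simp only [Fin.cons_zero]; omega
    · simpa using hp.2 i
  · intro α _; exact Fin.cons_self_tail α
  · intro p _; simp
  · intro α _; simp

/-- The order of the pole of the slot basis: the basis forms `Sum.inl` and the monomials
`Sum.inr`. -/
def slotDegree : Index S ⊕ ℕ → ℤ
  | Sum.inl i => i.2 + 2
  | Sum.inr j => -j

/-- The slot indices of order at most `K`. -/
def slotBox (S : SpectralCurve X) (K : ℕ) : Finset (Index S ⊕ ℕ) :=
  (Finset.univ ×ˢ Finset.range (K + 1)).disjSum (Finset.range (K + 1))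

theorem sum_slotBox {M : Type*} [AddCommMonoid M] (K : ℕ) (f : Index S ⊕ ℕ → M) :
    ∑ κ ∈ slotBox S K, f κ =
      ∑ i ∈ Finset.univ ×ˢ Finset.range (K + 1), f (Sum.inl i) +
        ∑ j ∈ Finset.range (K + 1), f (Sum.inr j) := by
  simp [slotBox, Finset.sum_disjSum]

/-- The slot degree is injective on each ramification point's family of forms and on the monomials.
These are `card + 1` separate convolutions. -/
theorem sum_slotBox_weight_le {ρ : ℝ} (hρ : 0 < ρ) (A B : ℤ) (K : ℕ) :
    ∑ κ ∈ slotBox S K, weight ρ (A - slotDegree κ) * weight ρ (slotDegree κ - B) ≤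
      (S.ram.card + 1) * convConst * weight ρ (A - B) := by
  rw [sum_slotBox, Finset.sum_product]
  simp only [slotDegree]
  have h1 := sum_weight_mul_weight_le hρ A B (Finset.range (K + 1)) (fun l : ℕ => (l : ℤ) + 2)
    (fun i _ j _ h => by simp only at h; omega)
  have h2 := sum_weight_mul_weight_le hρ A B (Finset.range (K + 1)) (fun l : ℕ => -(l : ℤ))
    (fun i _ j _ h => by simp only at h; omega)
  calc _ ≤ ∑ x : {a // a ∈ S.ram}, convConst * weight ρ (A - B) + convConst * weight ρ (A - B) :=
        add_le_add (Finset.sum_le_sum fun _ _ => h1) h2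
    _ = _ := by
        rw [Finset.sum_const, Finset.card_univ, Fintype.card_coe, nsmul_eq_mul]
        ring

namespace Frame

variable (F : Frame S)

/-- The basis form with a given index. -/
def form (i : Index S) (v : TVec X) : ℂ := basisForm S (F.Z i.1) i.2 v

/-- The product of basis forms with a given multi-index. -/
def mon {n : ℕ} (α : Fin n → Index S) (v : Fin n → TVec X) : ℂ := ∏ i, F.form (α i) (v i)

/-- The base of the exponential weights. -/
def rate : ℝ := 2 / F.R

theorem rate_pos : 0 < F.rate := div_pos two_pos F.R_pos

theorem mon_cons {n : ℕ} (i : Index S) (α : Fin n → Index S) (v : Fin (n + 1) → TVec X) :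
    F.mon (Fin.cons i α : Fin (n + 1) → Index S) v = F.form i (v 0) * F.mon α (Fin.tail v) := by
  simp [mon, Fin.prod_univ_succ, Fin.tail]

/-- The slot basis near a ramification point, in the special coordinate. -/
def slotFun (a : X) : Index S ⊕ ℕ → ℂ → ℂ
  | Sum.inl i => fun z => F.form i (coordVec (F.Z a) z)
  | Sum.inr j => fun z => z ^ j

theorem slot_le {a : X} (ha : a ∈ S.ram) (κ : Index S ⊕ ℕ) :
    PoleLE F.R (slotDegree κ) (F.slotFun a κ) ((F.c + 1) * F.R ^ (-slotDegree κ)) := by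
  have hR := F.R_pos
  have hc := F.c_pos
  cases κ with
  | inl i =>
    refine (F.basis_le a ha i.1 i.1.2 i.2).mono le_rfl ?_
    simp only [slotDegree]
    gcongr
    linarith
  | inr j =>
    have h := poleLE_zpow (R := F.R) (j : ℤ)
    simp only [zpow_natCast] at h
    refine h.mono le_rfl ?_
    simp only [slotDegree, neg_neg, zpow_natCast]
    have : 0 ≤ F.R ^ j := by positivity
    nlinarith

theorem slot_poleAt {a : X} (ha : a ∈ S.ram) (κ : Index S ⊕ ℕ) :
    PoleAt (slotDegree κ) (F.slotFun a κ) := (F.slot_le ha κ).poleAt F.R_pos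

/-- The structure constants of the recursion. -/
def tensor (a : X) (k : ℕ) (κ κ' : Index S ⊕ ℕ) : ℂ :=
  -residue (fun z => z ^ (k + 1) *
    (kernelFactor S (F.Z a) z * (F.slotFun a κ z * F.slotFun a κ' (-z)))) 0

/-- The constant in the estimate of the structure constants. -/
def tensorConst : ℝ := 4 * (F.R ^ 2 * (F.c * (F.c + 1) ^ 2))

theorem tensorConst_pos : 0 < F.tensorConst := by
  have := F.R_pos
  have := F.c_pos
  unfold tensorConst
  positivity

/-- If `deg κ + deg κ' < k` the integrand is regular and the residue vanishes, as does the weight.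
Otherwise integration over the circle of radius `R` gives a constant times `R^(-(deg κ + deg κ' -
k))`, and `1/R` is half the rate. -/
theorem tensor_le {a : X} (ha : a ∈ S.ram) (k : ℕ) (κ κ' : Index S ⊕ ℕ) :
    ‖F.tensor a k κ κ'‖ ≤
      F.tensorConst * weight F.rate (slotDegree κ + slotDegree κ' - k) := by
  have hR := F.R_pos
  have hc := F.c_pos
  have h0 : PoleLE F.R (-((k + 1 : ℕ) : ℤ)) (fun z => z ^ (k + 1)) (F.R ^ (k + 1)) := by
    have := poleLE_zpow (R := F.R) ((k + 1 : ℕ) : ℤ)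
    simpa only [zpow_natCast] using this
  have h1 := h0.mul ((F.kernel_le a ha).mul ((F.slot_le ha κ).mul (F.slot_le ha κ').comp_neg
    (by positivity)) hc.le) (by positivity)
  rw [tensor, norm_neg]
  rcases lt_or_ge (slotDegree κ + slotDegree κ' - k) 0 with h | h
  · rw [(h1.poleAt hR).residue_eq_zero (by push_cast; omega), norm_zero, weight_of_neg h, mul_zero]
  · refine (h1.norm_residue_le hR).trans ?_
    have h2 := geometric_le_weight F.rate_pos h
    rw [show F.rate / 2 = F.R⁻¹ by unfold rate; field_simp] at h2
    calc _ = F.R ^ 2 * (F.c * (F.c + 1) ^ 2) *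
          F.R⁻¹ ^ (slotDegree κ + slotDegree κ' - k) := by
          rw [inv_zpow, ← zpow_neg, show -(slotDegree κ + slotDegree κ' - (k : ℤ)) =
            -slotDegree κ + -slotDegree κ' + k by ring, zpow_add₀ hR.ne', zpow_add₀ hR.ne',
            zpow_natCast]
          ring
      _ ≤ F.R ^ 2 * (F.c * (F.c + 1) ^ 2) *
          (4 * weight F.rate (slotDegree κ + slotDegree κ' - k)) := by gcongr
      _ = _ := by unfold tensorConst; ring

/-- A multidifferential which is a combination of products of basis forms. -/
def HasExp {n : ℕ} (f : (Fin n → TVec X) → ℂ) (A : ℕ) (b : (Fin n → Index S) → ℝ) : Prop :=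
  ∃ c : (Fin n → Index S) → ℂ, (∀ α, ‖c α‖ ≤ b α * weight F.rate (A - degree α)) ∧
    ∀ v, OffRam S v → ∀ K, A ≤ K → f v = ∑ α ∈ box S n K, c α * F.mon α v

/-- The residues at `a` of a family of forms are a combination of products of basis forms. -/
def HasResExp (a : X) {n : ℕ} (f : (Fin n → TVec X) → TVec X → ℂ) (A : ℕ)
    (b : (Fin n → Index S) → ℝ) : Prop :=
  ∃ c : (Fin n → Index S) → ℂ, (∀ α, ‖c α‖ ≤ b α * weight F.rate (A - degree α)) ∧
    ∀ v, OffRam S v → HasResidue (fun w => f v (coordVec (chartAt ℂ a) w)) (chartAt ℂ a a)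
      (∑ α ∈ box S n A, c α * F.mon α v)

/-- A multidifferential whose first argument is near the ramification point `a` and is expanded in
the slot basis. -/
def HasSlotExp (a : X) {n : ℕ} (f : TVec X → (Fin n → TVec X) → ℂ) (A : ℕ)
    (b : (Fin n → Index S) → ℝ) : Prop :=
  (∀ v, OffRam S v → ∀ u : TVec X, u.proj ∉ S.ram → ∀ c, f (smulVec c u) v = c * f u v) ∧
  ∃ Φ : Index S ⊕ ℕ → (Fin n → Index S) → ℂ,
    (∀ κ α, ‖Φ κ α‖ ≤ b α * weight F.rate (A - slotDegree κ - degree α)) ∧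
    ∀ v, OffRam S v → ∀ K, A ≤ K → ∃ r : ℂ → ℂ, AnalyticAt ℂ r 0 ∧ ∀ᶠ z in 𝓝[≠] 0,
      f (coordVec (F.Z a) z) v = ∑ κ ∈ slotBox S K, ∑ α ∈ box S n K,
        Φ κ α * F.slotFun a κ z * F.mon α v + z ^ (K + 1) * r z

variable {F}

theorem coeff_eq_zero {n : ℕ} {c : (Fin n → Index S) → ℂ} {A : ℕ} {b : (Fin n → Index S) → ℝ}
    (hc : ∀ α, ‖c α‖ ≤ b α * weight F.rate (A - degree α)) {α : Fin n → Index S}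
    (h : (A : ℤ) < degree α) : c α = 0 := by
  have := hc α
  rw [weight_of_neg (by omega), mul_zero] at this
  exact norm_le_zero_iff.1 this

theorem sum_box_eq {n : ℕ} {c : (Fin n → Index S) → ℂ} {A : ℕ} {b : (Fin n → Index S) → ℝ}
    (hc : ∀ α, ‖c α‖ ≤ b α * weight F.rate (A - degree α)) {K : ℕ} (hK : A ≤ K)
    (v : Fin n → TVec X) :
    ∑ α ∈ box S n K, c α * F.mon α v = ∑ α ∈ box S n A, c α * F.mon α v := by
  refine (Finset.sum_subset (box_mono hK) fun α _ hα => ?_).symm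
  have : (A : ℤ) < degree α := by
    by_contra h
    exact hα (mem_box_of_degree_le (not_lt.1 h))
  rw [coeff_eq_zero hc this, zero_mul]

theorem HasResExp.zero (a : X) (n A : ℕ) :
    F.HasResExp a (fun (_ : Fin n → TVec X) _ => 0) A fun _ => 0 :=
  ⟨fun _ => 0, by simp, fun v _ => by simpa using hasResidue_zero _⟩

theorem HasResExp.add {a : X} {n : ℕ} {f g : (Fin n → TVec X) → TVec X → ℂ} {A : ℕ}
    {b b' : (Fin n → Index S) → ℝ} (hf : F.HasResExp a f A b) (hg : F.HasResExp a g A b') :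
    F.HasResExp a (fun v u => f v u + g v u) A fun α => b α + b' α := by
  obtain ⟨c, c1, c2⟩ := hf
  obtain ⟨d, d1, d2⟩ := hg
  refine ⟨fun α => c α + d α, fun α => ?_, fun v hv => ?_⟩
  · rw [add_mul]
    exact (norm_add_le _ _).trans (add_le_add (c1 α) (d1 α))
  · simp only [add_mul, Finset.sum_add_distrib]
    exact (c2 v hv).add (d2 v hv)

theorem HasResExp.sum {a : X} {n : ℕ} {κ : Type*} (s : Finset κ)
    {f : κ → (Fin n → TVec X) → TVec X → ℂ} {A : ℕ} {b : κ → (Fin n → Index S) → ℝ}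
    (hf : ∀ i ∈ s, F.HasResExp a (f i) A (b i)) :
    F.HasResExp a (fun v u => ∑ i ∈ s, f i v u) A fun α => ∑ i ∈ s, b i α := by
  classical
  induction s using Finset.induction_on with
  | empty => simpa using HasResExp.zero a n A
  | insert i s hi ih =>
    simp only [Finset.sum_insert hi]
    exact (hf i (by simp)).add (ih fun j hj => hf j (by simp [hj]))

/-- Indices of degree above `A` have weight zero, so only the others need comparison. This lets
orders of basis forms be replaced by bounds in terms of `A`. -/
theorem HasResExp.mono {a : X} {n : ℕ} {f : (Fin n → TVec X) → TVec X → ℂ} {A : ℕ}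
    {b b' : (Fin n → Index S) → ℝ} (hf : F.HasResExp a f A b)
    (h : ∀ α, degree α ≤ A → b α ≤ b' α) : F.HasResExp a f A b' := by
  obtain ⟨c, c1, c2⟩ := hf
  refine ⟨c, fun α => (c1 α).trans ?_, c2⟩
  have := weight_nonneg F.rate_pos (A - degree α)
  rcases le_or_gt (degree α) A with h1 | h1
  · exact mul_le_mul_of_nonneg_right (h α h1) this
  · rw [weight_of_neg (by omega)]; simp

theorem HasExp.of_residueAt {n : ℕ} {f : X → (Fin n → TVec X) → TVec X → ℂ} {A : ℕ}
    {b : X → (Fin n → Index S) → ℝ} (hf : ∀ a ∈ S.ram, F.HasResExp a (f a) A (b a)) :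
    F.HasExp (fun v => ∑ a ∈ S.ram, residueAt a (f a v)) A fun α => ∑ a ∈ S.ram, b a α := by
  have hf' : ∀ a, ∃ c : (Fin n → Index S) → ℂ, a ∈ S.ram →
      (∀ α, ‖c α‖ ≤ b a α * weight F.rate (A - degree α)) ∧
      ∀ v, OffRam S v → HasResidue (fun w => f a v (coordVec (chartAt ℂ a) w)) (chartAt ℂ a a)
        (∑ α ∈ box S n A, c α * F.mon α v) := fun a => by
    by_cases ha : a ∈ S.ram
    · obtain ⟨c, hc⟩ := hf a ha
      exact ⟨c, fun _ => hc⟩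
    · exact ⟨0, fun h => (ha h).elim⟩
  choose c hc using hf'
  have hb : ∀ α, ‖∑ a ∈ S.ram, c a α‖ ≤
      (∑ a ∈ S.ram, b a α) * weight F.rate (A - degree α) := fun α => by
    rw [Finset.sum_mul]
    exact norm_sum_le_of_le _ fun a ha => (hc a ha).1 α
  refine ⟨fun α => ∑ a ∈ S.ram, c a α, hb, fun v hv K hK => ?_⟩
  rw [sum_box_eq hb hK]
  simp only [Finset.sum_mul]
  rw [Finset.sum_comm]
  exact Finset.sum_congr rfl fun a ha => ((hc a ha).2 v hv).residue_eq

/-- Expansion of the residue of the recursion kernel against an expanded quadratic differential. -/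
theorem hasResExp_quadratic (hS : S.IsRegular) {a : X} (ha : a ∈ S.ram) {m A : ℕ}
    {Q : (Fin m → TVec X) → TVec X → ℂ} {b : (Fin m → Index S) → ℝ}
    {Y : Index S ⊕ ℕ → Index S ⊕ ℕ → (Fin m → Index S) → ℂ}
    (hY : ∀ κ κ' α, (A : ℤ) < slotDegree κ + slotDegree κ' → Y κ κ' α = 0)
    (hb : ∀ (k : ℕ) α, ∑ κ ∈ slotBox S A, ∑ κ' ∈ slotBox S A,
      ‖Y κ κ' α‖ * weight F.rate (slotDegree κ + slotDegree κ' - k) ≤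
        b α * weight F.rate (A - k - degree α))
    (hQ : ∀ v, OffRam S v → ∃ r : ℂ → ℂ, PoleAt (-1) r ∧ ∀ᶠ z in 𝓝[≠] 0, ∀ c,
      Q v (smulVec c (coordVec (F.Z a) z)) = c ^ 2 * -(∑ κ ∈ slotBox S A, ∑ κ' ∈ slotBox S A,
        (∑ α ∈ box S m A, Y κ κ' α * F.mon α v) * (F.slotFun a κ z * F.slotFun a κ' (-z)) +
          r z)) :
    F.HasResExp a (fun v u => S.kernel a (v 0) u * Q (Fin.tail v) u) A
      fun α : Fin (m + 1) → Index S => F.tensorConst * b (Fin.tail α) := by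
  classical
  have hsp := F.special a ha
  have hT := F.tensorConst_pos
  -- The new first argument carries only forms at `a` itself and of even order, as in the expansion
  -- of the kernel.
  set c : Index S → (Fin m → Index S) → ℂ := fun i α =>
    if (i.1 : X) = a ∧ Even i.2 then ∑ κ ∈ slotBox S A, ∑ κ' ∈ slotBox S A,
      Y κ κ' α * F.tensor a i.2 κ κ' else 0 with hcdef
  have hc : ∀ i α, ‖c i α‖ ≤ F.tensorConst * b α * weight F.rate (A - i.2 - degree α) := by
    intro i α
    have h1 := hb i.2 α
    have h2 : ∑ κ ∈ slotBox S A, ∑ κ' ∈ slotBox S A, ‖Y κ κ' α * F.tensor a i.2 κ κ'‖ ≤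
        F.tensorConst * (b α * weight F.rate (A - i.2 - degree α)) := by
      refine le_trans ?_ (mul_le_mul_of_nonneg_left h1 hT.le)
      rw [Finset.mul_sum]
      refine Finset.sum_le_sum fun κ _ => ?_
      rw [Finset.mul_sum]
      refine Finset.sum_le_sum fun κ' _ => ?_
      rw [norm_mul, mul_left_comm]
      exact mul_le_mul_of_nonneg_left (F.tensor_le ha _ _ _) (norm_nonneg _)
    rw [mul_assoc]
    rw [hcdef]
    simp only
    split_ifs
    · exact (norm_sum_le_of_le _ fun κ _ => norm_sum_le _ _).trans h2
    · rw [norm_zero]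
      exact (Finset.sum_nonneg fun κ _ => Finset.sum_nonneg fun κ' _ => norm_nonneg _).trans h2
  refine ⟨fun α => c (α 0) (Fin.tail α), fun α => ?_, fun v hv => ?_⟩
  · refine (hc _ _).trans (le_of_eq ?_)
    congr 2
    conv_rhs => rw [← Fin.cons_self_tail α, degree_cons]
    ring
  · have hv0 : (v 0).proj ≠ a := fun h => hv 0 (h ▸ ha)
    obtain ⟨r, r1, r2⟩ := hQ (Fin.tail v) fun i => hv i.succ
    set x : Index S ⊕ ℕ → Index S ⊕ ℕ → ℂ := fun κ κ' =>
      ∑ α ∈ box S m A, Y κ κ' α * F.mon α (Fin.tail v) with hx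
    set q : Index S ⊕ ℕ → Index S ⊕ ℕ → ℂ → ℂ := fun κ κ' z =>
      F.slotFun a κ z * F.slotFun a κ' (-z) with hq
    have hx0 : ∀ κ κ', (A : ℤ) < slotDegree κ + slotDegree κ' → x κ κ' = 0 := fun κ κ' h =>
      Finset.sum_eq_zero fun α _ => by rw [hY κ κ' α h, zero_mul]
    have hqp : ∀ κ κ', PoleAt (slotDegree κ + slotDegree κ') (q κ κ') := fun κ κ' =>
      (F.slot_poleAt ha κ).mul (F.slot_poleAt ha κ').comp_neg
    have hxq : ∀ κ κ', PoleAt A fun z => x κ κ' * q κ κ' z := fun κ κ' => by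
      rcases le_or_gt (slotDegree κ + slotDegree κ') A with h | h
      · exact ((hqp κ κ').const_mul _).mono h
      · rw [hx0 κ κ' h]
        simpa using poleAt_zero A
    have hsum : PoleAt A fun z => ∑ κ ∈ slotBox S A, ∑ κ' ∈ slotBox S A, x κ κ' * q κ κ' z :=
      PoleAt.sum fun κ _ => PoleAt.sum fun κ' _ => hxq κ κ'
    have htot : PoleAt A fun z => -(∑ κ ∈ slotBox S A, ∑ κ' ∈ slotBox S A, x κ κ' * q κ κ' z +
        r z) := by
      simpa using (hsum.add (r1.mono (by omega))).const_mul (-1)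
    have hres := hsp.hasResidue_kernel_mul hS ha hv0 (N := A) htot r2
    have hpow : ∀ k : ℕ, PoleAt (-((k + 1 : ℕ) : ℤ)) fun z : ℂ => z ^ (k + 1) := fun k => by
      have := poleAt_zpow ((k + 1 : ℕ) : ℤ)
      simpa only [zpow_natCast] using this
    have hker := hsp.poleAt_kernelFactor hS ha
    have hcoef : ∀ k : ℕ, residue (fun z => z ^ (k + 1) * (kernelFactor S (F.Z a) z *
        -(∑ κ ∈ slotBox S A, ∑ κ' ∈ slotBox S A, x κ κ' * q κ κ' z + r z))) 0 =
        ∑ κ ∈ slotBox S A, ∑ κ' ∈ slotBox S A, x κ κ' * F.tensor a k κ κ' := by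
      intro k
      have e1 : ∀ κ κ', PoleAt (-((k + 1 : ℕ) : ℤ) + (2 + (slotDegree κ + slotDegree κ')))
          fun z => z ^ (k + 1) * (kernelFactor S (F.Z a) z * q κ κ' z) := fun κ κ' =>
        (hpow k).mul (hker.mul (hqp κ κ'))
      -- The remainder `r` vanishes at `0`. Together with `z^(k+1)` this outweighs the double pole
      -- of the kernel factor, so there is no residue.
      have e2 : PoleAt (-((k + 1 : ℕ) : ℤ) + (2 + -1))
          fun z => z ^ (k + 1) * (kernelFactor S (F.Z a) z * r z) := (hpow k).mul (hker.mul r1)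
      have e3 : HasResidue (fun z => ∑ κ ∈ slotBox S A, ∑ κ' ∈ slotBox S A, -x κ κ' *
          (z ^ (k + 1) * (kernelFactor S (F.Z a) z * q κ κ' z)) +
          -1 * (z ^ (k + 1) * (kernelFactor S (F.Z a) z * r z))) 0
          (∑ κ ∈ slotBox S A, ∑ κ' ∈ slotBox S A, -x κ κ' *
            residue (fun z => z ^ (k + 1) * (kernelFactor S (F.Z a) z * q κ κ' z)) 0 +
            -1 * residue (fun z => z ^ (k + 1) * (kernelFactor S (F.Z a) z * r z)) 0) :=
        (HasResidue.sum fun κ _ => HasResidue.sum fun κ' _ =>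
          (e1 κ κ').hasResidue.const_mul _).add (e2.hasResidue.const_mul _)
      rw [e2.residue_eq_zero (by push_cast; omega), mul_zero, add_zero] at e3
      have e4 := e3.congr (g := fun z => z ^ (k + 1) * (kernelFactor S (F.Z a) z *
        -(∑ κ ∈ slotBox S A, ∑ κ' ∈ slotBox S A, x κ κ' * q κ κ' z + r z)))
        (Eventually.of_forall fun z => by
          simp only [mul_neg, mul_add, Finset.mul_sum, neg_add, ← Finset.sum_neg_distrib]
          congr 1
          · refine Finset.sum_congr rfl fun κ _ => Finset.sum_congr rfl fun κ' _ => ?_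
            ring
          · ring)
      rw [e4.residue_eq]
      refine Finset.sum_congr rfl fun κ _ => Finset.sum_congr rfl fun κ' _ => ?_
      rw [tensor]
      ring
    simp only [hcoef] at hres
    have hfin : ∑ k ∈ Finset.range (A + 1), (if Even k then basisForm S (F.Z a) k (v 0) else 0) *
        (∑ κ ∈ slotBox S A, ∑ κ' ∈ slotBox S A, x κ κ' * F.tensor a k κ κ') =
        ∑ α ∈ box S (m + 1) A, c (α 0) (Fin.tail α) * F.mon α v := by
      rw [sum_box_succ, Finset.sum_product, Finset.sum_eq_single (⟨a, ha⟩ : {a // a ∈ S.ram})]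
      · refine Finset.sum_congr rfl fun k _ => ?_
        simp only [Fin.cons_zero, Fin.tail_cons, mon_cons, hcdef, true_and]
        split_ifs with he
        · simp only [hx, Finset.sum_mul, Finset.mul_sum]
          symm
          rw [Finset.sum_comm]
          refine Finset.sum_congr rfl fun κ _ => ?_
          rw [Finset.sum_comm]
          refine Finset.sum_congr rfl fun κ' _ => Finset.sum_congr rfl fun α _ => ?_
          unfold form
          ring
        · simp
      · intro i _ hi
        refine Finset.sum_eq_zero fun k _ => Finset.sum_eq_zero fun α _ => ?_
        have : ¬ ((i : X) = a) := fun h => hi (Subtype.ext h)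
        simp [hcdef, this]
      · simp
    rw [← hfin]
    exact hres

end Frame

end Expansions

/-! ### Splitting tuples along a set of indices -/

section Restriction

/-- The restriction of a tuple to a set of indices. -/
def restrict {κ : Type*} {m : ℕ} (α : Fin m → κ) (J : Finset (Fin m)) : Fin J.card → κ :=
  fun i => α (J.orderEmbOfFin rfl i)

theorem prod_restrict {M : Type*} [CommMonoid M] {m : ℕ} (h : Fin m → M) (J : Finset (Fin m)) :
    ∏ i, restrict h J i = ∏ i ∈ J, h i := by
  conv_rhs => rw [← Finset.map_orderEmbOfFin_univ J rfl, Finset.prod_map]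
  rfl

theorem sum_restrict {M : Type*} [AddCommMonoid M] {m : ℕ} (h : Fin m → M) (J : Finset (Fin m)) :
    ∑ i, restrict h J i = ∑ i ∈ J, h i := by
  conv_rhs => rw [← Finset.map_orderEmbOfFin_univ J rfl, Finset.sum_map]
  rfl

/-- The tuple with given restrictions to a set of indices and to its complement. -/
def glue {κ : Type*} {m : ℕ} (J : Finset (Fin m)) (β : Fin J.card → κ) (γ : Fin Jᶜ.card → κ) :
    Fin m → κ := fun i =>
  if h : i ∈ J then β ((J.orderIsoOfFin rfl).symm ⟨i, h⟩)
  else γ ((Jᶜ.orderIsoOfFin rfl).symm ⟨i, Finset.mem_compl.2 h⟩)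

theorem restrict_glue {κ : Type*} {m : ℕ} (J : Finset (Fin m)) (β : Fin J.card → κ)
    (γ : Fin Jᶜ.card → κ) : restrict (glue J β γ) J = β := by
  funext i
  have h : J.orderEmbOfFin rfl i ∈ J := Finset.orderEmbOfFin_mem _ _ _
  simp only [restrict, glue, dif_pos h]
  congr 1
  rw [OrderIso.symm_apply_eq]
  rfl

theorem restrict_compl_glue {κ : Type*} {m : ℕ} (J : Finset (Fin m)) (β : Fin J.card → κ)
    (γ : Fin Jᶜ.card → κ) : restrict (glue J β γ) Jᶜ = γ := by
  funext i
  have h : Jᶜ.orderEmbOfFin rfl i ∈ Jᶜ := Finset.orderEmbOfFin_mem _ _ _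
  simp only [restrict, glue, dif_neg (Finset.mem_compl.1 h)]
  congr 1
  rw [OrderIso.symm_apply_eq]
  rfl

theorem glue_restrict {κ : Type*} {m : ℕ} (J : Finset (Fin m)) (α : Fin m → κ) :
    glue J (restrict α J) (restrict α Jᶜ) = α := by
  funext i
  unfold glue restrict
  split_ifs with h
  · congr 1
    have := congrArg Subtype.val ((J.orderIsoOfFin rfl).apply_symm_apply ⟨i, h⟩)
    exact this
  · congr 1
    have := congrArg Subtype.val
      ((Jᶜ.orderIsoOfFin rfl).apply_symm_apply ⟨i, Finset.mem_compl.2 h⟩)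
    exact this

variable {X : Type*} [TopologicalSpace X] [ChartedSpace ℂ X] [IsManifold 𝓘(ℂ) ω X]
  {S : SpectralCurve X}

theorem degree_restrict {m : ℕ} (α : Fin m → Index S) (J : Finset (Fin m)) :
    degree (restrict α J) + degree (restrict α Jᶜ) = degree α := by
  have h1 := sum_restrict (fun i => ((α i).2 : ℤ)) J
  have h2 := sum_restrict (fun i => ((α i).2 : ℤ)) Jᶜ
  have h3 := Finset.sum_add_sum_compl J fun i => ((α i).2 : ℤ)
  unfold degree
  rw [← h3, ← h1, ← h2]
  rfl

theorem Frame.mon_restrict (F : Frame S) {m : ℕ} (α : Fin m → Index S) (v : Fin m → TVec X)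
    (J : Finset (Fin m)) :
    F.mon (restrict α J) (SpectralCurve.subTuple v J) *
      F.mon (restrict α Jᶜ) (SpectralCurve.subTuple v Jᶜ) = F.mon α v := by
  have h1 := prod_restrict (fun i => F.form (α i) (v i)) J
  have h2 := prod_restrict (fun i => F.form (α i) (v i)) Jᶜ
  have h3 := Finset.prod_mul_prod_compl J fun i => F.form (α i) (v i)
  unfold Frame.mon
  rw [← h3, ← h1, ← h2]
  rfl

/-- Restriction to `J` and to its complement is a bijection of boxes with inverse `glue`. A product
of two expansions thus becomes one expansion over all indices. -/
theorem sum_box_restrict {m K : ℕ} (J : Finset (Fin m)) (g : (Fin J.card → Index S) → ℂ)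
    (g' : (Fin Jᶜ.card → Index S) → ℂ) :
    ∑ α ∈ box S m K, g (restrict α J) * g' (restrict α Jᶜ) =
      (∑ β ∈ box S J.card K, g β) * ∑ γ ∈ box S Jᶜ.card K, g' γ := by
  rw [Finset.sum_mul_sum, ← Finset.sum_product']
  refine Finset.sum_nbij' (fun α => (restrict α J, restrict α Jᶜ)) (fun p => glue J p.1 p.2)
    ?_ ?_ ?_ ?_ ?_
  · intro α hα
    rw [mem_box] at hα
    exact Finset.mem_product.2 ⟨mem_box.2 fun i => hα _, mem_box.2 fun i => hα _⟩
  · intro p hp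
    obtain ⟨h1, h2⟩ := Finset.mem_product.1 hp
    rw [mem_box] at h1 h2 ⊢
    intro i
    unfold glue
    split_ifs
    · exact h1 _
    · exact h2 _
  · intro α _; exact glue_restrict J α
  · intro p _; simp only [restrict_glue, restrict_compl_glue]
  · intro α _; rfl

theorem OffRam.subTuple {m : ℕ} {v : Fin m → TVec X} (hv : OffRam S v) (J : Finset (Fin m)) :
    OffRam S (SpectralCurve.subTuple v J) := fun _ => hv _

theorem OffRam.cons {m : ℕ} {u : TVec X} {v : Fin m → TVec X} (hu : u.proj ∉ S.ram)
    (hv : OffRam S v) : OffRam S (Fin.cons u v : Fin (m + 1) → TVec X) := fun i =>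
  Fin.cases hu (fun i => by simpa using hv i) i

end Restriction

/-! ### Correlators with one argument near a ramification point -/

section Slots

variable {X : Type*} [TopologicalSpace X] [ChartedSpace ℂ X] [IsManifold 𝓘(ℂ) ω X]
  {S : SpectralCurve X} {F : Frame S} {a : X}

namespace Frame

theorem eventually_off (F : Frame S) (ha : a ∈ S.ram) :
    ∀ᶠ z in 𝓝[≠] 0, (coordVec (F.Z a) z).proj ∉ S.ram := by
  filter_upwards [mem_nhdsWithin_of_mem_nhds (closedBall_mem_nhds (0 : ℂ) F.R_pos),
    self_mem_nhdsWithin] with z h1 h2 using F.off a ha z h1 h2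

theorem form_smulVec (F : Frame S) (i : Index S) (c : ℂ) (v : TVec X) :
    F.form i (smulVec c v) = c * F.form i v := basisForm_smulVec _ _ _ _ _

theorem mon_cons_cons (F : Frame S) {n : ℕ} (i : Index S) (α : Fin n → Index S) (u : TVec X)
    (v : Fin n → TVec X) :
    F.mon (Fin.cons i α : Fin (n + 1) → Index S) (Fin.cons u v : Fin (n + 1) → TVec X) =
      F.form i u * F.mon α v := by
  rw [mon_cons, Fin.cons_zero, Fin.tail_cons]

/-- The first basis form is simply reread as a slot function. A form of order `k` has slot degree `k
+ 2`, hence the shift of `A` by two; monomials do not occur. -/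
theorem HasExp.hasSlotExp (ha : a ∈ S.ram) {n A : ℕ} {N : ℝ} (hN : 0 ≤ N)
    {f : (Fin (n + 1) → TVec X) → ℂ} (hf : F.HasExp f A fun _ => N) :
    F.HasSlotExp a (fun u v => f (Fin.cons u v)) (A + 2) fun _ => N := by
  obtain ⟨c, c1, c2⟩ := hf
  refine ⟨fun v hv u hu d => ?_, fun κ α => κ.elim (fun i => c (Fin.cons i α)) fun _ => 0,
    fun κ α => ?_, fun v hv K hK => ⟨0, analyticAt_const, ?_⟩⟩
  · beta_reduce
    rw [c2 _ (OffRam.cons hu hv) A le_rfl, c2 _ (OffRam.cons (by simpa using hu) hv) A le_rfl,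
      sum_box_succ, sum_box_succ]
    simp only [Finset.mul_sum]
    refine Finset.sum_congr rfl fun i _ => Finset.sum_congr rfl fun α _ => ?_
    rw [mon_cons_cons, mon_cons_cons, form_smulVec]
    ring
  · rcases κ with i | j
    · refine (c1 _).trans (le_of_eq ?_)
      rw [degree_cons]
      simp only [slotDegree]
      congr 2
      push_cast
      ring
    · simpa using mul_nonneg hN (weight_nonneg F.rate_pos _)
  · filter_upwards [F.eventually_off ha] with z hz
    rw [c2 _ (OffRam.cons hz hv) K (by omega), sum_box_succ, sum_slotBox]
    simp only [Sum.elim_inl, Sum.elim_inr, zero_mul, Finset.sum_const_zero, add_zero,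
      Pi.zero_apply, mul_zero]
    refine Finset.sum_congr rfl fun i _ => Finset.sum_congr rfl fun α _ => ?_
    rw [mon_cons_cons, mul_assoc]
    rfl

/-- With `v` off the ramification points, `ω_{0,2}(z, v)` is holomorphic in `z` near `a`. Its Taylor
coefficient at `z^j` is `(j + 1) ξ_{a,j}(v)`, since `ξ_{a,j}` is normalized by `(j+1)!` rather than
`j!`. Slot degree `-j` and order `j` cancel, whence the value `0` of `A`. -/
theorem hasSlotExp_fundamental (ha : a ∈ S.ram) {n : ℕ} (hn : n = 1)
    {f : TVec X → (Fin n → TVec X) → ℂ}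
    (hf : ∀ u v, f u v = S.ω₀₂.eval u (v ⟨0, by omega⟩)) :
    F.HasSlotExp a f 0 fun α => ∑ i, (((α i).2 : ℝ) + 1) := by
  classical
  subst hn
  have hsp := F.special a ha
  refine ⟨fun v hv u hu d => by rw [hf, hf, BiForm.eval_smulVec_left],
    fun κ α => κ.elim (fun _ => 0) fun j => if α 0 = (⟨a, ha⟩, j) then (j : ℂ) + 1 else 0,
    fun κ α => ?_, fun v hv K _ => ?_⟩
  · have h0 : 0 ≤ (∑ i, (((α i).2 : ℝ) + 1)) *
        weight F.rate ((0 : ℕ) - slotDegree κ - degree α) :=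
      mul_nonneg (by positivity) (weight_nonneg F.rate_pos _)
    rcases κ with i | j
    · simpa using h0
    · simp only [Sum.elim_inr]
      split_ifs with h
      · simp [degree, slotDegree, h]
        exact_mod_cast (Complex.norm_natCast (j + 1)).le
      · simpa using h0
  · have hv0 : (v 0).proj ≠ (F.Z a).symm 0 := by
      rw [hsp.symm_zero]
      exact fun h => hv 0 (h ▸ ha)
    obtain ⟨r, r1, r2⟩ := taylor_eq (S.fundamental.analyticAt (v 0) hsp.mem hsp.zero_mem hv0)
      (K + 1)
    refine ⟨r, r1, Eventually.of_forall fun z => ?_⟩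
    rw [hf, S.fundamental.eval_symm]
    change S.ω₀₂.eval (v 0) (coordVec (F.Z a) z) = _
    rw [r2 z, sum_slotBox]
    simp only [Sum.elim_inl, Sum.elim_inr, zero_mul, Finset.sum_const_zero, zero_add]
    congr 1
    refine Finset.sum_congr rfl fun j hj => ?_
    rw [Finset.sum_eq_single (fun _ => (⟨a, ha⟩, j))]
    · simp only [if_true, mon, slotFun, Finset.univ_unique, Finset.prod_singleton, form,
        basisForm, Nat.factorial_succ]
      have h1 : ((j : ℂ) + 1) ≠ 0 := by exact_mod_cast j.succ_ne_zero
      have h2 : (j.factorial : ℂ) ≠ 0 := by exact_mod_cast j.factorial_ne_zero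
      push_cast
      simp only [Fin.default_eq_zero, Fin.isValue]
      field_simp
    · intro α _ hα
      rw [if_neg, zero_mul, zero_mul]
      intro h
      exact hα (funext fun i => by rw [Subsingleton.elim i 0, h])
    · intro h
      exact (h (mem_box.2 fun _ => by simpa [Nat.lt_succ_iff] using hj)).elim

end Frame

end Slots

/-! ### The three kinds of terms in the recursion -/

section Terms

variable {X : Type*} [TopologicalSpace X] [ChartedSpace ℂ X] [IsManifold 𝓘(ℂ) ω X]
  {S : SpectralCurve X} {F : Frame S} {a : X}

namespace Frame

/-- The polynomial part of a slot expansion has a pole of bounded order. -/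
theorem poleAt_slotSum (ha : a ∈ S.ram) {n A K : ℕ} {Φ : Index S ⊕ ℕ → (Fin n → Index S) → ℂ}
    (hΦ : ∀ κ α, (A : ℤ) < slotDegree κ → Φ κ α = 0) (v : Fin n → TVec X) :
    PoleAt A fun z => ∑ κ ∈ slotBox S K, ∑ α ∈ box S n K, Φ κ α * F.slotFun a κ z * F.mon α v := by
  refine PoleAt.sum fun κ _ => PoleAt.sum fun α _ => ?_
  rcases le_or_gt (slotDegree κ) A with h | h
  · refine (((F.slot_poleAt ha κ).const_mul (Φ κ α * F.mon α v)).mono h).congr ?_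
    exact Eventually.of_forall fun z => by ring
  · simpa [hΦ κ α h] using poleAt_zero A

theorem poleAt_remainder {K : ℕ} {r : ℂ → ℂ} (hr : AnalyticAt ℂ r 0) :
    PoleAt (-((K + 1 : ℕ) : ℤ)) fun z => z ^ (K + 1) * r z := by
  have := (poleAt_zpow ((K + 1 : ℕ) : ℤ)).mul (AnalyticAt.poleAt hr)
  simpa only [zpow_natCast, add_zero] using this

/-- The contribution to the recursion of a product of two correlators. -/
theorem HasSlotExp.hasResExp_mul (hS : S.IsRegular) (ha : a ∈ S.ram) {m : ℕ} {J : Finset (Fin m)}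
    {f₁ : TVec X → (Fin J.card → TVec X) → ℂ} {f₂ : TVec X → (Fin Jᶜ.card → TVec X) → ℂ}
    {A₁ A₂ : ℕ} {b₁ : (Fin J.card → Index S) → ℝ} {b₂ : (Fin Jᶜ.card → Index S) → ℝ}
    (h₁ : F.HasSlotExp a f₁ A₁ b₁) (h₂ : F.HasSlotExp a f₂ A₂ b₂)
    (hb₁ : ∀ α, 0 ≤ b₁ α) (hb₂ : ∀ α, 0 ≤ b₂ α) :
    F.HasResExp a (fun v u => S.kernel a (v 0) u *
      (f₁ u (SpectralCurve.subTuple (Fin.tail v) J) *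
        f₂ (tangentMap 𝓘(ℂ) 𝓘(ℂ) (S.galois a) u) (SpectralCurve.subTuple (Fin.tail v) Jᶜ)))
      (A₁ + A₂) fun α : Fin (m + 1) → Index S => F.tensorConst *
        (((S.ram.card + 1) * convConst) ^ 2 *
          (b₁ (restrict (Fin.tail α) J) * b₂ (restrict (Fin.tail α) Jᶜ))) := by
  obtain ⟨hom₁, Φ₁, c₁, e₁⟩ := h₁
  obtain ⟨hom₂, Φ₂, c₂, e₂⟩ := h₂
  have hsp := F.special a ha
  have hρ := F.rate_pos
  have hC := convConst_pos
  have hz₁ : ∀ κ α, (A₁ : ℤ) < slotDegree κ → Φ₁ κ α = 0 := fun κ α h => by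
    have := c₁ κ α
    rw [weight_of_neg (by have := degree_nonneg α; omega), mul_zero] at this
    exact norm_le_zero_iff.1 this
  have hz₂ : ∀ κ α, (A₂ : ℤ) < slotDegree κ → Φ₂ κ α = 0 := fun κ α h => by
    have := c₂ κ α
    rw [weight_of_neg (by have := degree_nonneg α; omega), mul_zero] at this
    exact norm_le_zero_iff.1 this
  refine hasResExp_quadratic hS ha (m := m) (A := A₁ + A₂)
    (Q := fun v u => f₁ u (SpectralCurve.subTuple v J) *
        f₂ (tangentMap 𝓘(ℂ) 𝓘(ℂ) (S.galois a) u) (SpectralCurve.subTuple v Jᶜ))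
    (b := fun α => ((S.ram.card + 1) * convConst) ^ 2 *
      (b₁ (restrict α J) * b₂ (restrict α Jᶜ)))
    (Y := fun κ κ' α => Φ₁ κ (restrict α J) * Φ₂ κ' (restrict α Jᶜ)) ?_ ?_ ?_
  · intro κ κ' α h
    rcases lt_or_ge (A₁ : ℤ) (slotDegree κ) with h1 | h1
    · rw [hz₁ κ _ h1, zero_mul]
    · rw [hz₂ κ' _ (by push_cast at h; omega), mul_zero]
  · intro k α
    set D₁ := degree (restrict α J)
    set D₂ := degree (restrict α Jᶜ)
    have hD : D₁ + D₂ = degree α := degree_restrict α J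
    set β₁ := b₁ (restrict α J)
    set β₂ := b₂ (restrict α Jᶜ)
    have n₁ : 0 ≤ β₁ := hb₁ _
    have n₂ : 0 ≤ β₂ := hb₂ _
    -- The weight of the structure constant links both factors. Convolving first in `κ'` leaves a
    -- convolution in `κ`; each contributes `(card + 1) * convConst`.
    have step : ∀ κ ∈ slotBox S (A₁ + A₂), ∑ κ' ∈ slotBox S (A₁ + A₂),
        ‖Φ₁ κ (restrict α J) * Φ₂ κ' (restrict α Jᶜ)‖ *
          weight F.rate (slotDegree κ + slotDegree κ' - k) ≤
        (β₁ * β₂ * ((S.ram.card + 1) * convConst)) * (weight F.rate (A₁ - D₁ - slotDegree κ) *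
          weight F.rate (slotDegree κ - (k - A₂ + D₂))) := by
      intro κ _
      calc _ ≤ ∑ κ' ∈ slotBox S (A₁ + A₂), (β₁ * weight F.rate (A₁ - D₁ - slotDegree κ) * β₂) *
            (weight F.rate (A₂ - D₂ - slotDegree κ') *
              weight F.rate (slotDegree κ' - (k - slotDegree κ))) := by
            refine Finset.sum_le_sum fun κ' _ => ?_
            have h1 := c₁ κ (restrict α J)
            have h2 := c₂ κ' (restrict α Jᶜ)
            rw [show (A₁ : ℤ) - slotDegree κ - degree (restrict α J) =
              A₁ - D₁ - slotDegree κ by ring] at h1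
            rw [show (A₂ : ℤ) - slotDegree κ' - degree (restrict α Jᶜ) =
              A₂ - D₂ - slotDegree κ' by ring] at h2
            rw [norm_mul, show slotDegree κ + slotDegree κ' - (k : ℤ) =
              slotDegree κ' - (k - slotDegree κ) by ring, ← mul_assoc]
            refine mul_le_mul_of_nonneg_right ?_ (weight_nonneg hρ _)
            refine (mul_le_mul h1 h2 (norm_nonneg _)
              (mul_nonneg n₁ (weight_nonneg hρ _))).trans (le_of_eq ?_)
            ring
        _ ≤ (β₁ * weight F.rate (A₁ - D₁ - slotDegree κ) * β₂) *
            ((S.ram.card + 1) * convConst *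
              weight F.rate (A₂ - D₂ - (k - slotDegree κ))) := by
            rw [← Finset.mul_sum]
            have := weight_nonneg hρ (A₁ - D₁ - slotDegree κ)
            exact mul_le_mul_of_nonneg_left (sum_slotBox_weight_le hρ _ _ _) (by positivity)
        _ = _ := by
            rw [show (A₂ : ℤ) - D₂ - (k - slotDegree κ) = slotDegree κ - (k - A₂ + D₂) by ring]
            ring
    refine (Finset.sum_le_sum step).trans ?_
    rw [← Finset.mul_sum]
    refine (mul_le_mul_of_nonneg_left (sum_slotBox_weight_le hρ _ _ _)
      (by positivity)).trans (le_of_eq ?_)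
    rw [← hD]
    push_cast
    rw [show (A₁ : ℤ) - D₁ - (k - A₂ + D₂) = A₁ + A₂ - k - (D₁ + D₂) by ring]
    ring
  · intro v hv
    set K := A₁ + A₂
    set v₁ := SpectralCurve.subTuple v J
    set v₂ := SpectralCurve.subTuple v Jᶜ
    have hv₁ : OffRam S v₁ := hv.subTuple J
    have hv₂ : OffRam S v₂ := hv.subTuple Jᶜ
    obtain ⟨r₁, a₁, t₁⟩ := e₁ v₁ hv₁ K (by omega)
    obtain ⟨r₂, a₂, t₂⟩ := e₂ v₂ hv₂ K (by omega)
    set P₁ : ℂ → ℂ := fun z => ∑ κ ∈ slotBox S K, ∑ α ∈ box S J.card K,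
      Φ₁ κ α * F.slotFun a κ z * F.mon α v₁
    set P₂ : ℂ → ℂ := fun z => ∑ κ ∈ slotBox S K, ∑ α ∈ box S Jᶜ.card K,
      Φ₂ κ α * F.slotFun a κ z * F.mon α v₂
    have p₁ : PoleAt A₁ P₁ := poleAt_slotSum ha hz₁ v₁
    have p₂ : PoleAt A₂ P₂ := poleAt_slotSum ha hz₂ v₂
    have q₁ := poleAt_remainder (K := K) a₁
    have q₂ := (poleAt_remainder (K := K) a₂).comp_neg
    -- Everything except `P₁(z) P₂(-z)`. The main parts have poles of order at most `A₁` and `A₂`,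
    -- while the remainders vanish to order `A₁ + A₂ + 1`, so every cross term vanishes at `0`.
    refine ⟨fun z => P₁ z * ((-z) ^ (K + 1) * r₂ (-z)) + ((z ^ (K + 1) * r₁ z) * P₂ (-z) +
      (z ^ (K + 1) * r₁ z) * ((-z) ^ (K + 1) * r₂ (-z))), ?_, ?_⟩
    · exact ((p₁.mul q₂).mono (by omega)).add (((q₁.mul p₂.comp_neg).mono (by omega)).add
        ((q₁.mul q₂).mono (by omega)))
    · filter_upwards [t₁, tendsto_neg_nhdsNE.eventually t₂, F.eventually_off ha,
        tendsto_neg_nhdsNE.eventually (F.eventually_off ha),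
        hsp.tangentMap_galois.filter_mono nhdsWithin_le_nhds] with z t1 t2 o1 o2 g1 c
      rw [tangentMap_smulVec, g1, hom₁ v₁ hv₁ _ o1, hom₂ v₂ hv₂ _ (by simpa using o2),
        hom₂ v₂ hv₂ _ o2, t1, t2]
      have key : ∑ κ ∈ slotBox S K, ∑ κ' ∈ slotBox S K, (∑ α ∈ box S m K,
          Φ₁ κ (restrict α J) * Φ₂ κ' (restrict α Jᶜ) * F.mon α v) *
          (F.slotFun a κ z * F.slotFun a κ' (-z)) = P₁ z * P₂ (-z) := by
        rw [Finset.sum_mul_sum]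
        refine Finset.sum_congr rfl fun κ _ => Finset.sum_congr rfl fun κ' _ => ?_
        have h1 := sum_box_restrict (K := K) J (fun α => Φ₁ κ α * F.mon α v₁)
          (fun α => Φ₂ κ' α * F.mon α v₂)
        have h2 : ∑ α ∈ box S m K, Φ₁ κ (restrict α J) * Φ₂ κ' (restrict α Jᶜ) * F.mon α v =
            (∑ α ∈ box S J.card K, Φ₁ κ α * F.mon α v₁) *
              ∑ α ∈ box S Jᶜ.card K, Φ₂ κ' α * F.mon α v₂ := by
          rw [← h1]
          refine Finset.sum_congr rfl fun α _ => ?_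
          rw [← F.mon_restrict α v J]
          ring
        rw [h2, mul_mul_mul_comm]
        congr 1 <;> rw [Finset.sum_mul] <;> exact Finset.sum_congr rfl fun α _ => mul_right_comm _ _ _
      rw [key]
      ring

/-- The contribution to the recursion of a correlator of lower genus. -/
theorem HasExp.hasResExp_handle (hS : S.IsRegular) (ha : a ∈ S.ram) {m A : ℕ} {N : ℝ}
    {f : (Fin (m + 2) → TVec X) → ℂ} (hf : F.HasExp f A fun _ => N) (hN : 0 ≤ N) :
    F.HasResExp a (fun v u => S.kernel a (v 0) u *
      f (Fin.cons u (Fin.cons (tangentMap 𝓘(ℂ) 𝓘(ℂ) (S.galois a) u) (Fin.tail v))))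
      (A + 4) fun _ : Fin (m + 1) → Index S => F.tensorConst *
        (N * (S.ram.card ^ 2 * (A + 5) * convConst)) := by
  obtain ⟨c, c1, c2⟩ := hf
  have hsp := F.special a ha
  have hρ := F.rate_pos
  have hC := convConst_pos
  refine hasResExp_quadratic hS ha (m := m) (A := A + 4)
    (Q := fun v u =>
      f (Fin.cons u (Fin.cons (tangentMap 𝓘(ℂ) 𝓘(ℂ) (S.galois a) u) v)))
    (b := fun _ => N * (S.ram.card ^ 2 * (A + 5) * convConst))
    (Y := fun κ κ' α => κ.elim (fun i => κ'.elim (fun j => c (Fin.cons i (Fin.cons j α)))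
      fun _ => 0) fun _ => 0) ?_ ?_ ?_
  · rintro (i | i) (j | j) α h
    · refine coeff_eq_zero c1 ?_
      rw [degree_cons, degree_cons]
      simp only [slotDegree] at h
      have := degree_nonneg α
      push_cast at h
      omega
    all_goals rfl
  · intro k α
    simp only [sum_slotBox, Sum.elim_inl, Sum.elim_inr, norm_zero, zero_mul,
      Finset.sum_const_zero, add_zero, slotDegree]
    -- Only the sum over the orders of `j` is a convolution. Its bound no longer depends on `i`, so
    -- the sum over `i` counts terms and produces the factor linear in `A`.
    have step : ∀ i ∈ (Finset.univ ×ˢ Finset.range (A + 4 + 1) : Finset (Index S)),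
        ∑ j ∈ (Finset.univ ×ˢ Finset.range (A + 4 + 1) : Finset (Index S)),
          ‖c (Fin.cons i (Fin.cons j α))‖ * weight F.rate (i.2 + 2 + (j.2 + 2) - k) ≤
        N * (S.ram.card * (convConst * weight F.rate ((A + 4 : ℕ) - k - degree α))) := by
      intro i _
      calc _ ≤ ∑ j ∈ (Finset.univ ×ˢ Finset.range (A + 4 + 1) : Finset (Index S)),
            N * (weight F.rate ((A - i.2 - degree α) - (j.2 : ℤ)) *
              weight F.rate ((j.2 : ℤ) - (k - i.2 - 4))) := by
            refine Finset.sum_le_sum fun j _ => ?_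
            have h1 := c1 (Fin.cons i (Fin.cons j α))
            rw [degree_cons, degree_cons, show (A : ℤ) - (i.2 + (j.2 + degree α)) =
              A - i.2 - degree α - j.2 by ring] at h1
            rw [show (i.2 : ℤ) + 2 + (j.2 + 2) - k = j.2 - (k - i.2 - 4) by ring, ← mul_assoc]
            exact mul_le_mul_of_nonneg_right h1 (weight_nonneg hρ _)
        _ ≤ ∑ x : {a // a ∈ S.ram}, N * (convConst *
              weight F.rate ((A - i.2 - degree α) - (k - i.2 - 4))) := by
            rw [Finset.sum_product]
            refine Finset.sum_le_sum fun x _ => ?_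
            rw [← Finset.mul_sum]
            exact mul_le_mul_of_nonneg_left (sum_weight_mul_weight_le hρ _ _ _
              (fun j : ℕ => (j : ℤ)) (fun _ _ _ _ h => by simpa using h)) hN
        _ = _ := by
            rw [Finset.sum_const, Finset.card_univ, Fintype.card_coe, nsmul_eq_mul]
            push_cast
            rw [show (A : ℤ) - i.2 - degree α - (k - i.2 - 4) = A + 4 - k - degree α by ring]
            ring
    refine (Finset.sum_le_sum step).trans (le_of_eq ?_)
    rw [Finset.sum_const, Finset.card_product, Finset.card_univ, Fintype.card_coe,
      Finset.card_range, nsmul_eq_mul]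
    push_cast
    ring
  · intro v hv
    refine ⟨fun _ => 0, poleAt_zero _, ?_⟩
    filter_upwards [F.eventually_off ha, tendsto_neg_nhdsNE.eventually (F.eventually_off ha),
      hsp.tangentMap_galois.filter_mono nhdsWithin_le_nhds] with z o1 o2 g1 d
    rw [tangentMap_smulVec, g1, c2 _ (OffRam.cons (by simpa using o1)
      (OffRam.cons (by simpa using o2) hv)) (A + 4) (by omega), sum_box_succ]
    simp only [sum_slotBox, Sum.elim_inl, Sum.elim_inr, zero_mul, Finset.sum_const_zero, add_zero]
    simp only [mul_neg, Finset.mul_sum, Finset.sum_mul, ← Finset.sum_neg_distrib]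
    refine Finset.sum_congr rfl fun i _ => ?_
    rw [sum_box_succ]
    refine Finset.sum_congr rfl fun j _ => Finset.sum_congr rfl fun α _ => ?_
    rw [mon_cons_cons, mon_cons_cons, form_smulVec, form_smulVec, form_smulVec]
    simp only [slotFun]
    ring

/-- The contribution to the recursion of `ω₀₂` on the diagonal. -/
theorem hasResExp_diagonal (hS : S.IsRegular) (ha : a ∈ S.ram) :
    F.HasResExp a (fun (v : Fin 1 → TVec X) u => S.kernel a (v 0) u *
      S.ω₀₂.eval u (tangentMap 𝓘(ℂ) 𝓘(ℂ) (S.galois a) u)) 2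
      fun _ => 4 * (F.R ^ 4 * F.c ^ 2) := by
  classical
  have hsp := F.special a ha
  have hR := F.R_pos
  have hcp := F.c_pos
  -- The sign comes from the differential of `z ↦ -z`.
  set q : ℂ → ℂ := fun z => -1 * S.ω₀₂.eval (coordVec (F.Z a) z) (coordVec (F.Z a) (-z)) with hq
  have hqp : PoleAt (2 : ℕ) q := hsp.poleAt_diagonal.const_mul (-1)
  have hql : PoleLE F.R 2 q F.c := by
    have h1 : PoleLE F.R 0 (fun _ => (-1 : ℂ)) 1 :=
      ⟨⟨fun _ => -1, fun _ _ => analyticAt_const, by simp⟩, by simp⟩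
    simpa [hq] using h1.mul (F.diag_le a ha) zero_le_one
  set t : ℕ → ℂ := fun k => residue (fun z => z ^ (k + 1) * (kernelFactor S (F.Z a) z * q z)) 0
    with ht
  have htk : ∀ k, ‖t k‖ ≤ 4 * (F.R ^ 4 * F.c ^ 2) * weight F.rate (2 - k) := by
    intro k
    have h0 : PoleLE F.R (-((k + 1 : ℕ) : ℤ)) (fun z => z ^ (k + 1)) (F.R ^ (k + 1)) := by
      have := poleLE_zpow (R := F.R) ((k + 1 : ℕ) : ℤ)
      simpa only [zpow_natCast] using this
    have h1 := h0.mul ((F.kernel_le a ha).mul hql hcp.le) (by positivity)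
    rcases lt_or_ge ((2 : ℤ) - k) 0 with h | h
    · rw [ht]
      simp only
      rw [(h1.poleAt hR).residue_eq_zero (by push_cast; omega), norm_zero, weight_of_neg h,
        mul_zero]
    · refine (h1.norm_residue_le hR).trans ?_
      have h2 := geometric_le_weight F.rate_pos h
      rw [show F.rate / 2 = F.R⁻¹ by unfold rate; field_simp] at h2
      calc _ = F.R ^ 4 * F.c ^ 2 * F.R⁻¹ ^ ((2 : ℤ) - k) := by
            rw [inv_zpow, ← zpow_neg, show -((2 : ℤ) - k) = k + (-2) by ring, zpow_add₀ hR.ne',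
              zpow_natCast, zpow_neg]
            norm_cast
            field_simp
            ring
        _ ≤ F.R ^ 4 * F.c ^ 2 * (4 * weight F.rate (2 - k)) := by gcongr
        _ = _ := by ring
  refine ⟨fun α => if ((α 0).1 : X) = a ∧ Even (α 0).2 then t (α 0).2 else 0, fun α => ?_,
    fun v hv => ?_⟩
  · have hd : ((2 : ℕ) : ℤ) - degree α = 2 - (α 0).2 := by simp [degree]
    rw [hd]
    beta_reduce
    split_ifs
    · exact htk _
    · rw [norm_zero]
      exact (norm_nonneg _).trans (htk (α 0).2)
  · have hv0 : (v 0).proj ≠ a := fun h => hv 0 (h ▸ ha)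
    have hres := hsp.hasResidue_kernel_mul hS ha hv0 (N := 2)
      (Q := fun u => S.ω₀₂.eval u (tangentMap 𝓘(ℂ) 𝓘(ℂ) (S.galois a) u)) hqp (by
        filter_upwards [hsp.tangentMap_galois.filter_mono nhdsWithin_le_nhds] with z g1 c
        rw [tangentMap_smulVec, g1, BiForm.eval_smulVec_left, BiForm.eval_smulVec_right,
          BiForm.eval_smulVec_right, hq]
        ring)
    refine Eq.subst (motive := fun r => HasResidue _ _ r) ?_ hres
    rw [sum_box_succ, Finset.sum_product, Finset.sum_eq_single (⟨a, ha⟩ : {a // a ∈ S.ram})]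
    · refine Finset.sum_congr rfl fun k _ => ?_
      have hb : box S 0 2 = {Fin.elim0} := by
        ext α
        simp [mem_box, Subsingleton.elim α Fin.elim0]
      rw [hb, Finset.sum_singleton, mon_cons]
      simp only [Fin.cons_zero, true_and, mon, Finset.univ_eq_empty, Finset.prod_empty, mul_one]
      split_ifs
      · rw [mul_comm]; rfl
      · simp
    · intro i _ hi
      refine Finset.sum_eq_zero fun k _ => Finset.sum_eq_zero fun α _ => ?_
      have : ¬ ((i : X) = a) := fun h => hi (Subtype.ext h)
      simp [this]
    · simp

end Frame

end Terms

/-! ### The induction on `2g - 2 + n` -/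

section Recursion

variable {X : Type*} [TopologicalSpace X] [ChartedSpace ℂ X] [IsManifold 𝓘(ℂ) ω X]
  {S : SpectralCurve X} {F : Frame S} {a : X}

namespace Frame

theorem HasExp.mono {n : ℕ} {f : (Fin n → TVec X) → ℂ} {A : ℕ} {b b' : (Fin n → Index S) → ℝ}
    (hf : F.HasExp f A b) (h : ∀ α, b α ≤ b' α) : F.HasExp f A b' := by
  obtain ⟨c, c1, c2⟩ := hf
  exact ⟨c, fun α => (c1 α).trans
    (mul_le_mul_of_nonneg_right (h α) (weight_nonneg F.rate_pos _)), c2⟩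

theorem correlator_two (S : SpectralCurve X) (v : Fin 2 → TVec X) :
    S.correlator 0 2 v = S.ω₀₂.eval (v 0) (v 1) := by
  rw [SpectralCurve.correlator]
  simp

/-- The kernel is distributed over the terms, so that each becomes a family of forms to which one of
the three residue expansions applies. -/
theorem correlator_succ (S : SpectralCurve X) {g m : ℕ} (h : 2 ≤ 2 * g + m)
    (v : Fin (m + 1) → TVec X) :
    S.correlator g (m + 1) v = ∑ a ∈ S.ram, residueAt a fun u =>
      S.kernel a (v 0) u * (if g = 0 then 0 else S.correlator (g - 1) (m + 2)
          (Fin.cons u (Fin.cons (tangentMap 𝓘(ℂ) 𝓘(ℂ) (S.galois a) u) (Fin.tail v)))) +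
        ∑ k : Fin (g + 1), ∑ J : Finset (Fin m),
          if ((k : ℕ) = 0 ∧ J.card = 0) ∨ (g - k = 0 ∧ Jᶜ.card = 0) then 0
          else S.kernel a (v 0) u *
            (S.correlator k (J.card + 1) (Fin.cons u (SpectralCurve.subTuple (Fin.tail v) J)) *
            S.correlator (g - k) (Jᶜ.card + 1)
              (Fin.cons (tangentMap 𝓘(ℂ) 𝓘(ℂ) (S.galois a) u)
                (SpectralCurve.subTuple (Fin.tail v) Jᶜ))) := by
  rw [SpectralCurve.correlator, if_neg (by omega), dif_neg (by omega)]
  refine Finset.sum_congr rfl fun a _ => ?_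
  congr 1
  funext u
  simp only [mul_add, Finset.mul_sum, mul_dite, mul_ite, mul_zero]
  rfl

/-- Slot expansions of the correlators, `ω₀₂` included. -/
theorem hasSlotExp_correlator (ha : a ∈ S.ram) {L : ℝ} (hL : 0 < L) {k j : ℕ}
    (h : ¬(k = 0 ∧ j = 0))
    (ih : 2 ≤ 2 * k + j →
      F.HasExp (S.correlator k (j + 1)) (6 * k + 2 * j - 4) fun _ => majorant L (2 * k + j)) :
    F.HasSlotExp a (fun u v => S.correlator k (j + 1) (Fin.cons u v)) (6 * k + 2 * j - 2)
      fun β : Fin j → Index S =>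
        if k = 0 ∧ j = 1 then ∑ i, (((β i).2 : ℝ) + 1) else majorant L (2 * k + j) := by
  by_cases h1 : k = 0 ∧ j = 1
  · simp only [if_pos h1]
    obtain ⟨rfl, rfl⟩ := h1
    refine hasSlotExp_fundamental ha rfl fun u v => ?_
    rw [correlator_two]
    rfl
  · simp only [if_neg h1]
    have := (ih (by omega)).hasSlotExp ha (majorant_pos hL _).le
    rwa [show 6 * k + 2 * j - 4 + 2 = 6 * k + 2 * j - 2 by omega] at this

/-- The constant in the inductive step. -/
def stepConst (F : Frame S) : ℝ :=
  12 * (F.tensorConst * (S.ram.card ^ 2 * convConst)) + 18 * (F.R ^ 4 * F.c ^ 2) +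
    F.tensorConst * (((S.ram.card + 1) * convConst) ^ 2 * (3 * convConst + 10000))

theorem stepConst_pos (F : Frame S) : 0 < F.stepConst := by
  have := F.tensorConst_pos
  have := convConst_pos
  have := F.R_pos
  have := F.c_pos
  unfold stepConst
  positivity

/-- The case `ω_{1,1}` is separate because it involves `ω_{0,2}` on the graph of the involution,
which is not a combination of products of basis forms. Otherwise the loss linear in `A` is absorbed
by the step from `P - 1` to `P`. -/
theorem hasResExp_lower_genus (hS : S.IsRegular) (ha : a ∈ S.ram) {L : ℝ} (hL : 0 < L) {g m : ℕ}
    (h : 2 ≤ 2 * g + m)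
    (ih : g ≠ 0 → 2 ≤ 2 * (g - 1) + (m + 1) → F.HasExp (S.correlator (g - 1) (m + 2))
      (6 * (g - 1) + 2 * (m + 1) - 4) fun _ => majorant L (2 * (g - 1) + (m + 1))) :
    F.HasResExp a (fun v u => S.kernel a (v 0) u * (if g = 0 then 0 else
      S.correlator (g - 1) (m + 2)
        (Fin.cons u (Fin.cons (tangentMap 𝓘(ℂ) 𝓘(ℂ) (S.galois a) u) (Fin.tail v)))))
      (6 * g + 2 * m - 4) fun _ : Fin (m + 1) → Index S =>
        (12 * (F.tensorConst * (S.ram.card ^ 2 * convConst)) + 18 * (F.R ^ 4 * F.c ^ 2)) *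
          majorant L (2 * g + m) / L := by
  have hT := F.tensorConst_pos
  have hC := convConst_pos
  have hR := F.R_pos
  have hcp := F.c_pos
  have hM := majorant_pos hL (2 * g + m)
  by_cases hg : g = 0
  · simp only [if_pos hg, mul_zero]
    exact (HasResExp.zero a _ _).mono fun α _ => by positivity
  simp only [if_neg hg]
  by_cases h1 : g = 1 ∧ m = 0
  · obtain ⟨rfl, rfl⟩ := h1
    have e : (fun (v : Fin 1 → TVec X) u => S.kernel a (v 0) u * S.correlator (1 - 1) (0 + 2)
        (Fin.cons u (Fin.cons (tangentMap 𝓘(ℂ) 𝓘(ℂ) (S.galois a) u) (Fin.tail v)))) =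
        fun v u => S.kernel a (v 0) u *
          S.ω₀₂.eval u (tangentMap 𝓘(ℂ) 𝓘(ℂ) (S.galois a) u) := by
      funext v u
      change _ * S.correlator 0 2 _ = _
      rw [correlator_two]
      rfl
    rw [e]
    refine (hasResExp_diagonal hS ha).mono fun α _ => ?_
    -- This fixes the coefficient `18` in the step constant: `18 · 2/9 = 4`, the constant of the
    -- diagonal term.
    have hm : majorant L (2 * 1 + 0) = L * 2 / 9 := by norm_num [majorant, Nat.factorial]
    rw [hm, le_div_iff₀ hL]
    have : 0 ≤ F.tensorConst * (S.ram.card ^ 2 * convConst) * L := by positivity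
    nlinarith
  · have h2 := (ih hg (by omega)).hasResExp_handle hS ha (majorant_pos hL _).le
    rw [show 6 * (g - 1) + 2 * (m + 1) - 4 + 4 = 6 * g + 2 * m - 4 by omega,
      show 2 * (g - 1) + (m + 1) = 2 * g + m - 1 by omega] at h2
    refine h2.mono fun α _ => ?_
    have h3 := majorant_pred_le hL h
    have h4 := majorant_pos hL (2 * g + m - 1)
    -- This `3`, times the `4` of `majorant_pred_le`, gives the coefficient `12` in the step
    -- constant.
    have h5 : ((6 * (g - 1) + 2 * (m + 1) - 4 : ℕ) : ℝ) + 5 ≤ 3 * (((2 * g + m : ℕ) : ℝ) + 1) := by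
      have : 6 * (g - 1) + 2 * (m + 1) - 4 + 5 ≤ 3 * (2 * g + m + 1) := by omega
      exact_mod_cast this
    rw [le_div_iff₀ hL]
    calc _ ≤ F.tensorConst * (majorant L (2 * g + m - 1) *
          (S.ram.card ^ 2 * (3 * (((2 * g + m : ℕ) : ℝ) + 1)) * convConst)) * L := by gcongr
      _ = 3 * (F.tensorConst * (S.ram.card ^ 2 * convConst)) *
          (L * ((((2 * g + m : ℕ) : ℝ) + 1) * majorant L (2 * g + m - 1))) := by ring
      _ ≤ 3 * (F.tensorConst * (S.ram.card ^ 2 * convConst)) *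
          (4 * majorant L (2 * g + m)) := by gcongr
      _ ≤ _ := by
        have : 0 ≤ 18 * (F.R ^ 4 * F.c ^ 2) * majorant L (2 * g + m) := by positivity
        nlinarith

theorem hasResExp_products (hS : S.IsRegular) (ha : a ∈ S.ram) {L : ℝ} (hL : 1 ≤ L) {g m : ℕ}
    (h : 2 ≤ 2 * g + m)
    (ih : ∀ k j, 2 ≤ 2 * k + j → 2 * k + j < 2 * g + m →
      F.HasExp (S.correlator k (j + 1)) (6 * k + 2 * j - 4) fun _ => majorant L (2 * k + j)) :
    F.HasResExp a (fun v u => ∑ k : Fin (g + 1), ∑ J : Finset (Fin m),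
      if ((k : ℕ) = 0 ∧ J.card = 0) ∨ (g - k = 0 ∧ Jᶜ.card = 0) then 0
      else S.kernel a (v 0) u *
        (S.correlator k (J.card + 1) (Fin.cons u (SpectralCurve.subTuple (Fin.tail v) J)) *
        S.correlator (g - k) (Jᶜ.card + 1)
          (Fin.cons (tangentMap 𝓘(ℂ) 𝓘(ℂ) (S.galois a) u)
            (SpectralCurve.subTuple (Fin.tail v) Jᶜ))))
      (6 * g + 2 * m - 4) fun _ : Fin (m + 1) → Index S =>
        F.tensorConst * (((S.ram.card + 1) * convConst) ^ 2 * (3 * convConst + 10000)) *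
          majorant L (2 * g + m) / L := by
  have hL0 : 0 < L := by linarith
  have hT := F.tensorConst_pos
  have hC := convConst_pos
  set x : (Fin (m + 1) → Index S) → Fin m → ℝ := fun α i => ((Fin.tail α i).2 : ℝ) + 1 with hx
  have hterm : ∀ (k : Fin (g + 1)) (J : Finset (Fin m)), F.HasResExp a (fun v u =>
      if ((k : ℕ) = 0 ∧ J.card = 0) ∨ (g - k = 0 ∧ Jᶜ.card = 0) then 0
      else S.kernel a (v 0) u *
        (S.correlator k (J.card + 1) (Fin.cons u (SpectralCurve.subTuple (Fin.tail v) J)) *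
        S.correlator (g - k) (Jᶜ.card + 1)
          (Fin.cons (tangentMap 𝓘(ℂ) 𝓘(ℂ) (S.galois a) u)
            (SpectralCurve.subTuple (Fin.tail v) Jᶜ))))
      (6 * g + 2 * m - 4) fun α => F.tensorConst * (((S.ram.card + 1) * convConst) ^ 2 *
        (if ((k : ℕ) = 0 ∧ J.card = 0) ∨ (g - k = 0 ∧ Jᶜ.card = 0) then 0 else
          factorMajorant L (x α) k J * factorMajorant L (x α) (g - k) Jᶜ)) := by
    intro k J
    by_cases hs : ((k : ℕ) = 0 ∧ J.card = 0) ∨ (g - k = 0 ∧ Jᶜ.card = 0)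
    · simp only [if_pos hs, mul_zero]
      exact HasResExp.zero a _ _
    · simp only [if_neg hs]
      obtain ⟨hs1, hs2⟩ := not_or.1 hs
      have hk := k.2
      have hJ := Finset.card_add_card_compl J
      rw [Fintype.card_fin] at hJ
      have h1 := hasSlotExp_correlator ha hL0 hs1 fun h' => ih _ _ h' (by omega)
      have h2 := hasSlotExp_correlator ha hL0 hs2 fun h' => ih _ _ h' (by omega)
      have h3 := h1.hasResExp_mul hS ha h2
        (fun β => by split_ifs; exacts [by positivity, (majorant_pos hL0 _).le])
        (fun β => by split_ifs; exacts [by positivity, (majorant_pos hL0 _).le])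
      rw [show 6 * (k : ℕ) + 2 * J.card - 2 + (6 * (g - k) + 2 * Jᶜ.card - 2) =
        6 * g + 2 * m - 4 by omega] at h3
      refine h3.mono fun α _ => le_of_eq ?_
      have e1 := sum_restrict (x α) J
      have e2 := sum_restrict (x α) Jᶜ
      unfold factorMajorant
      rw [← e1, ← e2]
      rfl
  refine (HasResExp.sum Finset.univ fun k _ => HasResExp.sum Finset.univ fun J _ =>
    hterm k J).mono fun α hα => ?_
  -- The coefficients `k + 1` coming from `ω_{0,2}` are unbounded by themselves, but the orders add
  -- up to at most `6g + 2m - 4`. With the `m` summands `1` the total is linear in `2g + m`.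
  have hsum : ∑ i, x α i ≤ 6 * (((2 * g + m : ℕ) : ℝ) + 1) := by
    have h1 : degree (Fin.tail α) ≤ ((6 * g + 2 * m - 4 : ℕ) : ℤ) := by
      rw [← Fin.cons_self_tail α, degree_cons] at hα
      omega
    have h2 : ∑ i, x α i = ((degree (Fin.tail α) : ℤ) : ℝ) + m := by
      simp [hx, degree, Finset.sum_add_distrib]
    rw [h2]
    have h3 : degree (Fin.tail α) + m ≤ 6 * (((2 * g + m : ℕ) : ℤ) + 1) := by omega
    exact_mod_cast h3
  have hkey := sum_factorMajorant_le hL h (x := x α) (fun i => by positivity) hsum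
  simp only [← Finset.mul_sum]
  rw [le_div_iff₀ hL0]
  have h4 := mul_le_mul_of_nonneg_left hkey
    (show 0 ≤ F.tensorConst * ((S.ram.card + 1) * convConst) ^ 2 by positivity)
  refine le_trans (le_of_eq ?_) (h4.trans (le_of_eq ?_)) <;> ring

/-- The correlators are combinations of products of basis forms, with factorially growing
coefficients. -/
theorem exists_hasExp_correlator (hS : S.IsRegular) (F : Frame S) :
    ∃ L : ℝ, 1 ≤ L ∧ ∀ g m : ℕ, 2 ≤ 2 * g + m → F.HasExp (S.correlator g (m + 1))
      (6 * g + 2 * m - 4) fun _ => majorant L (2 * g + m) := by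
  have hG := F.stepConst_pos
  -- Each ramification point contributes at most `stepConst / L` times the majorant, so this `L`
  -- makes their sum at most the majorant itself.
  refine ⟨1 + S.ram.card * F.stepConst, by simpa using by positivity, ?_⟩
  set L := 1 + S.ram.card * F.stepConst with hLdef
  have hL : 1 ≤ L := by simpa [hLdef] using by positivity
  have hL0 : 0 < L := by linarith
  suffices H : ∀ P g m : ℕ, 2 * g + m = P → 2 ≤ 2 * g + m → F.HasExp (S.correlator g (m + 1))
      (6 * g + 2 * m - 4) fun _ => majorant L (2 * g + m) from fun g m => H _ g m rfl
  intro P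
  induction P using Nat.strong_induction_on with
  | _ P ih =>
    intro g m hP h
    have h1 := HasExp.of_residueAt fun a (ha : a ∈ S.ram) =>
      (hasResExp_lower_genus hS ha hL0 (g := g) (m := m) h fun hg h' =>
        ih _ (by omega) (g - 1) (m + 1) rfl h').add
      (hasResExp_products hS ha hL h fun k j h' hlt => ih _ (by omega) k j rfl h')
    have h2 := h1.mono (b' := fun _ => majorant L (2 * g + m)) fun α => by
      have hM := majorant_pos hL0 (2 * g + m)
      rw [Finset.sum_const, nsmul_eq_mul, ← add_div, mul_div_assoc', div_le_iff₀ hL0]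
      calc _ = S.ram.card * F.stepConst * majorant L (2 * g + m) := by unfold stepConst; ring
        _ ≤ _ := by rw [hLdef]; nlinarith
    obtain ⟨c, c1, c2⟩ := h2
    refine ⟨c, c1, fun v hv K hK => ?_⟩
    rw [← c2 v hv K hK, correlator_succ S h]

end Frame

end Recursion

/-! ### From coefficients to values of the correlators -/

section Bounds

variable {X : Type*} [TopologicalSpace X] [ChartedSpace ℂ X] [IsManifold 𝓘(ℂ) ω X]
  {S : SpectralCurve X} {F : Frame S} {a : X}

theorem factorial_pred_le {N : ℕ} (hN : 3 ≤ N) :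
    ((N - 1).factorial : ℝ) ≤ 4 ^ N * ((N - 3).factorial : ℝ) := by
  obtain ⟨k, rfl⟩ : ∃ k, N = k + 3 := ⟨N - 3, by omega⟩
  simp only [show k + 3 - 1 = k + 2 from rfl, show k + 3 - 3 = k from rfl]
  have h : (k + 2) * (k + 1) ≤ 4 ^ (k + 3) := by
    have h1 : k + 2 < 2 ^ (k + 2) := Nat.lt_two_pow_self
    calc (k + 2) * (k + 1) ≤ 2 ^ (k + 2) * 2 ^ (k + 2) :=
          Nat.mul_le_mul h1.le (by omega)
      _ = 4 ^ (k + 2) := by rw [← mul_pow]; norm_num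
      _ ≤ 4 ^ (k + 3) := Nat.pow_le_pow_right (by norm_num) (by omega)
  rw [Nat.factorial_succ, Nat.factorial_succ, ← mul_assoc]
  push_cast
  gcongr
  exact_mod_cast h

/-- With `N = 2g + n` this replaces `(2g-1+n)!` by `(2g+n-3)! = Γ(2g-2+n)` at an exponential cost.
-/
theorem majorant_le {L : ℝ} (hL : 1 ≤ L) {N : ℕ} (hN : 3 ≤ N) :
    majorant L (N - 1) ≤ (4 * L) ^ N * ((N - 3).factorial : ℝ) := by
  unfold majorant
  have h1 := factorial_pred_le hN
  have h2 : L ^ (N - 1 - 1) ≤ L ^ N := pow_le_pow_right₀ hL (by omega)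
  calc L ^ (N - 1 - 1) * ((N - 1).factorial : ℝ) / (((N - 1 : ℕ) : ℝ) + 1) ^ 2
      ≤ L ^ (N - 1 - 1) * ((N - 1).factorial : ℝ) := by
        refine div_le_self (by positivity) (one_le_pow₀ ?_)
        have : (0 : ℝ) ≤ ((N - 1 : ℕ) : ℝ) := by positivity
        linarith
    _ ≤ L ^ N * (4 ^ N * ((N - 3).factorial : ℝ)) := by gcongr
    _ = _ := by rw [mul_pow]; ring

theorem sum_box_geometric_le (n K : ℕ) :
    ∑ α ∈ box S n K, ∏ i, (1 / 2 : ℝ) ^ (α i).2 ≤ (2 * S.ram.card + 1) ^ n := by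
  have h1 : ∑ α ∈ box S n K, ∏ i, (1 / 2 : ℝ) ^ (α i).2 =
      ∏ _i : Fin n, ∑ j ∈ (Finset.univ ×ˢ Finset.range (K + 1) : Finset (Index S)),
        (1 / 2 : ℝ) ^ j.2 := by
    rw [Finset.prod_univ_sum]
    rfl
  rw [h1, Finset.prod_const, Finset.card_univ, Fintype.card_fin]
  refine pow_le_pow_left₀ (Finset.sum_nonneg fun _ _ => by positivity) ?_ n
  rw [Finset.sum_product]
  simp only
  rw [Finset.sum_const, Finset.card_univ, Fintype.card_coe, nsmul_eq_mul]
  have h2 : ∑ k ∈ Finset.range (K + 1), (1 / 2 : ℝ) ^ k ≤ 2 := sum_geometric_two_le _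
  have h3 : (0 : ℝ) ≤ S.ram.card := by positivity
  nlinarith

theorem weight_le {ρ M : ℝ} (hρ : 0 < ρ) (hM : ρ ≤ M) (d : ℕ) : weight ρ d ≤ M ^ d := by
  rw [weight_of_nonneg (by positivity), zpow_natCast]
  refine (div_le_self (by positivity) (one_le_pow₀ ?_)).trans
    (pow_le_pow_left₀ hρ.le hM d)
  push_cast
  linarith [(Nat.cast_nonneg d : (0 : ℝ) ≤ d)]

namespace Frame

/-- Sets of tangent vectors on which the basis forms grow at most exponentially with their order. -/
structure Admissible (F : Frame S) (V : Set (TVec X)) (D : ℝ) : Prop where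
  one_le : 1 ≤ D
  off : ∀ v ∈ V, v.proj ∉ S.ram
  bound : ∀ v ∈ V, ∀ i, ‖F.form i v‖ ≤ D ^ (i.2 + 1)

theorem HasExp.norm_le {n A : ℕ} {N M : ℝ} (hN : 0 ≤ N) {f : (Fin n → TVec X) → ℂ}
    (hf : F.HasExp f A fun _ => N) (hM : F.rate ≤ M) {V : Set (TVec X)} (hV : F.Admissible V M)
    {v : Fin n → TVec X} (hv : ∀ i, v i ∈ V) :
    ‖f v‖ ≤ N * ((2 * M) ^ (A + n) * (2 * S.ram.card + 1) ^ n) := by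
  obtain ⟨c, c1, c2⟩ := hf
  have hM1 := hV.one_le
  have hM0 : 0 < M := by linarith
  rw [c2 v (fun i => hV.off _ (hv i)) A le_rfl]
  have key : ∀ α ∈ box S n A, ‖c α * F.mon α v‖ ≤
      N * ((2 * M) ^ (A + n) * ∏ i, (1 / 2 : ℝ) ^ (α i).2) := by
    intro α _
    rcases lt_or_ge (A : ℤ) (degree α) with h | h
    · rw [coeff_eq_zero c1 h, zero_mul, norm_zero]
      positivity
    · obtain ⟨d, hd⟩ := Int.eq_ofNat_of_zero_le (degree_nonneg α)
      have hdA : d ≤ A := by omega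
      have h1 : ‖c α‖ ≤ N * M ^ (A - d) := by
        refine (c1 α).trans (mul_le_mul_of_nonneg_left ?_ hN)
        rw [hd, show (A : ℤ) - d = ((A - d : ℕ) : ℤ) by omega]
        exact weight_le F.rate_pos hM _
      have hds : ∑ i, (α i).2 = d := by
        have : ((∑ i, (α i).2 : ℕ) : ℤ) = d := by rw [← hd]; simp [degree]
        exact_mod_cast this
      have h2 : ‖F.mon α v‖ ≤ M ^ (d + n) := by
        rw [mon, norm_prod]
        refine (Finset.prod_le_prod (fun i _ => norm_nonneg _)
          fun i _ => hV.bound _ (hv i) (α i)).trans (le_of_eq ?_)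
        rw [Finset.prod_pow_eq_pow_sum, Finset.sum_add_distrib, hds]
        simp
      have h3 : ∏ i, (1 / 2 : ℝ) ^ (α i).2 = (1 / 2) ^ d := by
        rw [Finset.prod_pow_eq_pow_sum, hds]
      -- Since `d ≤ A`, an exponential factor buys geometric decay in the orders. The sum over
      -- multi-indices is then at most `(2 card + 1)^n`, independently of `A`.
      have h4 : (1 : ℝ) ≤ 2 ^ (A + n) * (1 / 2) ^ d := by
        rw [show A + n = (A + n - d) + d by omega, pow_add, mul_assoc, ← mul_pow]
        norm_num
        exact one_le_pow₀ (by norm_num)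
      rw [norm_mul, h3]
      calc ‖c α‖ * ‖F.mon α v‖ ≤ N * M ^ (A - d) * M ^ (d + n) := by gcongr
        _ = N * M ^ (A + n) * 1 := by
          rw [mul_assoc, ← pow_add, show A - d + (d + n) = A + n by omega, mul_one]
        _ ≤ N * M ^ (A + n) * (2 ^ (A + n) * (1 / 2) ^ d) := by gcongr
        _ = _ := by rw [mul_pow]; ring
  refine (norm_sum_le_of_le _ key).trans ?_
  rw [← Finset.mul_sum, ← Finset.mul_sum]
  have := sum_box_geometric_le (S := S) n A
  gcongr

theorem Admissible.mono {V : Set (TVec X)} {D D' : ℝ} (h : F.Admissible V D) (hD : D ≤ D') :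
    F.Admissible V D' :=
  ⟨h.one_le.trans hD, h.off, fun v hv i => (h.bound v hv i).trans
    (pow_le_pow_left₀ (by linarith [h.one_le]) hD _)⟩

/-- Different coordinates and compact sets for different arguments reduce to a single admissible
set. The index `i₀` is needed for the constant to be at least `1`. -/
theorem Admissible.iUnion {ι : Type*} [Fintype ι] (i₀ : ι) {V : ι → Set (TVec X)} {D : ι → ℝ}
    (h : ∀ i, F.Admissible (V i) (D i)) : F.Admissible (⋃ i, V i) (∑ i, D i) := by
  have hle : ∀ i, D i ≤ ∑ i, D i := fun i => Finset.single_le_sum (f := D)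
    (fun j _ => by linarith [(h j).one_le]) (Finset.mem_univ i)
  have h' : ∀ i, F.Admissible (V i) (∑ i, D i) := fun i => (h i).mono (hle i)
  refine ⟨(h' i₀).one_le, fun v hv => ?_, fun v hv => ?_⟩
  · obtain ⟨i, hi⟩ := Set.mem_iUnion.1 hv
    exact (h' i).off v hi
  · obtain ⟨i, hi⟩ := Set.mem_iUnion.1 hv
    exact (h' i).bound v hi

/-- The central estimate: coefficients, number of terms and basis forms each cost at most an
exponential in `2g + n`, beyond one factorial. The constant `E` depends on neither `g` nor `n`. -/
theorem Admissible.norm_correlator_le (hS : S.IsRegular) {V : Set (TVec X)} {D : ℝ}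
    (hV : F.Admissible V D) :
    ∃ E : ℝ, 1 ≤ E ∧ ∀ g n : ℕ, 0 < n → 2 < 2 * g + n → ∀ v : Fin n → TVec X, (∀ i, v i ∈ V) →
      ‖S.correlator g n v‖ ≤ E ^ (2 * g + n) * ((2 * g + n - 3).factorial : ℝ) := by
  obtain ⟨L, hL, H⟩ := exists_hasExp_correlator hS F
  set M := max D F.rate
  have hV' := hV.mono (le_max_left D F.rate)
  have hM1 : 1 ≤ M := hV'.one_le
  set B : ℝ := 2 * S.ram.card + 1
  have hB : 1 ≤ B := by simp [B]
  refine ⟨4 * L * ((2 * M) ^ 4 * B), ?_, ?_⟩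
  · have h1 : 1 ≤ (2 * M) ^ 4 := one_le_pow₀ (by linarith)
    have h2 : 1 ≤ (2 * M) ^ 4 * B := one_le_mul_of_one_le_of_one_le h1 hB
    nlinarith
  · intro g n hn h v hv
    obtain ⟨m, rfl⟩ : ∃ m, n = m + 1 := ⟨n - 1, by omega⟩
    have h1 := (H g m (by omega)).norm_le (majorant_pos (by linarith) _).le (le_max_right D F.rate)
      hV' hv
    have h2 := majorant_le hL (N := 2 * g + (m + 1)) (by omega)
    -- The exponent `6g + 3m - 3` is at most `4 (2g + m + 1)`, which explains the fourth power in
    -- `E`.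
    have h3 : (2 * M) ^ (6 * g + 2 * m - 4 + (m + 1)) ≤ ((2 * M) ^ 4) ^ (2 * g + (m + 1)) := by
      rw [← pow_mul]
      exact pow_le_pow_right₀ (by linarith) (by omega)
    have h4 : B ^ (m + 1) ≤ B ^ (2 * g + (m + 1)) := pow_le_pow_right₀ hB (by omega)
    refine h1.trans ?_
    rw [show 2 * g + m = 2 * g + (m + 1) - 1 by omega]
    calc _ ≤ (4 * L) ^ (2 * g + (m + 1)) * ((2 * g + (m + 1) - 3).factorial : ℝ) *
          (((2 * M) ^ 4) ^ (2 * g + (m + 1)) * B ^ (2 * g + (m + 1))) := by gcongr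
      _ = _ := by rw [mul_pow (4 * L), mul_pow ((2 * M) ^ 4)]; ring

theorem mul_pow_le_pow_succ {Q r : ℝ} (hQ : 0 ≤ Q) (hr : 0 ≤ r) (l : ℕ) :
    Q * r ^ l ≤ ((1 + Q) * (1 + r)) ^ (l + 1) := by
  rw [mul_pow, pow_succ (1 + Q), pow_succ (1 + r)]
  have h1 : 1 ≤ (1 + Q) ^ l := one_le_pow₀ (by linarith)
  have h2 : r ^ l ≤ (1 + r) ^ l := pow_le_pow_left₀ hr (by linarith) l
  have h3 : 0 ≤ (1 + r) ^ l := by positivity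
  calc Q * r ^ l ≤ (1 * (1 + Q)) * ((1 + r) ^ l * 1) := by gcongr <;> linarith
    _ ≤ _ := by gcongr; linarith

/-- A small closed disc about `a` misses `K`, so `ω_{0,2}` is bounded on the product of `K` with it.
Cauchy estimates in the second variable give exponential growth in `l`, uniformly on `K`. -/
theorem exists_bound_form [T2Space X] (F : Frame S) (ha : a ∈ S.ram)
    {Z : OpenPartialHomeomorph X ℂ} (hZ : Z ∈ IsManifold.maximalAtlas 𝓘(ℂ) ω X) {K : Set X}
    (hK : IsCompact K) (hKZ : K ⊆ Z.source) (haK : a ∉ K) :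
    ∃ D : ℝ, 1 ≤ D ∧ ∀ z ∈ K, ∀ l : ℕ,
      ‖basisForm S (F.Z a) l (coordVec Z (Z z))‖ ≤ D ^ (l + 1) := by
  have hsp := F.special a ha
  have hev := (eventually_nhdsGT_closedBall ((hsp.tendsto_symm.eventually
    (hK.isClosed.isOpen_compl.mem_nhds haK)).and hsp.eventually_mem)).and self_mem_nhdsWithin
  obtain ⟨ρ, h1, (hρ : 0 < ρ)⟩ := hev.exists
  set h : ℂ × ℂ → ℂ := fun w => S.ω₀₂.eval (coordVec Z w.1) (coordVec (F.Z a) w.2)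
  have hh : AnalyticOnNhd ℂ h ((Z '' K) ×ˢ closedBall 0 ρ) := by
    rintro ⟨w, z⟩ ⟨⟨p, hp, rfl⟩, hz⟩
    refine S.fundamental.holomorphic Z hZ _ hsp.mem _ ⟨Z.map_source (hKZ hp), (h1 z hz).2, ?_⟩
    simp only
    rw [Z.left_inv (hKZ hp)]
    exact fun e => (h1 z hz).1 (e ▸ hp)
  obtain ⟨M, hM⟩ := ((hK.image_of_continuousOn (Z.continuousOn.mono hKZ)).prod
    (isCompact_closedBall (0 : ℂ) ρ)).exists_bound_of_continuousOn hh.continuousOn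
  refine ⟨(1 + |M|) * (1 + ρ⁻¹), ?_, fun z hz l => ?_⟩
  · have := abs_nonneg M
    have : 0 < ρ⁻¹ := by positivity
    nlinarith
  · refine le_trans ?_ (mul_pow_le_pow_succ (abs_nonneg M) (by positivity) l)
    have hd : DiffContOnCl ℂ (fun w => h (Z z, w)) (ball 0 ρ) := by
      refine DifferentiableOn.diffContOnCl ?_
      rw [closure_ball _ hρ.ne']
      intro w hw
      have ha : AnalyticAt ℂ (fun w : ℂ => (Z z, w)) w := analyticAt_const.prod analyticAt_id
      exact (AnalyticAt.comp (g := h) (f := fun w : ℂ => (Z z, w))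
        (hh (Z z, w) ⟨⟨z, hz, rfl⟩, hw⟩) ha).differentiableAt.differentiableWithinAt
    have := Complex.norm_iteratedDeriv_le_of_forall_mem_sphere_norm_le l hρ hd
      (C := |M|) fun w hw => (hM (Z z, w) ⟨⟨z, hz, rfl⟩, sphere_subset_closedBall hw⟩).trans
        (le_abs_self M)
    unfold basisForm
    rw [norm_div, Complex.norm_natCast, div_le_iff₀ (by positivity)]
    refine this.trans ?_
    rw [inv_pow, ← div_eq_mul_inv, mul_div_assoc, mul_comm]
    gcongr
    exact Nat.le_succ l

/-- Compact subsets of a coordinate domain without ramification points are admissible. -/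
theorem exists_admissible_of_isCompact [T2Space X] (F : Frame S) {Z : OpenPartialHomeomorph X ℂ}
    (hZ : Z ∈ IsManifold.maximalAtlas 𝓘(ℂ) ω X) (hdisj : Disjoint Z.source (S.ram : Set X))
    {K : Set X} (hK : IsCompact K) (hKZ : K ⊆ Z.source) :
    ∃ D, F.Admissible ((fun z => coordVec Z (Z z)) '' K) D := by
  have hex : ∀ b : {b // b ∈ S.ram}, ∃ D : ℝ, 1 ≤ D ∧ ∀ z ∈ K, ∀ l : ℕ,
      ‖basisForm S (F.Z b) l (coordVec Z (Z z))‖ ≤ D ^ (l + 1) := fun b =>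
    F.exists_bound_form b.2 hZ hK hKZ fun h => Set.disjoint_left.1 hdisj (hKZ h) b.2
  choose D hD1 hD using hex
  have hle : ∀ b, D b ≤ 1 + ∑ b, D b := fun b => by
    have := Finset.single_le_sum (f := D) (fun b _ => by linarith [hD1 b]) (Finset.mem_univ b)
    linarith
  refine ⟨1 + ∑ b, D b, ?_, ?_, ?_⟩
  · have : 0 ≤ ∑ b, D b := Finset.sum_nonneg fun b _ => by linarith [hD1 b]
    linarith
  · rintro _ ⟨z, hz, rfl⟩ h
    rw [coordVec_proj, Z.left_inv (hKZ hz)] at h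
    exact Set.disjoint_left.1 hdisj (hKZ hz) h
  · rintro _ ⟨z, hz, rfl⟩ i
    exact (hD i.1 z hz i.2).trans (pow_le_pow_left₀ (by linarith [hD1 i.1]) (hle i.1) _)

/-- The circles of radius `R` about the ramification points are admissible. -/
theorem exists_admissible_circles (F : Frame S) :
    ∃ D, F.Admissible {v | ∃ a ∈ S.ram, ∃ z ∈ sphere (0 : ℂ) F.R, v = coordVec (F.Z a) z} D := by
  have hR := F.R_pos
  have hc := F.c_pos
  refine ⟨(1 + F.c * F.R⁻¹ ^ 2) * (1 + F.R⁻¹), ?_, ?_, ?_⟩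
  · exact one_le_mul_of_one_le_of_one_le (by simpa using by positivity) (by simpa using hR.le)
  · rintro _ ⟨a, ha, z, hz, rfl⟩
    refine F.off a ha z (sphere_subset_closedBall hz) ?_
    rintro rfl
    simp at hz
    linarith
  · rintro _ ⟨a, ha, z, hz, rfl⟩ i
    refine le_trans ?_ (mul_pow_le_pow_succ (by positivity) (by positivity) i.2)
    refine ((F.basis_le a ha i.1 i.1.2 i.2).2 z hz).trans (le_of_eq ?_)
    rw [show -((i.2 : ℤ) + 2) = -((i.2 + 2 : ℕ) : ℤ) by push_cast; ring, zpow_neg, zpow_natCast,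
      pow_add, inv_pow, inv_pow]
    field_simp

end Frame

end Bounds

/-! ### Free energies -/

theorem poleLE_zero (R : ℝ) (d : ℤ) : PoleLE R d (fun _ => 0) 0 :=
  ⟨⟨fun _ => 0, fun _ _ => analyticAt_const, by simp⟩, by simp⟩

theorem PoleLE.const_mul {R : ℝ} {d : ℤ} {f : ℂ → ℂ} {M : ℝ} (c : ℂ) (hf : PoleLE R d f M) :
    PoleLE R d (fun z => c * f z) (‖c‖ * M) := by
  have h : PoleLE R 0 (fun _ => c) ‖c‖ := ⟨⟨fun _ => c, fun _ _ => analyticAt_const, by simp⟩,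
    by simp⟩
  simpa using h.mul hf (norm_nonneg c)

theorem exists_poleLE_sum {ι : Type*} {R : ℝ} {d : ℤ} {s : Finset ι} {f : ι → ℂ → ℂ}
    (hf : ∀ i ∈ s, ∃ M, PoleLE R d (f i) M) : ∃ M, PoleLE R d (fun z => ∑ i ∈ s, f i z) M := by
  classical
  induction s using Finset.induction_on with
  | empty => exact ⟨0, by simpa using poleLE_zero R d⟩
  | insert i s hi ih =>
    obtain ⟨M, hM⟩ := hf i (by simp)
    obtain ⟨N, hN⟩ := ih fun j hj => hf j (by simp [hj])
    exact ⟨M + N, by simpa only [Finset.sum_insert hi] using hM.add hN⟩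

section FreeEnergies

variable {X : Type*} [TopologicalSpace X] [ChartedSpace ℂ X] [IsManifold 𝓘(ℂ) ω X]
  {S : SpectralCurve X} {F : Frame S} {a : X}

/-- The residues which make up the free energies. -/
theorem Frame.HasExp.norm_residueAt_action_le (ha : a ∈ S.ram) {A : ℕ}
    {b : (Fin 1 → Index S) → ℝ} {f : (Fin 1 → TVec X) → ℂ} (hf : F.HasExp f A b) {M : ℝ}
    (hM : ∀ z ∈ sphere (0 : ℂ) F.R, ‖f ![coordVec (F.Z a) z]‖ ≤ M) :
    ‖residueAt a fun u =>
      localIntegral a (fun v => S.y v.proj * S.dx.eval v) a u.proj * f ![u]‖ ≤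
      F.R * (F.c * M) := by
  obtain ⟨c, c1, c2⟩ := hf
  have hsp := F.special a ha
  have hc := IsManifold.chart_mem_maximalAtlas (I := 𝓘(ℂ)) (n := ω) a
  have hs := mem_chart_source ℂ a
  have ht := mem_chart_target ℂ a
  set φ := chartAt ℂ a
  set Z := F.Z a
  have hfz : ∀ u : TVec X, u.proj ∉ S.ram → f ![u] = ∑ α ∈ box S 1 A, c α * F.form (α 0) u :=
    fun u hu => by
      rw [c2 _ (fun i => by rwa [Subsingleton.elim i 0]) A le_rfl]
      simp [Frame.mon]
  have hoff : ∀ z ∈ closedBall (0 : ℂ) F.R, z ≠ 0 → (coordVec Z z).proj ∉ S.ram :=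
    F.off a ha
  obtain ⟨N, hN⟩ : ∃ N, PoleLE F.R (A + 2)
      (fun z => ∑ α ∈ box S 1 A, c α * F.form (α 0) (coordVec Z z)) N := by
    refine exists_poleLE_sum fun α hα => ⟨_, ((F.basis_le a ha _ (α 0).1.2 _).mono ?_
      le_rfl).const_mul (c α)⟩
    have := mem_box.1 hα 0
    omega
  -- The expansion is used only to know that the singularity at `a` is a pole. The bound on the
  -- circle is the hypothesis `hM`, not the one coming from the expansion.
  have hP : PoleLE F.R (A + 2) (fun z => f ![coordVec Z z]) M :=
    ⟨(hN.congr F.R_pos fun z hz h0 => hfz _ (hoff z hz h0)).1, hM⟩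
  have hG := (F.action_le a ha).mul hP F.c_pos.le
  refine le_trans (le_of_eq ?_) (hG.norm_residue_le F.R_pos)
  congr 1
  have hs' : φ.symm (φ a) ∈ Z.source := by rw [φ.left_inv hs]; exact hsp.mem_source
  have hκ := analyticAt_transition hsp.mem hc ht hs'
  have hκ0 : Z (φ.symm (φ a)) = 0 := by rw [φ.left_inv hs, hsp.map_eq]
  have hκ1 := deriv_transition_ne_zero hsp.mem hc ht hs'
  refine ((hG.poleAt F.R_pos).residue_comp hκ hκ0 hκ1 ?_).residue_eq
  have hev : ∀ᶠ w in 𝓝 (φ a), w ∈ φ.target ∧ φ.symm w ∈ Z.source :=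
    (φ.open_target.eventually_mem ht).and ((φ.continuousAt_symm ht).eventually
      (Z.open_source.mem_nhds hs'))
  have hκt : Tendsto (fun w => Z (φ.symm w)) (𝓝 (φ a)) (𝓝 0) := by
    have := hκ.continuousAt.tendsto
    rwa [hκ0] at this
  filter_upwards [hev.filter_mono nhdsWithin_le_nhds,
    (hκt.eventually (closedBall_mem_nhds (0 : ℂ) F.R_pos)).filter_mono nhdsWithin_le_nhds,
    self_mem_nhdsWithin] with w e1 e2 e3
  have e4 : Z (φ.symm w) ≠ 0 := fun h => e3 (by
    have e5 := Z.injOn e1.2 hsp.mem_source (h.trans hsp.map_eq.symm)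
    rw [Set.mem_singleton_iff, ← e5, φ.right_inv e1.1])
  have e5 := hoff _ e2 e4
  rw [coordVec_eq_smulVec hsp.mem hc e1.1 e1.2, hfz _ (by simpa using e5), hfz _ e5]
  simp only [Frame.form_smulVec, smulVec_proj, coordVec_proj, Finset.mul_sum]
  refine Finset.sum_congr rfl fun α _ => ?_
  ring

/-- On circles about the ramification points `ω_{g,1}` is bounded by `E^(2g+1) (2g-2)!`. Dividing by
`2g - 2` leaves `(2g-3)! = Γ(2g-2)`. -/
theorem Frame.exists_norm_freeEnergy_le (hS : S.IsRegular) (F : Frame S) :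
    ∃ S₀ A₀ : ℝ, 0 < S₀ ∧ 0 < A₀ ∧ ∀ g : ℕ, 2 ≤ g →
      ‖S.freeEnergy g‖ ≤ S₀ * Real.Gamma (2 * (g : ℝ) - 2) / A₀ ^ (2 * g - 2) := by
  obtain ⟨D, hD⟩ := F.exists_admissible_circles
  obtain ⟨E, hE, hb⟩ := hD.norm_correlator_le hS
  obtain ⟨L, hL, H⟩ := Frame.exists_hasExp_correlator hS F
  have hR := F.R_pos
  have hc := F.c_pos
  have hE0 : 0 < E := by linarith
  -- Of `E^(2g+1)` the part `E^(2g-2)` is the exponential rate and `E^3` goes into the constant.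
  -- Adding `1` ensures positivity when there is no ramification point.
  refine ⟨S.ram.card * (F.R * (F.c * E ^ 3)) + 1, E⁻¹, by positivity, by positivity,
    fun g hg => ?_⟩
  obtain ⟨k, rfl⟩ : ∃ k, g = k + 2 := ⟨g - 2, by omega⟩
  have hΓ : Real.Gamma (2 * ((k + 2 : ℕ) : ℝ) - 2) = ((2 * k + 1).factorial : ℝ) := by
    rw [← Real.Gamma_nat_eq_factorial]
    congr 1
    push_cast
    ring
  have h1 : ∀ a ∈ S.ram, ‖residueAt a fun u =>
      localIntegral a (fun v => S.y v.proj * S.dx.eval v) a u.proj *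
        S.correlator (k + 2) 1 ![u]‖ ≤
      F.R * (F.c * (E ^ (2 * (k + 2) + 1) * ((2 * (k + 2) + 1 - 3).factorial : ℝ))) :=
    fun a ha => (H (k + 2) 0 (by omega)).norm_residueAt_action_le ha fun z hz =>
      hb (k + 2) 1 one_pos (by omega) _ fun i => ⟨a, ha, z, hz, by simp⟩
  have h2 := (norm_sum_le _ _).trans (Finset.sum_le_sum h1)
  have h3 : ‖1 / (2 - 2 * ((k + 2 : ℕ) : ℂ))‖ = 1 / (2 * (k : ℝ) + 2) := by
    rw [show (2 - 2 * ((k + 2 : ℕ) : ℂ)) = -((2 * k + 2 : ℕ) : ℂ) by push_cast; ring, norm_div,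
      norm_neg, Complex.norm_natCast, norm_one]
    push_cast
    rfl
  rw [SpectralCurve.freeEnergy, norm_mul, h3, hΓ]
  rw [Finset.sum_const, nsmul_eq_mul] at h2
  have h4 : ((2 * (k + 2) + 1 - 3).factorial : ℝ) = (2 * k + 2) * ((2 * k + 1).factorial : ℝ) := by
    rw [show 2 * (k + 2) + 1 - 3 = 2 * k + 1 + 1 by omega, Nat.factorial_succ]
    push_cast
    ring
  rw [h4] at h2
  calc _ ≤ 1 / (2 * (k : ℝ) + 2) * (S.ram.card * (F.R * (F.c * (E ^ (2 * (k + 2) + 1) *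
        ((2 * k + 2) * ((2 * k + 1).factorial : ℝ)))))) := by gcongr
    _ = S.ram.card * (F.R * (F.c * E ^ 3)) * ((2 * k + 1).factorial : ℝ) /
        E⁻¹ ^ (2 * (k + 2) - 2) := by
      rw [show 2 * (k + 2) - 2 = 2 * k + 2 by omega, inv_pow, div_inv_eq_mul]
      field_simp
      ring
    _ ≤ _ := by
      gcongr
      linarith

end FreeEnergies

/-! ### Comparison with the stated forms of the bound -/

theorem factorial_trinomial_le (i j k : ℕ) :
    (i.factorial : ℝ) * (j.factorial : ℝ) * (k.factorial : ℝ) ≤ ((i + j + k).factorial : ℝ) := by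
  have h1 := Nat.le_of_dvd (Nat.factorial_pos _) (Nat.factorial_mul_factorial_dvd_factorial_add i j)
  have h2 := Nat.le_of_dvd (Nat.factorial_pos _)
    (Nat.factorial_mul_factorial_dvd_factorial_add (i + j) k)
  exact_mod_cast (Nat.mul_le_mul_right _ h1).trans h2

theorem le_gamma_div {E x : ℝ} {g n : ℕ} (h : 2 < 2 * g + n)
    (hx : x ≤ E ^ (2 * g + n) * ((2 * g + n - 3).factorial : ℝ)) :
    x ≤ E ^ 2 * Real.Gamma (2 * (g : ℝ) - 2 + n) / E⁻¹ ^ (2 * g + n - 2) := by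
  have hΓ : Real.Gamma (2 * (g : ℝ) - 2 + n) = ((2 * g + n - 3).factorial : ℝ) := by
    rw [← Real.Gamma_nat_eq_factorial, Nat.cast_sub (by omega)]
    congr 1
    push_cast
    ring
  refine hx.trans (le_of_eq ?_)
  rw [hΓ, inv_pow, div_inv_eq_mul, show 2 * g + n = 2 + (2 * g + n - 2) by omega, pow_add,
    show 2 + (2 * g + n - 2) - 2 = 2 * g + n - 2 by omega,
    show 2 + (2 * g + n - 2) - 3 = 2 * g + n - 3 by omega]
  ring

/-- The factorial bound is the weaker one: `g! n! (2g+n-3)! ≤ (3g+2n-3)!`, because a trinomial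
coefficient is at least `1`. -/
theorem le_factorial_div {E x : ℝ} (hE : 1 ≤ E) {g n : ℕ} (h : 2 < 2 * g + n)
    (hx : x ≤ E ^ (2 * g + n) * ((2 * g + n - 3).factorial : ℝ)) :
    x ≤ 1 * ((3 * g + 2 * n - 3).factorial : ℝ) /
      ((E ^ 2)⁻¹ ^ g * E⁻¹ ^ n * (g.factorial : ℝ) * (n.factorial : ℝ)) := by
  have hE0 : 0 < E := by linarith
  have h1 := factorial_trinomial_le g n (2 * g + n - 3)
  rw [show g + n + (2 * g + n - 3) = 3 * g + 2 * n - 3 by omega] at h1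
  refine hx.trans ?_
  rw [le_div_iff₀ (by positivity), one_mul]
  refine le_trans (le_of_eq ?_) h1
  rw [pow_add, inv_pow, inv_pow, ← pow_mul]
  field_simp

end TopRec

end

theorem mainTheorem1 {X : Type*} [TopologicalSpace X] [T2Space X] [ChartedSpace ℂ X]
    [IsManifold 𝓘(ℂ) ω X] (S : TopRec.SpectralCurve X) (hS : S.IsRegular) :
    -- one local coordinate `Z` on an open set avoiding the ramification points, a compact `K`
    (∀ Z ∈ IsManifold.maximalAtlas 𝓘(ℂ) ω X, Disjoint Z.source (S.ram : Set X) →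
      ∀ K : Set X, IsCompact K → K ⊆ Z.source →
        (∃ T B C : ℝ, 0 < T ∧ 0 < B ∧ 0 < C ∧
          ∀ g n : ℕ, 0 < n → 2 < 2 * g + n → ∀ z : Fin n → X, (∀ i, z i ∈ K) →
            ‖S.correlatorCoeff g (fun _ => Z) z‖ ≤
              T * ((3 * g + 2 * n - 3).factorial : ℝ) /
                (B ^ g * C ^ n * (g.factorial : ℝ) * (n.factorial : ℝ))) ∧
        (∃ A : ℝ, 0 < A ∧ ∀ n : ℕ, 0 < n → ∃ Sₙ : ℝ, 0 < Sₙ ∧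
          ∀ g : ℕ, 2 < 2 * g + n → ∀ z : Fin n → X, (∀ i, z i ∈ K) →
            ‖S.correlatorCoeff g (fun _ => Z) z‖ ≤
              Sₙ * Real.Gamma (2 * (g : ℝ) - 2 + n) / A ^ (2 * g + n - 2))) ∧
    -- fixed `n`, with possibly different local coordinates and compacts
    (∀ n : ℕ, 0 < n → ∀ Z : Fin n → OpenPartialHomeomorph X ℂ,
      (∀ i, Z i ∈ IsManifold.maximalAtlas 𝓘(ℂ) ω X ∧ Disjoint (Z i).source (S.ram : Set X)) →
      ∀ K : Fin n → Set X, (∀ i, IsCompact (K i) ∧ K i ⊆ (Z i).source) →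
        ∃ Sₙ A : ℝ, 0 < Sₙ ∧ 0 < A ∧
          ∀ g : ℕ, 2 < 2 * g + n → ∀ z : Fin n → X, (∀ i, z i ∈ K i) →
            ‖S.correlatorCoeff g Z z‖ ≤
              Sₙ * Real.Gamma (2 * (g : ℝ) - 2 + n) / A ^ (2 * g + n - 2)) ∧
    -- the free energies
    (∃ S₀ A₀ : ℝ, 0 < S₀ ∧ 0 < A₀ ∧ ∀ g : ℕ, 2 ≤ g →
      ‖S.freeEnergy g‖ ≤ S₀ * Real.Gamma (2 * (g : ℝ) - 2) / A₀ ^ (2 * g - 2)) := by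
  obtain ⟨F⟩ := TopRec.exists_frame S hS
  refine ⟨fun Z hZ hdisj K hK hKZ => ?_, fun n hn Z hZ K hK => ?_, F.exists_norm_freeEnergy_le hS⟩
  · obtain ⟨D, hD⟩ := F.exists_admissible_of_isCompact hZ hdisj hK hKZ
    obtain ⟨E, hE, hb⟩ := hD.norm_correlator_le hS
    have hE0 : 0 < E := by linarith
    refine ⟨⟨1, (E ^ 2)⁻¹, E⁻¹, one_pos, by positivity, by positivity, fun g n hn h z hz => ?_⟩,
      ⟨E⁻¹, by positivity, fun n hn => ⟨E ^ 2, by positivity, fun g h z hz => ?_⟩⟩⟩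
    · exact TopRec.le_factorial_div hE h (hb g n hn h _ fun i => ⟨z i, hz i, rfl⟩)
    · exact TopRec.le_gamma_div h (hb g n hn h _ fun i => ⟨z i, hz i, rfl⟩)
  · have hex : ∀ i, ∃ D, F.Admissible
        ((fun z => TopRec.coordVec (Z i) (Z i z)) '' K i) D := fun i =>
      F.exists_admissible_of_isCompact (hZ i).1 (hZ i).2 (hK i).1 (hK i).2
    choose D hD using hex
    -- All coordinate vectors over all the `K i` form one admissible set; `0 < n` makes the union
    -- nonempty as a family.
    obtain ⟨E, hE, hb⟩ := (TopRec.Frame.Admissible.iUnion ⟨0, hn⟩ hD).norm_correlator_le hS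
    have hE0 : 0 < E := by linarith
    refine ⟨E ^ 2, E⁻¹, by positivity, by positivity, fun g h z hz => ?_⟩
    exact TopRec.le_gamma_div h (hb g n hn h _ fun i => Set.mem_iUnion.2 ⟨i, z i, hz i, rfl⟩)
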